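/- Let $n\ge 3$, let $I\subset(0,\infty)$ be an open interval and let $f:I\to(0,\infty)$ be a smooth function with \[ \frac{f^2-1}{r^2}-\frac{ff'}{r}\le 0 \quad\text{on } I. \tag{1}\] Let $V=\mathbb{R}\times I\times S^{n-1}$ carry the metric $\bar g=\langle\cdot,\cdot\rangle=-f^2dt^2+f^{-2}dr^2+r^2g_{S^{n-1}}$ with Levi-Civita connection $D$, let $r^*$ be an antiderivative of $1/f^2$ on $I$, and let $\Sigma$ be a spacelike codimension 2 submanifold of the outgoing standard null cone $t-r^*=w_0$, given as a graph $x\mapsto (t=w_0+r^*(r(x)),\,r=r(x),\,x)$ over $S^{n-1}$ with $r:S^{n-1}\to I$ smooth. Let $L=\frac{r}{f^2}\left(\partial_t+f^2\partial_r\right)$ be the null normal of $\Sigma$ tangent to the cone, and let $\underline L$ be the null normal of $\Sigma$ with $\langle L,\underline L\rangle=-2$. Let $\underline{\mathcal C}(\Sigma)$ be the incoming null hypersurface generated near $\Sigma$ by the affinely parametrized null geodesics starting from $\Sigma$ with velocity $\underline L$, and extend $\underline L$ to it as their velocity field. A function $U$ on $S^{n-1}$ is called an infinitesimal variation preserving $\alpha_H=-d\log|H|$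 if there is a smooth variation $F(x,s)$ of $\Sigma=F(S^{n-1},0)$ inside $\underline{\mathcal C}(\Sigma)$ with $\partial_sF(x,0)=U(x)\underline L$, and smooth null normals $\underline L(s)=\psi(x,s)\underline L$ and $L(s)$ of $F(S^{n-1},s)$ with $\langle L(s),\underline L(s)\rangle=-2$, $\psi(x,0)=1$ and $L(0)=L$, such that \[ \frac{\partial}{\partial s}\Big|_{s=0}\partial_a\operatorname{tr}\chi=0,\qquad \frac{\partial}{\partial s}\Big|_{s=0}\langle D_a\underline L(s),L(s)\rangle=0, \] where $\chi_{ab}=\langle D_aL(s),\partial_bF\rangle$ and the trace is taken with respect to the induced metric of $F(S^{n-1},s)$. Then $\Sigma$ is infinitesimally rigid: every such $U$ is a constant multiple of $r$, except that, if the spacetime is a Lorentz space form along $\Sigma$, i.e. equality holds in (1) at $r(x)$ for every $x\in S^{n-1}$, $U$ may instead be $r$ times a function supported in the $\ell\le1$ modes, i.e. a function $a_0+\sum_{i=1}^n a_i\tilde X^i$ with constants $a_0,\dots,a_n$, where $\tilde X^i$ are the restrictions to $S^{n-1}$ of the Cartesian coordinates of $\mathbb{R}^n$. -/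

import Mathlib

open Set
open scoped ContDiff

noncomputable section

namespace StaticNullCone

/-! ### Calculus on the unit sphere of `ℝⁿ`

A map on `S^{n-1}` is represented by a map `u` on `ℝⁿ` of which only the values at unit vectors
matter: every definition below sees `u` only through its radial extension `y ↦ u (y / ‖y‖)`. -/

/-- Cartesian `n`-space; `S^{n-1}` is its unit sphere. -/
abbrev Space (n : ℕ) : Type := EuclideanSpace ℝ (Fin n)

/-- The extension, constant along rays, of a map on the unit sphere. -/
def radialExt {n : ℕ} {W : Type*} (u : Space n → W) (y : Space n) : W := u (‖y‖⁻¹ • y)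

/-- `u` is a smooth map on the unit sphere. -/
def SphereSmooth {n : ℕ} {W : Type*} [NormedAddCommGroup W] [NormedSpace ℝ W]
    (u : Space n → W) : Prop :=
  ContDiffOn ℝ ∞ (radialExt u) {0}ᶜ

/-- `(s, x) ↦ u s x` is a smooth map on `J × S^{n-1}`, for an open set `J` of parameters. -/
def SphereSmoothFamily {n : ℕ} {W : Type*} [NormedAddCommGroup W] [NormedSpace ℝ W]
    (J : Set ℝ) (u : ℝ → Space n → W) : Prop :=
  ContDiffOn ℝ ∞ (fun q : ℝ × Space n => radialExt (u q.1) q.2) (J ×ˢ {0}ᶜ)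

/-- The derivative at the unit vector `x` of a map on the sphere, in the direction of the tangent
vector `X ⟂ x`. -/
def sphereDeriv {n : ℕ} {W : Type*} [NormedAddCommGroup W] [NormedSpace ℝ W]
    (u : Space n → W) (x X : Space n) : W :=
  fderiv ℝ (radialExt u) x X

/-! ### The spacetime -/

/-- Events `(t, y)`. The point of `S^{n-1}` and the area radius `r` are `y / ‖y‖` and `‖y‖`. -/
abbrev Event (n : ℕ) : Type := ℝ × Space n

/-- The warping factor `f : I → (0,∞)`, with the differential inequality. If the spacetime has a
centre `r = 0`, it is left out of `I`, since a spacelike hypersurface of a standard null cone does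
not meet it. -/
structure IsWarpingFactor (I : Set ℝ) (f : ℝ → ℝ) : Prop where
  isOpen : IsOpen I
  ordConnected : I.OrdConnected
  radius_pos : I ⊆ Ioi 0
  smooth : ContDiffOn ℝ ∞ f I
  pos : ∀ r ∈ I, 0 < f r
  inequality : ∀ r ∈ I, (f r ^ 2 - 1) / r ^ 2 - f r * deriv f r / r ≤ 0

/-- The domain `{r ∈ I}` of the spacetime. -/
def region (n : ℕ) (I : Set ℝ) : Set (Event n) := {p | ‖p.2‖ ∈ I}

/-- The one-form `dr`. -/
def dr {n : ℕ} (p X : Event n) : ℝ := inner ℝ p.2 X.2 / ‖p.2‖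

/-- The metric `-f² dt² + f⁻² dr² + r² g_{S^{n-1}}`. Here `r² g_{S^{n-1}} = |dy|² - dr²`, because
`|dy|² = dr² + r² g_{S^{n-1}}` is the Euclidean metric in polar coordinates. -/
def metric {n : ℕ} (f : ℝ → ℝ) (p X Y : Event n) : ℝ :=
  -(f ‖p.2‖ ^ 2) * (X.1 * Y.1) + (dr p X * dr p Y) / f ‖p.2‖ ^ 2
    + (inner ℝ X.2 Y.2 - dr p X * dr p Y)

/-- The Christoffel symbols of the first kind of the metric: `⟨D_A B, Z⟩` for the Levi-Civita
connection `D` and vector fields `A`, `B`, `Z` that are constant in the coordinates `(t, y)`. -/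
def christoffel {n : ℕ} (f : ℝ → ℝ) (p A B Z : Event n) : ℝ :=
  (fderiv ℝ (fun q => metric f q B Z) p A + fderiv ℝ (fun q => metric f q A Z) p B
    - fderiv ℝ (fun q => metric f q A B) p Z) / 2

/-- `⟨D_X W, Z⟩` at `x`, where `W` is a vector field along the map `F` from the sphere to the
spacetime and `X` is tangent to the sphere at `x`. -/
def covInner {n : ℕ} (f : ℝ → ℝ) (F W : Space n → Event n) (x X : Space n) (Z : Event n) : ℝ :=
  metric f (F x) (sphereDeriv W x X) Z + christoffel f (F x) (sphereDeriv F x X) (W x) Z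

/-- The acceleration `D_γ' γ'` of the curve `γ` at the parameter `τ`, paired with `Z`. -/
def accelInner {n : ℕ} (f : ℝ → ℝ) (γ : ℝ → Event n) (τ : ℝ) (Z : Event n) : ℝ :=
  metric f (γ τ) (deriv (deriv γ) τ) Z + christoffel f (γ τ) (deriv γ τ) (deriv γ τ) Z

/-! ### Codimension two submanifolds `F(S^{n-1})` -/

/-- `L`, `Lbar` are null normal fields along `F(S^{n-1})` with `⟨L, Lbar⟩ = -2`. -/
structure IsNullFrame {n : ℕ} (f : ℝ → ℝ) (F L Lbar : Space n → Event n) : Prop where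
  null : ∀ x, ‖x‖ = 1 → metric f (F x) (L x) (L x) = 0
  null_bar : ∀ x, ‖x‖ = 1 → metric f (F x) (Lbar x) (Lbar x) = 0
  normalized : ∀ x, ‖x‖ = 1 → metric f (F x) (L x) (Lbar x) = -2
  normal : ∀ x X, ‖x‖ = 1 → inner ℝ x X = 0 → metric f (F x) (L x) (sphereDeriv F x X) = 0
  normal_bar : ∀ x X, ‖x‖ = 1 → inner ℝ x X = 0 →
    metric f (F x) (Lbar x) (sphereDeriv F x X) = 0

/-- The matrix, in the standard basis of `ℝⁿ = ℝx ⊕ T_x S^{n-1}`, of the orthogonal sum of the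
square of `⟨x, ·⟩` and the induced metric `σ(X, Y) = ⟨dF X, dF Y⟩`. Note that
`sphereDeriv F x` vanishes on `x`. -/
def gramMatrix {n : ℕ} (f : ℝ → ℝ) (F : Space n → Event n) (x : Space n) :
    Matrix (Fin n) (Fin n) ℝ :=
  Matrix.of fun i j => x i * x j + metric f (F x)
    (sphereDeriv F x (EuclideanSpace.single i 1)) (sphereDeriv F x (EuclideanSpace.single j 1))

/-- The matrix of the null second fundamental form `χ(X, Y) = ⟨D_X L, dF Y⟩`, extended by zero to
`ℝx`. -/
def chiMatrix {n : ℕ} (f : ℝ → ℝ) (F L : Space n → Event n) (x : Space n) :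
    Matrix (Fin n) (Fin n) ℝ :=
  Matrix.of fun i j => covInner f F L x (EuclideanSpace.single i 1)
    (sphereDeriv F x (EuclideanSpace.single j 1))

/-- The null mean curvature `tr χ = σ^{ab} χ_{ab}`. The line `ℝx`, on which `χ` is extended by
zero, contributes nothing to the trace. -/
def trChi {n : ℕ} (f : ℝ → ℝ) (F L : Space n → Event n) (x : Space n) : ℝ :=
  ((gramMatrix f F x)⁻¹ * chiMatrix f F L x).trace

/-! ### Submanifolds of a standard null cone and their variations -/

/-- The embedding of the submanifold `r = ρ(x)` of the outgoing standard null cone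
`t - r* = w₀`, where `rs` is the tortoise coordinate `r*` as a function of `r`. -/
def coneGraph {n : ℕ} (rs : ℝ → ℝ) (w₀ : ℝ) (ρ : Space n → ℝ) (x : Space n) : Event n :=
  (w₀ + rs (ρ x), ρ x • x)

/-- The null normal `L = (2r/f²) ∂_v = (r/f²) (∂_t + f² ∂_r)` tangent to the cone. -/
def coneNormal {n : ℕ} (f : ℝ → ℝ) (ρ : Space n → ℝ) (x : Space n) : Event n :=
  (ρ x / f (ρ x) ^ 2, ρ x • x)

/-- `Φ` parametrizes the incoming null hypersurface of `Σ = coneGraph rs w₀ ρ` near `Σ`: the curve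
`τ ↦ Φ τ x` is the affinely parametrized null geodesic starting at the point of `Σ` over `x` with
velocity the null normal complementary to `coneNormal f ρ`. So `∂_τ Φ` is the extension of that
null normal with vanishing acceleration. -/
structure IsIncomingNullHypersurface {n : ℕ} (I : Set ℝ) (f rs : ℝ → ℝ) (w₀ : ℝ)
    (ρ : Space n → ℝ) (δ : ℝ) (Φ : ℝ → Space n → Event n) : Prop where
  δ_pos : 0 < δ
  smooth : SphereSmoothFamily (Ioo (-δ) δ) Φ
  mem_region : ∀ τ ∈ Ioo (-δ) δ, ∀ x, ‖x‖ = 1 → Φ τ x ∈ region n I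
  initial : ∀ x, ‖x‖ = 1 → Φ 0 x = coneGraph rs w₀ ρ x
  frame : IsNullFrame f (coneGraph rs w₀ ρ) (coneNormal f ρ) (fun x => deriv (fun τ => Φ τ x) 0)
  geodesic : ∀ τ ∈ Ioo (-δ) δ, ∀ x, ‖x‖ = 1 → ∀ Z, accelInner f (fun τ' => Φ τ' x) τ Z = 0

/-- The variation `F(x, s)` inside the hypersurface parametrized by `Φ`: at time `s`, the point
over `x` is at parameter `T s x` on the generator through `ξ s x`. -/
def varMap {n : ℕ} (Φ : ℝ → Space n → Event n) (T : ℝ → Space n → ℝ) (ξ : ℝ → Space n → Space n)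
    (s : ℝ) (x : Space n) : Event n :=
  Φ (T s x) (ξ s x)

/-- The null normal `ψ Lbar` along `F(·, s)`, where `Lbar = ∂_τ Φ`. -/
def varLbar {n : ℕ} (Φ : ℝ → Space n → Event n) (T : ℝ → Space n → ℝ) (ξ : ℝ → Space n → Space n)
    (ψ : ℝ → Space n → ℝ) (s : ℝ) (x : Space n) : Event n :=
  ψ s x • deriv (fun τ => Φ τ (ξ s x)) (T s x)

/-- `varMap Φ T ξ` is a smooth variation of `Σ = coneGraph rs w₀ ρ` inside its incoming null
hypersurface, with initial velocity `U Lbar`, and `L s`, `varLbar Φ T ξ ψ s` are its null normals,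
which at `s = 0` are the chosen null normals of `Σ`. -/
structure IsIncomingVariation {n : ℕ} (f : ℝ → ℝ) (ρ : Space n → ℝ) (δ : ℝ)
    (Φ : ℝ → Space n → Event n) (ε : ℝ) (T : ℝ → Space n → ℝ) (ξ : ℝ → Space n → Space n)
    (ψ : ℝ → Space n → ℝ) (L : ℝ → Space n → Event n) (U : Space n → ℝ) : Prop where
  ε_pos : 0 < ε
  smooth_T : SphereSmoothFamily (Ioo (-ε) ε) T
  smooth_ξ : SphereSmoothFamily (Ioo (-ε) ε) ξ
  smooth_ψ : SphereSmoothFamily (Ioo (-ε) ε) ψ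
  smooth_L : SphereSmoothFamily (Ioo (-ε) ε) L
  T_mem : ∀ s ∈ Ioo (-ε) ε, ∀ x, ‖x‖ = 1 → T s x ∈ Ioo (-δ) δ
  norm_ξ : ∀ s ∈ Ioo (-ε) ε, ∀ x, ‖x‖ = 1 → ‖ξ s x‖ = 1
  T_zero : ∀ x, ‖x‖ = 1 → T 0 x = 0
  ξ_zero : ∀ x, ‖x‖ = 1 → ξ 0 x = x
  ψ_zero : ∀ x, ‖x‖ = 1 → ψ 0 x = 1
  L_zero : ∀ x, ‖x‖ = 1 → L 0 x = coneNormal f ρ x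
  velocity : ∀ x, ‖x‖ = 1 →
    HasDerivAt (fun s => varMap Φ T ξ s x) (U x • deriv (fun τ => Φ τ x) 0) 0
  frame : ∀ s ∈ Ioo (-ε) ε, IsNullFrame f (varMap Φ T ξ s) (L s) (varLbar Φ T ξ ψ s)

/-- The family `F s` with null normals `L s`, `Lbar s` preserves `α_H = -d log |H|`
infinitesimally: `∂_s|₀ ∂_a tr χ = 0` and `∂_s|₀ ⟨D_a Lbar(s), L(s)⟩ = 0`. -/
def PreservesCNNC {n : ℕ} (f : ℝ → ℝ) (F L Lbar : ℝ → Space n → Event n) : Prop :=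
  ∀ x X, ‖x‖ = 1 → inner ℝ x X = 0 →
    deriv (fun s => sphereDeriv (trChi f (F s) (L s)) x X) 0 = 0 ∧
    deriv (fun s => covInner f (F s) (Lbar s) x X (L s x)) 0 = 0

/-- `U` is the speed of a variation of `Σ` in its incoming null hypersurface that preserves
`α_H = -d log |H|` infinitesimally. -/
def IsInfinitesimalCNNCVariation {n : ℕ} (I : Set ℝ) (f rs : ℝ → ℝ) (w₀ : ℝ)
    (ρ U : Space n → ℝ) : Prop :=
  ∃ (δ : ℝ) (Φ : ℝ → Space n → Event n) (ε : ℝ) (T : ℝ → Space n → ℝ)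
    (ξ : ℝ → Space n → Space n) (ψ : ℝ → Space n → ℝ) (L : ℝ → Space n → Event n),
    IsIncomingNullHypersurface I f rs w₀ ρ δ Φ ∧
    IsIncomingVariation f ρ δ Φ ε T ξ ψ L U ∧
    PreservesCNNC f (varMap Φ T ξ) L (varLbar Φ T ξ ψ)

/-- A function on the sphere supported in the `ℓ ≤ 1` modes. -/
def SupportedInLowModes {n : ℕ} (u : Space n → ℝ) : Prop :=
  ∃ (a₀ : ℝ) (a : Fin n → ℝ), ∀ x, ‖x‖ = 1 → u x = a₀ + ∑ i, a i * x i

/-- The spacetime is a Lorentz space form along `Σ`: equality holds in the differential inequality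
at every radius attained on `Σ`. -/
def IsSpaceFormAlong {n : ℕ} (f : ℝ → ℝ) (ρ : Space n → ℝ) : Prop :=
  ∀ x, ‖x‖ = 1 → (f (ρ x) ^ 2 - 1) / ρ x ^ 2 - f (ρ x) * deriv f (ρ x) / ρ x = 0

/-- Infinitesimal rigidity of `Σ` for `α_H = -d log |H|`. -/
def InfinitesimallyRigid {n : ℕ} (I : Set ℝ) (f rs : ℝ → ℝ) (w₀ : ℝ) (ρ : Space n → ℝ) : Prop :=
  ∀ U : Space n → ℝ, IsInfinitesimalCNNCVariation I f rs w₀ ρ U →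
    (∃ c : ℝ, ∀ x, ‖x‖ = 1 → U x = c * ρ x) ∨
    (IsSpaceFormAlong f ρ ∧
      ∃ u : Space n → ℝ, SupportedInLowModes u ∧ ∀ x, ‖x‖ = 1 → U x = ρ x * u x)

end StaticNullCone

end

open Set
open scoped ContDiff

noncomputable section

namespace StaticNullCone

open Filter Topology MeasureTheory

/-! ### Homogeneous functions on punctured Euclidean space -/

/-! In the coordinates w = t - r*, r, θ the metric is -f² dw² - 2 dw dr + r² |dθ|² and the cone is w
= w₀. Let u be the first variation of w along the family. The initial velocity is U Lbar and the ∂_w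
component of Lbar on Σ is 2/ρ, so U = ρ u / 2. It remains to show that u is constant, or an ℓ ≤ 1
function in the space form case.

The frame conditions (null, normal, ⟨L, Lbar⟩ = -2), linearized at Σ, express the relevant
variations of L and Lbar through u and q, where q is the variation of the ∂_r component of L minus
the variation of r. For X tangent to the sphere the two preserved quantities then give ρ Xq - (Xρ) q
= ∇²u(X, ∇ρ) - ρ² (f f' - f²/ρ) Xu (`torsion_linearized`), ρ X(Δu + (n-1) q) = (Xρ) (Δu + (n-1) q)
(`trChi_linearized`). Eliminate q, and write A for the trace-free Hessian of u on the sphere and k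
for -ρ³ times the left-hand side of the differential inequality, so that k ≥ 0. The result is A(X,
∇ρ) = -ρ/(n-1) X(Δu + (n-1) u) + k Xu.

On the unit sphere div A = (n-2)/(n-1) d(Δu + (n-1) u). Hence the two third order terms cancel in
div(ρ^(n-2) A(∇u)) = (n-2) ρ^(n-3) k |∇u|² + ρ^(n-2) |A|² (`divergence_rigidityField`). The right
side is nonnegative with integral zero, so both summands vanish. A = 0 means that u is supported in
ℓ ≤ 1 (`exists_affine_of_tfHess_eq_zero`). If k ≠ 0 at one point, then ∇u = 0 on an open set and u
is constant (`eq_zero_of_tangential`); otherwise equality holds in the inequality along all of Σ.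

Analysis on the sphere is done with homogeneous functions on ℝⁿ minus the origin. The function u has
degree zero, and v = |y| u has degree one. The Euclidean Hessian of v annihilates y, and at a unit
vector its tangential part is ∇²u + u g. Partial derivatives commute, so no curvature terms have to
be tracked. The divergence theorem on the sphere is replaced by integration over ℝⁿ against a radial
cutoff (`divergence_eq_zero_of_nonneg`). -/

/-- The partial derivative `∂g/∂yᵢ`. -/
def pderiv {n : ℕ} (i : Fin n) (g : Space n → ℝ) (y : Space n) : ℝ :=
  fderiv ℝ g y (EuclideanSpace.single i 1)

/-- `g` is positively homogeneous of degree `k` away from the origin. -/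
def IsHomogeneous {n : ℕ} (k : ℤ) (g : Space n → ℝ) : Prop :=
  ∀ c : ℝ, 0 < c → ∀ y : Space n, y ≠ 0 → g (c • y) = c ^ k * g y

section
variable {n : ℕ}

lemma eq_sum_single (X : Space n) : X = ∑ i, X i • EuclideanSpace.single i (1 : ℝ) := by
  ext j
  simp [Finset.sum_apply, Pi.single_apply]

lemma fderiv_eq_sum_pderiv (g : Space n → ℝ) (y X : Space n) :
    fderiv ℝ g y X = ∑ i, X i * pderiv i g y := by
  conv_lhs => rw [eq_sum_single X]
  simp [pderiv]

lemma differentiableAt_of_smooth {W : Type*} [NormedAddCommGroup W] [NormedSpace ℝ W]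
    {g : Space n → W} (hg : ContDiffOn ℝ ∞ g {0}ᶜ) {y : Space n} (hy : y ≠ 0) :
    DifferentiableAt ℝ g y :=
  (hg.contDiffAt (isOpen_compl_singleton.mem_nhds hy)).differentiableAt (by simp)

lemma contDiffOn_pderiv {g : Space n → ℝ} (hg : ContDiffOn ℝ ∞ g {0}ᶜ) (i : Fin n) :
    ContDiffOn ℝ ∞ (pderiv i g) {0}ᶜ :=
  (hg.fderiv_of_isOpen isOpen_compl_singleton (by simp)).clm_apply contDiffOn_const

lemma contDiffOn_coord (i : Fin n) (s : Set (Space n)) :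
    ContDiffOn ℝ ∞ (fun y : Space n => y i) s := by
  have : ContDiff ℝ ∞ (fun y : Space n => y i) := by fun_prop
  exact this.contDiffOn

lemma contDiffOn_norm' : ContDiffOn ℝ ∞ (fun y : Space n => ‖y‖) {0}ᶜ :=
  fun y hy => (contDiffAt_norm ℝ (by simpa using hy)).contDiffWithinAt

lemma pderiv_mul {g h : Space n → ℝ} {y : Space n} (i : Fin n) (hg : DifferentiableAt ℝ g y)
    (hh : DifferentiableAt ℝ h y) :
    pderiv i (fun z => g z * h z) y = pderiv i g y * h y + g y * pderiv i h y := by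
  unfold pderiv
  rw [fderiv_fun_mul hg hh]
  simp; ring

lemma pderiv_add {g h : Space n → ℝ} {y : Space n} (i : Fin n) (hg : DifferentiableAt ℝ g y)
    (hh : DifferentiableAt ℝ h y) :
    pderiv i (fun z => g z + h z) y = pderiv i g y + pderiv i h y := by
  unfold pderiv
  rw [fderiv_fun_add hg hh]
  simp

lemma pderiv_sub {g h : Space n → ℝ} {y : Space n} (i : Fin n) (hg : DifferentiableAt ℝ g y)
    (hh : DifferentiableAt ℝ h y) :
    pderiv i (fun z => g z - h z) y = pderiv i g y - pderiv i h y := by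
  unfold pderiv
  rw [fderiv_fun_sub hg hh]
  simp

lemma pderiv_const_mul {g : Space n → ℝ} {y : Space n} (i : Fin n) (c : ℝ)
    (hg : DifferentiableAt ℝ g y) :
    pderiv i (fun z => c * g z) y = c * pderiv i g y := by
  unfold pderiv
  rw [fderiv_const_mul hg]
  simp

lemma pderiv_sum {ι : Type*} (s : Finset ι) {g : ι → Space n → ℝ} {y : Space n} (i : Fin n)
    (hg : ∀ j ∈ s, DifferentiableAt ℝ (g j) y) :
    pderiv i (fun z => ∑ j ∈ s, g j z) y = ∑ j ∈ s, pderiv i (g j) y := by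
  unfold pderiv
  rw [fderiv_fun_sum hg]
  simp

lemma pderiv_pow {g : Space n → ℝ} {y : Space n} (i : Fin n) (k : ℕ)
    (hg : DifferentiableAt ℝ g y) :
    pderiv i (fun z => g z ^ k) y = k * g y ^ (k - 1) * pderiv i g y := by
  unfold pderiv
  rw [fderiv_fun_pow k hg]
  simp

lemma pderiv_coord (i j : Fin n) (y : Space n) :
    pderiv i (fun z : Space n => z j) y = if i = j then 1 else 0 := by
  have : HasFDerivAt (fun z : Space n => z j) (EuclideanSpace.proj (𝕜 := ℝ) j) y :=
    (EuclideanSpace.proj (𝕜 := ℝ) j).hasFDerivAt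
  unfold pderiv
  rw [this.fderiv]
  simp [eq_comm]

lemma fderiv_norm_apply {y : Space n} (hy : y ≠ 0) (X : Space n) :
    fderiv ℝ (fun z : Space n => ‖z‖) y X = inner ℝ y X / ‖y‖ := by
  have h1 : HasFDerivAt (fun z : Space n => ‖z‖ ^ 2) (2 • (innerSL ℝ y)) y :=
    (hasStrictFDerivAt_norm_sq y).hasFDerivAt
  have h2 : DifferentiableAt ℝ (fun z : Space n => ‖z‖) y := (contDiffAt_norm ℝ hy).differentiableAt
    (n := ∞) (by simp)
  have h3 := (h2.hasFDerivAt.pow 2).unique h1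
  have h4 := congrArg (fun A => A X) h3
  have hn : ‖y‖ ≠ 0 := norm_ne_zero_iff.2 hy
  simp at h4
  field_simp
  linarith

lemma pderiv_norm (i : Fin n) {y : Space n} (hy : y ≠ 0) :
    pderiv i (fun z : Space n => ‖z‖) y = y i / ‖y‖ := by
  unfold pderiv
  rw [fderiv_norm_apply hy, EuclideanSpace.inner_single_right]
  simp

lemma pderiv_congr {g h : Space n → ℝ} {y : Space n} (i : Fin n) (e : g =ᶠ[𝓝 y] h) :
    pderiv i g y = pderiv i h y := by
  unfold pderiv
  rw [e.fderiv_eq]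

lemma eventuallyEq_of_forall_ne {W : Type*} {g h : Space n → W} (e : ∀ y ≠ 0, g y = h y)
    {y : Space n} (hy : y ≠ 0) : g =ᶠ[𝓝 y] h := by
  filter_upwards [isOpen_compl_singleton.mem_nhds hy] with z hz using e z hz

lemma pderiv_comm {g : Space n → ℝ} (hg : ContDiffOn ℝ ∞ g {0}ᶜ) (i j : Fin n) {y : Space n}
    (hy : y ≠ 0) : pderiv i (pderiv j g) y = pderiv j (pderiv i g) y := by
  have hc := hg.contDiffAt (isOpen_compl_singleton.mem_nhds hy)
  have hs : IsSymmSndFDerivAt ℝ g y := hc.isSymmSndFDerivAt (by simp; exact WithTop.coe_le_coe.2 le_top)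
  have hd : DifferentiableAt ℝ (fderiv ℝ g) y :=
    (hc.fderiv_right (m := ∞) (by simp)).differentiableAt (by simp)
  have key : ∀ a b : Fin n, pderiv a (pderiv b g) y
      = fderiv ℝ (fderiv ℝ g) y (EuclideanSpace.single a 1) (EuclideanSpace.single b 1) := by
    intro a b
    have : HasFDerivAt (pderiv b g) _ y := hd.hasFDerivAt.clm_apply
      (hasFDerivAt_const (EuclideanSpace.single b (1 : ℝ)) y)
    unfold pderiv at this ⊢
    rw [this.fderiv]
    simp
  rw [key, key, hs.eq]

lemma IsHomogeneous.pderiv {k : ℤ} {g : Space n → ℝ} (hg : ContDiffOn ℝ ∞ g {0}ᶜ)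
    (h : IsHomogeneous k g) (i : Fin n) : IsHomogeneous (k - 1) (pderiv i g) := by
  intro c hc y hy
  have hcy : c • y ≠ 0 := smul_ne_zero hc.ne' hy
  have e : (fun z => g (c • z)) =ᶠ[𝓝 y] fun z => c ^ k * g z :=
    eventuallyEq_of_forall_ne (fun z hz => h c hc z hz) hy
  have h1 : HasFDerivAt (fun z => g (c • z))
      ((fderiv ℝ g (c • y)).comp (c • ContinuousLinearMap.id ℝ (Space n))) y :=
    (differentiableAt_of_smooth hg hcy).hasFDerivAt.comp y ((hasFDerivAt_id y).const_smul c)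
  have h2 := ((differentiableAt_of_smooth hg hy).hasFDerivAt.const_mul (c ^ k)).congr_of_eventuallyEq e
  have h3 := congrArg (fun A => A (EuclideanSpace.single i 1)) (h1.unique h2)
  simp at h3
  unfold StaticNullCone.pderiv
  rw [zpow_sub_one₀ hc.ne']
  field_simp
  linarith

lemma IsHomogeneous.euler {k : ℤ} {g : Space n → ℝ} (hg : ContDiffOn ℝ ∞ g {0}ᶜ)
    (h : IsHomogeneous k g) {y : Space n} (hy : y ≠ 0) :
    ∑ i, y i * StaticNullCone.pderiv i g y = k * g y := by
  rw [← fderiv_eq_sum_pderiv]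
  have h0 : HasDerivAt (fun c : ℝ => c • y) y 1 := by
    simpa using (hasDerivAt_id (1 : ℝ)).smul_const y
  have h1 : HasDerivAt (fun c : ℝ => g (c • y)) (fderiv ℝ g y y) 1 := by
    have hd : HasFDerivAt g (fderiv ℝ g y) ((1 : ℝ) • y) := by
      simpa using (differentiableAt_of_smooth hg hy).hasFDerivAt
    exact hd.comp_hasDerivAt 1 h0
  have h2 : HasDerivAt (fun c : ℝ => c ^ k * g y) (k * g y) 1 := by
    simpa using (hasDerivAt_zpow k (1 : ℝ) (Or.inl one_ne_zero)).mul_const (g y)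
  have e : (fun c : ℝ => g (c • y)) =ᶠ[𝓝 1] fun c : ℝ => c ^ k * g y := by
    filter_upwards [isOpen_Ioi.mem_nhds (show (1 : ℝ) ∈ Ioi 0 by simp)] with c hc
    exact h c hc y hy
  exact h1.unique (h2.congr_of_eventuallyEq e)

/-- Integration by parts against the constant function 1. Combined with a radial cutoff it plays the
role of the divergence theorem on the sphere. -/
lemma integral_pderiv_eq_zero {g : Space n → ℝ} (hg : ContDiff ℝ ∞ g) (hc : HasCompactSupport g)
    (i : Fin n) : ∫ y, pderiv i g y = 0 := by
  have hcont : Continuous (pderiv i g) := (hg.continuous_fderiv (by simp)).clm_apply continuous_const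
  have hcs : HasCompactSupport (pderiv i g) := by
    refine hc.mono' ?_
    intro y hy
    by_contra hny
    apply hy
    unfold pderiv
    rw [image_eq_zero_of_notMem_tsupport (fun h => hny (tsupport_fderiv_subset ℝ h))]
    simp
  have := integral_mul_fderiv_eq_neg_fderiv_mul_of_integrable (μ := volume) (𝕜 := ℝ)
    (f := fun _ : Space n => (1 : ℝ)) (g := g) (v := EuclideanSpace.single i 1)
    (by simp) (by simp only [one_mul]; exact hcont.integrable_of_hasCompactSupport hcs)
    (by simpa using hg.continuous.integrable_of_hasCompactSupport hc)
    (by fun_prop) (fun y _ => hg.differentiable (by simp) y)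
  simpa [pderiv] using this

/-- A tangential homogeneous vector field whose divergence has a sign on the unit sphere is
divergence free there. -/
theorem divergence_eq_zero_of_nonneg {Z : Fin n → Space n → ℝ} {k : ℤ}
    (hZ : ∀ i, ContDiffOn ℝ ∞ (Z i) {0}ᶜ) (hom : ∀ i, IsHomogeneous k (Z i))
    (htan : ∀ y ≠ 0, ∑ i, y i * Z i y = 0)
    (hpos : ∀ x, ‖x‖ = 1 → 0 ≤ ∑ i, pderiv i (Z i) x) (x : Space n) (hx : ‖x‖ = 1) :
    ∑ i, pderiv i (Z i) x = 0 := by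
  -- The cutoff is a function of |y|², equal to 1 near the unit sphere and zero outside 1/2 < |y|² <
  -- 3/2. So `η * Z i` extends smoothly by zero across the origin, where `Z i` may be singular.
  let b : ContDiffBump (1 : ℝ) := ⟨1 / 4, 1 / 2, by norm_num, by norm_num⟩
  let η : Space n → ℝ := fun y => b (‖y‖ ^ 2)
  have hη : ContDiff ℝ ∞ η := b.contDiff.comp (contDiff_norm_sq ℝ)
  have hη0 : ∀ y : Space n, ‖y‖ ^ 2 ≤ 1 / 2 ∨ 3 / 2 ≤ ‖y‖ ^ 2 → η y = 0 := by
    intro y hy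
    apply b.zero_of_le_dist
    rw [Real.dist_eq, le_abs]
    rcases hy with hy | hy
    · right; simp only [b]; linarith
    · left; simp only [b]; linarith
  have hη1 : η x = 1 := by
    apply b.one_of_mem_closedBall
    simp [hx, b]
  have hnear : ∀ i, (fun y => η y * Z i y) =ᶠ[𝓝 0] fun _ => 0 := by
    intro i
    have : ∀ᶠ y : Space n in 𝓝 0, ‖y‖ ^ 2 < 1 / 2 := by
      have hc : Continuous fun y : Space n => ‖y‖ ^ 2 := by fun_prop
      exact hc.continuousAt.eventually_lt continuousAt_const (by simp)
    filter_upwards [this] with y hy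
    rw [hη0 y (Or.inl hy.le), zero_mul]
  have hG : ∀ i, ContDiff ℝ ∞ (fun y => η y * Z i y) := by
    intro i
    rw [contDiff_iff_contDiffAt]
    intro y
    by_cases hy : y = 0
    · subst hy
      exact contDiffAt_const.congr_of_eventuallyEq (hnear i)
    · exact hη.contDiffAt.mul ((hZ i).contDiffAt (isOpen_compl_singleton.mem_nhds hy))
  have hGc : ∀ i, HasCompactSupport (fun y => η y * Z i y) := by
    intro i
    refine HasCompactSupport.intro (isCompact_closedBall (0 : Space n) 2) ?_
    intro y hy
    have : 2 < ‖y‖ := by simpa using hy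
    rw [hη0 y (Or.inr (by nlinarith)), zero_mul]
  have hcont : ∀ i, Continuous (pderiv i (fun y => η y * Z i y)) := fun i =>
    ((hG i).continuous_fderiv (by simp)).clm_apply continuous_const
  have hcs : ∀ i, HasCompactSupport (pderiv i (fun y => η y * Z i y)) := by
    intro i
    refine (hGc i).mono' ?_
    intro y hy
    by_contra hny
    apply hy
    unfold pderiv
    rw [image_eq_zero_of_notMem_tsupport (fun h => hny (tsupport_fderiv_subset ℝ h))]
    simp
  have hintegr : ∀ i, Integrable (pderiv i (fun y => η y * Z i y)) := fun i =>
    (hcont i).integrable_of_hasCompactSupport (hcs i)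
  -- The gradient of a radial cutoff is radial and the field is tangential, so the derivative of `η`
  -- drops out of the divergence.
  have hval : ∀ y ≠ 0, ∑ i, pderiv i (fun y => η y * Z i y) y = η y * ∑ i, pderiv i (Z i) y := by
    intro y hy
    have hη' : ∀ i, pderiv i η y = deriv b (‖y‖ ^ 2) * (2 * y i) := by
      intro i
      have h1 : HasFDerivAt (fun z : Space n => ‖z‖ ^ 2) (2 • (innerSL ℝ y)) y :=
        (hasStrictFDerivAt_norm_sq y).hasFDerivAt
      have h2 : HasDerivAt b (deriv b (‖y‖ ^ 2)) (‖y‖ ^ 2) :=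
        ((b.contDiff (n := 1)).differentiable (by simp) _).hasDerivAt
      have h3 := h2.comp_hasFDerivAt y h1
      unfold pderiv
      rw [show η = (b : ℝ → ℝ) ∘ fun z : Space n => ‖z‖ ^ 2 from rfl, h3.fderiv]
      simp [EuclideanSpace.inner_single_right]
    have : ∀ i, pderiv i (fun y => η y * Z i y) y
        = deriv b (‖y‖ ^ 2) * 2 * (y i * Z i y) + η y * pderiv i (Z i) y := by
      intro i
      rw [pderiv_mul i (hη.differentiable (by simp) y) (differentiableAt_of_smooth (hZ i) hy), hη']
      ring
    simp only [this]
    rw [Finset.sum_add_distrib, ← Finset.mul_sum, ← Finset.mul_sum, htan y hy]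
    ring
  have hnn : ∀ y, 0 ≤ ∑ i, pderiv i (fun y => η y * Z i y) y := by
    intro y
    by_cases hy : y = 0
    · subst hy
      apply le_of_eq
      symm
      apply Finset.sum_eq_zero
      intro i _
      rw [pderiv_congr i (hnear i)]
      simp [pderiv]
    · rw [hval y hy]
      -- Homogeneity carries the sign of the divergence from the unit sphere to the punctured space.
      refine mul_nonneg b.nonneg ?_
      have hny : 0 < ‖y‖ := norm_pos_iff.2 hy
      have hu : ‖‖y‖⁻¹ • y‖ = 1 := by
        rw [norm_smul, norm_inv, norm_norm, inv_mul_cancel₀ hny.ne']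
      have hu0 : ‖y‖⁻¹ • y ≠ 0 := by
        intro h0; rw [h0] at hu; simp at hu
      have hs : y = ‖y‖ • (‖y‖⁻¹ • y) := by rw [smul_smul, mul_inv_cancel₀ hny.ne', one_smul]
      have : ∀ i, pderiv i (Z i) y = ‖y‖ ^ (k - 1) * pderiv i (Z i) (‖y‖⁻¹ • y) := by
        intro i
        rw [← (hom i).pderiv (hZ i) i ‖y‖ hny _ hu0, ← hs]
      simp only [this, ← Finset.mul_sum]
      exact mul_nonneg (zpow_nonneg hny.le _) (hpos _ hu)
  have hzero : ∫ y, ∑ i, pderiv i (fun y => η y * Z i y) y = 0 := by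
    rw [integral_finsetSum _ fun i _ => hintegr i]
    exact Finset.sum_eq_zero fun i _ => integral_pderiv_eq_zero (hG i) (hGc i) i
  have hae := (integral_eq_zero_iff_of_nonneg hnn (integrable_finsetSum _ fun i _ => hintegr i)).1 hzero
  -- Continuity upgrades vanishing almost everywhere to vanishing at `x`, where the cutoff is 1.
  have hfun := (Continuous.ae_eq_iff_eq volume
    (continuous_finsetSum _ fun i _ => hcont i) continuous_const).1 hae
  have hx0 : x ≠ 0 := by
    intro h0; rw [h0] at hx; simp at hx
  have hDx : ∑ i, pderiv i (fun y => η y * Z i y) x = 0 := congrFun hfun x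
  rwa [hval x hx0, hη1, one_mul] at hDx

end

/-! ### The trace-free Hessian of a function of degree one -/

section
variable {n : ℕ}

lemma ne_zero_of_norm_one {x : Space n} (hx : ‖x‖ = 1) : x ≠ 0 := by
  intro h0; rw [h0] at hx; simp at hx

lemma sum_sq_of_norm_one {x : Space n} (hx : ‖x‖ = 1) : ∑ i, x i * x i = 1 := by
  have := EuclideanSpace.real_norm_sq_eq x
  rw [hx] at this
  simp only [pow_two] at this
  linarith

lemma contDiffOn_norm_inv : ContDiffOn ℝ ∞ (fun y : Space n => ‖y‖⁻¹) {0}ᶜ :=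
  contDiffOn_norm'.inv fun _ hy => norm_ne_zero_iff.2 hy

lemma pderiv_norm_inv (i : Fin n) {y : Space n} (hy : y ≠ 0) :
    pderiv i (fun z : Space n => ‖z‖⁻¹) y = -y i * ‖y‖⁻¹ ^ 3 := by
  have hn : ‖y‖ ≠ 0 := norm_ne_zero_iff.2 hy
  have h : HasFDerivAt (fun z : Space n => ‖z‖) (fderiv ℝ (fun z : Space n => ‖z‖) y) y :=
    (differentiableAt_of_smooth contDiffOn_norm' hy).hasFDerivAt
  have h2 := (hasDerivAt_inv hn).comp_hasFDerivAt y h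
  have h3 := pderiv_norm i hy
  unfold pderiv at h3 ⊢
  rw [show (fun z : Space n => ‖z‖⁻¹) = (fun t : ℝ => t⁻¹) ∘ fun z : Space n => ‖z‖ from rfl,
    h2.fderiv]
  simp only [smul_apply, h3, smul_eq_mul]
  field_simp

lemma IsHomogeneous.mul {k l : ℤ} {g h : Space n → ℝ} (hg : IsHomogeneous k g)
    (hh : IsHomogeneous l h) : IsHomogeneous (k + l) (fun y => g y * h y) := by
  intro c hc y hy
  simp only
  rw [hg c hc y hy, hh c hc y hy, zpow_add₀ hc.ne']
  ring

lemma IsHomogeneous.sub {k : ℤ} {g h : Space n → ℝ} (hg : IsHomogeneous k g)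
    (hh : IsHomogeneous k h) : IsHomogeneous k (fun y => g y - h y) := by
  intro c hc y hy
  simp only
  rw [hg c hc y hy, hh c hc y hy]
  ring

lemma IsHomogeneous.sum {ι : Type*} {s : Finset ι} {k : ℤ} {g : ι → Space n → ℝ}
    (hg : ∀ j ∈ s, IsHomogeneous k (g j)) : IsHomogeneous k (fun y => ∑ j ∈ s, g j y) := by
  intro c hc y hy
  rw [Finset.mul_sum]
  exact Finset.sum_congr rfl fun j hj => hg j hj c hc y hy

lemma IsHomogeneous.const (a : ℝ) : IsHomogeneous 0 (fun _ : Space n => a) := by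
  intro c hc y hy
  simp

lemma IsHomogeneous.pow_zero {g : Space n → ℝ} (hg : IsHomogeneous 0 g) (m : ℕ) :
    IsHomogeneous 0 (fun y => g y ^ m) := by
  intro c hc y hy
  simp [hg c hc y hy]

lemma isHomogeneous_coord (i : Fin n) : IsHomogeneous 1 (fun y : Space n => y i) := by
  intro c hc y hy
  simp

lemma isHomogeneous_norm_inv : IsHomogeneous (-1) (fun y : Space n => ‖y‖⁻¹) := by
  intro c hc y hy
  simp [norm_smul, abs_of_pos hc, mul_comm]

lemma isHomogeneous_norm : IsHomogeneous 1 (fun y : Space n => ‖y‖) := by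
  intro c hc y hy
  simp [norm_smul, abs_of_pos hc]

/-- The Laplacian as a sum of second partial derivatives. -/
def lap (v : Space n → ℝ) (y : Space n) : ℝ := ∑ i, pderiv i (pderiv i v) y

lemma contDiffOn_lap {v : Space n → ℝ} (hv : ContDiffOn ℝ ∞ v {0}ᶜ) :
    ContDiffOn ℝ ∞ (lap v) {0}ᶜ :=
  ContDiffOn.sum fun i _ => contDiffOn_pderiv (contDiffOn_pderiv hv i) i

/-- Flat partial derivatives commute, so the divergence of the Hessian is the gradient of the
Laplacian; the intrinsic computation on the sphere would produce a Ricci term here. -/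
lemma sum_pderiv_pderiv_pderiv {v : Space n → ℝ} (hv : ContDiffOn ℝ ∞ v {0}ᶜ) (j : Fin n)
    {y : Space n} (hy : y ≠ 0) :
    ∑ i, pderiv i (pderiv i (pderiv j v)) y = pderiv j (lap v) y := by
  have h : pderiv j (lap v) y = ∑ i, pderiv j (pderiv i (pderiv i v)) y :=
    pderiv_sum _ j fun i _ =>
      differentiableAt_of_smooth (contDiffOn_pderiv (contDiffOn_pderiv hv i) i) hy
  rw [h]
  refine Finset.sum_congr rfl fun i _ => ?_
  rw [← pderiv_comm (contDiffOn_pderiv hv i) i j hy]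
  exact pderiv_congr i (eventuallyEq_of_forall_ne (fun z hz => pderiv_comm hv i j hz) hy)

/-- The trace-free part, over the orthogonal complement of `y`, of the Hessian of `v`. -/
def tfHess (v : Space n → ℝ) (i j : Fin n) (y : Space n) : ℝ :=
  pderiv i (pderiv j v) y
    - ((n : ℝ) - 1)⁻¹ * lap v y * ((if i = j then 1 else 0) - y i * y j * ‖y‖⁻¹ ^ 2)

lemma contDiffOn_tfHess {v : Space n → ℝ} (hv : ContDiffOn ℝ ∞ v {0}ᶜ) (i j : Fin n) :
    ContDiffOn ℝ ∞ (tfHess v i j) {0}ᶜ :=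
  (contDiffOn_pderiv (contDiffOn_pderiv hv j) i).sub
    ((contDiffOn_const.mul (contDiffOn_lap hv)).mul
      (contDiffOn_const.sub (((contDiffOn_coord i _).mul (contDiffOn_coord j _)).mul
        (contDiffOn_norm_inv.pow 2))))

lemma isHomogeneous_tfHess {v : Space n → ℝ} (hv : ContDiffOn ℝ ∞ v {0}ᶜ)
    (hvh : IsHomogeneous 1 v) (i j : Fin n) : IsHomogeneous (-1) (tfHess v i j) := by
  have h2 : ∀ a b, IsHomogeneous (-1) (pderiv a (pderiv b v)) := fun a b =>
    (hvh.pderiv hv b).pderiv (contDiffOn_pderiv hv b) a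
  have hl : IsHomogeneous (-1) (lap v) := IsHomogeneous.sum fun a _ => h2 a a
  have hp : IsHomogeneous 0 (fun y : Space n => (if i = j then (1 : ℝ) else 0)
      - y i * y j * ‖y‖⁻¹ ^ 2) := by
    refine (IsHomogeneous.const _).sub ?_
    have := ((isHomogeneous_coord i).mul (isHomogeneous_coord j)).mul
      (isHomogeneous_norm_inv.mul isHomogeneous_norm_inv)
    simpa [pow_two] using this
  have := (h2 i j).sub (((IsHomogeneous.const ((n : ℝ) - 1)⁻¹).mul hl).mul hp)
  exact this

/-- The function `pderiv j v` has degree zero, so its radial derivative vanishes. The Hessian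
therefore lives on the orthogonal complement of y, and `lap v` is already its trace there. -/
lemma sum_coord_mul_hess {v : Space n → ℝ} (hv : ContDiffOn ℝ ∞ v {0}ᶜ)
    (hvh : IsHomogeneous 1 v) (j : Fin n) {y : Space n} (hy : y ≠ 0) :
    ∑ i, y i * pderiv i (pderiv j v) y = 0 := by
  have := (hvh.pderiv hv j).euler (contDiffOn_pderiv hv j) hy
  simpa using this

lemma sum_coord_mul_tfHess {v : Space n → ℝ} (hv : ContDiffOn ℝ ∞ v {0}ᶜ)
    (hvh : IsHomogeneous 1 v) (j : Fin n) {y : Space n} (hy : y ≠ 0) :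
    ∑ i, y i * tfHess v i j y = 0 := by
  have hn : ‖y‖ ≠ 0 := norm_ne_zero_iff.2 hy
  have h0 := sum_coord_mul_hess hv hvh j hy
  have h1 : ∑ i, y i * (if i = j then (1 : ℝ) else 0) = y j := by simp
  have h2 : ∑ i, y i * y i = ‖y‖ ^ 2 := by
    rw [EuclideanSpace.real_norm_sq_eq y]; simp only [pow_two]
  have : ∀ i, y i * tfHess v i j y = y i * pderiv i (pderiv j v) y
      - ((n : ℝ) - 1)⁻¹ * lap v y * (y i * (if i = j then (1 : ℝ) else 0))
      + ((n : ℝ) - 1)⁻¹ * lap v y * y j * ‖y‖⁻¹ ^ 2 * (y i * y i) := by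
    intro i; unfold tfHess; ring
  simp only [this]
  rw [Finset.sum_add_distrib, Finset.sum_sub_distrib, ← Finset.mul_sum, ← Finset.mul_sum, h0, h1,
    h2]
  field_simp
  ring

lemma tfHess_symm {v : Space n → ℝ} (hv : ContDiffOn ℝ ∞ v {0}ᶜ) (i j : Fin n)
    {y : Space n} (hy : y ≠ 0) : tfHess v i j y = tfHess v j i y := by
  unfold tfHess
  rw [pderiv_comm hv i j hy]
  simp only [eq_comm (a := i) (b := j)]
  ring

/-- The projection to the orthogonal complement of y has trace n - 1, which cancels the factor `(n -
1)⁻¹` in `tfHess`. -/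
lemma trace_tfHess (hn : 3 ≤ n) (v : Space n → ℝ) {y : Space n} (hy : y ≠ 0) :
    ∑ i, tfHess v i i y = 0 := by
  have hm : (n : ℝ) - 1 ≠ 0 := by
    have : (3 : ℝ) ≤ n := by exact_mod_cast hn
    linarith
  have hn : ‖y‖ ≠ 0 := norm_ne_zero_iff.2 hy
  have h2 : ∑ i, y i * y i = ‖y‖ ^ 2 := by
    rw [EuclideanSpace.real_norm_sq_eq y]; simp only [pow_two]
  have : ∀ i, tfHess v i i y = pderiv i (pderiv i v) y
      - ((n : ℝ) - 1)⁻¹ * lap v y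
      + ((n : ℝ) - 1)⁻¹ * lap v y * ‖y‖⁻¹ ^ 2 * (y i * y i) := by
    intro i; unfold tfHess; simp; ring
  simp only [this]
  rw [Finset.sum_add_distrib, Finset.sum_sub_distrib, ← Finset.mul_sum, ← Finset.mul_sum, h2]
  simp only [Finset.sum_const, Finset.card_univ, Fintype.card_fin, nsmul_eq_mul]
  change lap v y - _ + _ = 0
  field_simp
  ring

lemma pderiv_tfHess {v : Space n → ℝ} (hv : ContDiffOn ℝ ∞ v {0}ᶜ) {x : Space n} (hx : ‖x‖ = 1) (i j : Fin n) :
    pderiv i (tfHess v i j) x = pderiv i (pderiv i (pderiv j v)) x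
      - ((n : ℝ) - 1)⁻¹ * (pderiv i (lap v) x * ((if i = j then 1 else 0) - x i * x j)
        + lap v x * (-x j - (if i = j then x i else 0) + 2 * (x i * x i) * x j)) := by
  have hx0 := ne_zero_of_norm_one hx
  have d : ∀ {g : Space n → ℝ}, ContDiffOn ℝ ∞ g {0}ᶜ → DifferentiableAt ℝ g x :=
    fun hg => differentiableAt_of_smooth hg hx0
  have cij : ContDiffOn ℝ ∞ (fun y : Space n => y i * y j) {0}ᶜ :=
    (contDiffOn_coord i _).mul (contDiffOn_coord j _)
  have cN := contDiffOn_norm_inv (n := n)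
  have cP : ContDiffOn ℝ ∞ (fun y : Space n => y i * y j * ‖y‖⁻¹ ^ 2) {0}ᶜ := cij.mul (cN.pow 2)
  have cQ : ContDiffOn ℝ ∞ (fun y : Space n => (if i = j then (1 : ℝ) else 0)
    - y i * y j * ‖y‖⁻¹ ^ 2) {0}ᶜ := contDiffOn_const.sub cP
  have cl := contDiffOn_lap hv
  have cml : ContDiffOn ℝ ∞ (fun y => ((n : ℝ) - 1)⁻¹ * lap v y) {0}ᶜ := contDiffOn_const.mul cl
  have e : tfHess v i j = fun y => pderiv i (pderiv j v) y
    - ((n : ℝ) - 1)⁻¹ * lap v y * ((if i = j then 1 else 0) - y i * y j * ‖y‖⁻¹ ^ 2) := rfl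
  rw [e, pderiv_sub i (d (contDiffOn_pderiv (contDiffOn_pderiv hv j) i)) (d (cml.mul cQ)),
    pderiv_mul i (d cml) (d cQ), pderiv_const_mul i _ (d cl),
    pderiv_sub i (d contDiffOn_const) (d cP), pderiv_mul i (d cij) (d (cN.pow 2)),
    pderiv_mul i (d (contDiffOn_coord i _)) (d (contDiffOn_coord j _)),
    pderiv_pow i 2 (d cN), pderiv_norm_inv i hx0, pderiv_coord, pderiv_coord, hx]
  have hc : pderiv i (fun _ : Space n => (if i = j then (1 : ℝ) else 0)) x = 0 := by
    simp [pderiv]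
  rw [hc]
  by_cases hij : i = j <;> simp [hij] <;> ring

end

/-! ### The divergence identity for the rigidity field -/

section
variable {n : ℕ}

/-- The degree zero function `v / ‖y‖` associated with a function `v` of degree one. -/
def angular (v : Space n → ℝ) (y : Space n) : ℝ := ‖y‖⁻¹ * v y

lemma contDiffOn_angular {v : Space n → ℝ} (hv : ContDiffOn ℝ ∞ v {0}ᶜ) :
    ContDiffOn ℝ ∞ (angular v) {0}ᶜ :=
  contDiffOn_norm_inv.mul hv

lemma isHomogeneous_angular {v : Space n → ℝ} (hvh : IsHomogeneous 1 v) :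
    IsHomogeneous 0 (angular v) :=
  isHomogeneous_norm_inv.mul hvh

lemma pderiv_angular {v : Space n → ℝ} (hv : ContDiffOn ℝ ∞ v {0}ᶜ) (j : Fin n) {y : Space n}
    (hy : y ≠ 0) :
    pderiv j (angular v) y = -y j * ‖y‖⁻¹ ^ 3 * v y + ‖y‖⁻¹ * pderiv j v y := by
  have e : angular v = fun y => ‖y‖⁻¹ * v y := rfl
  rw [e, pderiv_mul j (differentiableAt_of_smooth contDiffOn_norm_inv hy)
    (differentiableAt_of_smooth hv hy), pderiv_norm_inv j hy]

/-- Tangentially, at a unit vector, the Hessians of the degree zero and the degree one function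
differ only by v times the identity, so their trace-free parts agree. The remaining terms carry a
factor `x i` or `x j`. -/
lemma pderiv_pderiv_angular {v : Space n → ℝ} (hv : ContDiffOn ℝ ∞ v {0}ᶜ) (i j : Fin n)
    {x : Space n} (hx : ‖x‖ = 1) :
    pderiv i (pderiv j (angular v)) x = pderiv i (pderiv j v) x
      - (if i = j then v x else 0) + x i * (3 * x j * v x - pderiv j v x)
      - x j * pderiv i v x := by
  have hx0 := ne_zero_of_norm_one hx
  have d : ∀ {g : Space n → ℝ}, ContDiffOn ℝ ∞ g {0}ᶜ → DifferentiableAt ℝ g x :=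
    fun hg => differentiableAt_of_smooth hg hx0
  have cN := contDiffOn_norm_inv (n := n)
  have cj : ContDiffOn ℝ ∞ (fun y : Space n => -1 * y j) {0}ᶜ :=
    contDiffOn_const.mul (contDiffOn_coord j _)
  have e : pderiv j (angular v) =ᶠ[𝓝 x]
      fun y => (-1 * y j) * ‖y‖⁻¹ ^ 3 * v y + ‖y‖⁻¹ * pderiv j v y := by
    refine eventuallyEq_of_forall_ne (fun y hy => ?_) hx0
    rw [pderiv_angular hv j hy]; ring
  rw [pderiv_congr i e, pderiv_add i (d ((cj.mul (cN.pow 3)).mul hv))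
    (d (cN.mul (contDiffOn_pderiv hv j))), pderiv_mul i (d (cj.mul (cN.pow 3))) (d hv),
    pderiv_mul i (d cj) (d (cN.pow 3)), pderiv_mul i (d cN) (d (contDiffOn_pderiv hv j)),
    pderiv_const_mul i _ (d (contDiffOn_coord j _)), pderiv_pow i 3 (d cN),
    pderiv_norm_inv i hx0, pderiv_coord, hx]
  by_cases hij : i = j <;> simp [hij] <;> ring

/-- The Hessian contributes the full gradient of `lap v`, and the subtracted pure trace part removes
1/(n-1) of it. The last summand is radial, hence invisible when paired with a tangential gradient.
-/
lemma sum_pderiv_tfHess {v : Space n → ℝ} (hv : ContDiffOn ℝ ∞ v {0}ᶜ) {x : Space n}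
    (hx : ‖x‖ = 1) (j : Fin n) :
    ∑ i, pderiv i (tfHess v i j) x = (1 - ((n : ℝ) - 1)⁻¹) * pderiv j (lap v) x
      + ((n : ℝ) - 1)⁻¹ * ((∑ i, x i * pderiv i (lap v) x) + lap v x * ((n : ℝ) - 1)) * x j := by
  have hi : ∀ i, pderiv i (tfHess v i j) x = pderiv i (pderiv i (pderiv j v)) x
      - ((n : ℝ) - 1)⁻¹ * (if i = j then pderiv i (lap v) x else 0)
      + ((n : ℝ) - 1)⁻¹ * x j * (x i * pderiv i (lap v) x)
      + ((n : ℝ) - 1)⁻¹ * lap v x * x j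
      + ((n : ℝ) - 1)⁻¹ * lap v x * (if i = j then x i else 0)
      - 2 * ((n : ℝ) - 1)⁻¹ * lap v x * x j * (x i * x i) := by
    intro i
    rw [pderiv_tfHess hv hx]
    by_cases hij : i = j <;> simp [hij] <;> ring
  simp only [hi, Finset.sum_add_distrib, Finset.sum_sub_distrib, ← Finset.mul_sum]
  rw [sum_pderiv_pderiv_pderiv hv j (ne_zero_of_norm_one hx), sum_sq_of_norm_one hx]
  simp only [Finset.sum_ite_eq', Finset.mem_univ, if_true, Finset.sum_const, Finset.card_univ,
    Fintype.card_fin, nsmul_eq_mul]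
  ring

/-- The vector field whose divergence carries the rigidity argument. -/
def rigidityField (ρ v : Space n → ℝ) (i : Fin n) (y : Space n) : ℝ :=
  ρ y ^ (n - 2) * ∑ j, tfHess v i j y * pderiv j (angular v) y

lemma sum_mul_sum_comm (a b : Fin n → ℝ) (A : Fin n → Fin n → ℝ) :
    ∑ i, a i * ∑ j, A i j * b j = ∑ j, (∑ i, a i * A i j) * b j := by
  simp only [Finset.mul_sum, Finset.sum_mul]
  rw [Finset.sum_comm]
  refine Finset.sum_congr rfl fun j _ => Finset.sum_congr rfl fun i _ => by ring

/-- `tfHess` is symmetric, trace-free and annihilates x. Contracted with it, the Hessian of `angular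
v` loses its multiple of the identity and every term with a factor `x i` or `x j`, and what is left
is `tfHess` itself. -/
lemma contraction_tfHess_hess {v : Space n → ℝ} (hv : ContDiffOn ℝ ∞ v {0}ᶜ)
    (hvh : IsHomogeneous 1 v) (hn : 3 ≤ n) {x : Space n} (hx : ‖x‖ = 1) :
    ∑ i, ∑ j, tfHess v i j x * pderiv i (pderiv j (angular v)) x
      = ∑ i, ∑ j, tfHess v i j x ^ 2 := by
  have hx0 := ne_zero_of_norm_one hx
  have hr : ∀ i, ∑ j, tfHess v i j x * x j = 0 := by
    intro i
    rw [← sum_coord_mul_tfHess hv hvh i hx0]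
    refine Finset.sum_congr rfl fun j _ => ?_
    rw [tfHess_symm hv i j hx0, mul_comm]
  have hl : ∀ j, ∑ i, x i * tfHess v i j x = 0 := fun j => sum_coord_mul_tfHess hv hvh j hx0
  have htr := trace_tfHess hn v hx0
  have hterm : ∀ i j, tfHess v i j x * pderiv i (pderiv j (angular v)) x
      = tfHess v i j x ^ 2
        + (((n : ℝ) - 1)⁻¹ * lap v x - v x) * (if i = j then tfHess v i j x else 0)
        + x i * (tfHess v i j x * ((3 * v x - ((n : ℝ) - 1)⁻¹ * lap v x) * x j - pderiv j v x))
        - pderiv i v x * (tfHess v i j x * x j) := by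
    intro i j
    rw [pderiv_pderiv_angular hv i j hx]
    have : pderiv i (pderiv j v) x = tfHess v i j x
        + ((n : ℝ) - 1)⁻¹ * lap v x * ((if i = j then 1 else 0) - x i * x j) := by
      unfold tfHess; rw [hx]; ring
    rw [this]
    by_cases hij : i = j <;> simp [hij] <;> ring
  simp only [hterm, Finset.sum_add_distrib, Finset.sum_sub_distrib, ← Finset.mul_sum]
  rw [sum_mul_sum_comm]
  simp [hr, hl, htr]

/-- The exponent n - 2 is forced by a cancellation. Differentiating the weight and using the
equation gives -(n-2)/(n-1) ρ^(n-2) ⟨∇ lap v, ∇u⟩, while the divergence of `tfHess` gives the same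
expression with the opposite sign. Only the two terms with a sign survive. -/
lemma divergence_rigidityField {ρ v : Space n → ℝ} (hn : 3 ≤ n) (hρ : ContDiffOn ℝ ∞ ρ {0}ᶜ)
    (hv : ContDiffOn ℝ ∞ v {0}ᶜ) (hvh : IsHomogeneous 1 v)
    {x : Space n} (hx : ‖x‖ = 1) {k : ℝ}
    (pde : ∀ X : Space n, inner ℝ x X = 0 →
      ∑ i, X i * ∑ j, pderiv i (pderiv j v) x * pderiv j ρ x
        = ((n : ℝ) - 1)⁻¹ * (lap v x * ∑ i, X i * pderiv i ρ x
          - ρ x * ∑ i, X i * pderiv i (lap v) x) + k * ∑ i, X i * pderiv i v x) :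
    ∑ i, pderiv i (rigidityField ρ v i) x
      = ((n : ℝ) - 2) * ρ x ^ (n - 3) * (k * ∑ i, pderiv i (angular v) x ^ 2)
        + ρ x ^ (n - 2) * ∑ i, ∑ j, tfHess v i j x ^ 2 := by
  have hx0 := ne_zero_of_norm_one hx
  have d : ∀ {g : Space n → ℝ}, ContDiffOn ℝ ∞ g {0}ᶜ → DifferentiableAt ℝ g x :=
    fun hg => differentiableAt_of_smooth hg hx0
  have hm : (n : ℝ) - 1 ≠ 0 := by
    have : (3 : ℝ) ≤ n := by exact_mod_cast hn
    linarith
  have cu := contDiffOn_angular hv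
  have cA := contDiffOn_tfHess hv
  have cAu : ∀ i j, ContDiffOn ℝ ∞ (fun y => tfHess v i j y * pderiv j (angular v) y) {0}ᶜ :=
    fun i j => (cA i j).mul (contDiffOn_pderiv cu j)
  have cS : ∀ i, ContDiffOn ℝ ∞ (fun y => ∑ j, tfHess v i j y * pderiv j (angular v) y) {0}ᶜ :=
    fun i => ContDiffOn.sum fun j _ => cAu i j
  have hu : ∑ j, x j * pderiv j (angular v) x = 0 := by
    simpa using (isHomogeneous_angular hvh).euler cu hx0
  have hu' : ∑ j, pderiv j (angular v) x * x j = 0 := by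
    rw [← hu]; exact Finset.sum_congr rfl fun j _ => mul_comm _ _
  have hvj : ∀ j, pderiv j v x = pderiv j (angular v) x + v x * x j := by
    intro j; rw [pderiv_angular hv j hx0, hx]; ring
  have hZ : ∀ i, pderiv i (rigidityField ρ v i) x
      = ((n : ℝ) - 2) * ρ x ^ (n - 3) * (pderiv i ρ x * ∑ j, tfHess v i j x * pderiv j (angular v) x)
        + ρ x ^ (n - 2) * (∑ j, pderiv i (tfHess v i j) x * pderiv j (angular v) x
          + ∑ j, tfHess v i j x * pderiv i (pderiv j (angular v)) x) := by
    intro i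
    have e : rigidityField ρ v i
      = fun y => ρ y ^ (n - 2) * ∑ j, tfHess v i j y * pderiv j (angular v) y := rfl
    rw [e, pderiv_mul i (d (hρ.pow _)) (d (cS i)), pderiv_pow i _ (d hρ),
      pderiv_sum _ i fun j _ => d (cAu i j), ← Finset.sum_add_distrib]
    simp only [pderiv_mul i (d (cA i _)) (d (contDiffOn_pderiv cu _))]
    rw [show n - 2 - 1 = n - 3 by omega, Nat.cast_sub (by omega)]
    push_cast
    ring
  simp only [hZ, Finset.sum_add_distrib, ← Finset.mul_sum]
  rw [contraction_tfHess_hess hv hvh hn hx]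
  have hdiv : ∑ i, ∑ j, pderiv i (tfHess v i j) x * pderiv j (angular v) x
      = (1 - ((n : ℝ) - 1)⁻¹) * ∑ j, pderiv j (lap v) x * pderiv j (angular v) x := by
    rw [Finset.sum_comm]
    have hj : ∀ j, ∑ i, pderiv i (tfHess v i j) x * pderiv j (angular v) x
        = (1 - ((n : ℝ) - 1)⁻¹) * (pderiv j (lap v) x * pderiv j (angular v) x)
          + ((n : ℝ) - 1)⁻¹ * ((∑ i, x i * pderiv i (lap v) x) + lap v x * ((n : ℝ) - 1))
            * (x j * pderiv j (angular v) x) := by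
      intro j
      rw [← Finset.sum_mul, sum_pderiv_tfHess hv hx j]
      ring
    simp only [hj, Finset.sum_add_distrib, ← Finset.mul_sum, hu]
    ring
  have hgrad : ∑ i, pderiv i ρ x * ∑ j, tfHess v i j x * pderiv j (angular v) x
      = -((n : ℝ) - 1)⁻¹ * ρ x * ∑ j, pderiv j (lap v) x * pderiv j (angular v) x
        + k * ∑ j, pderiv j (angular v) x ^ 2 := by
    -- The equation is tested with the gradient of `angular v`, which is tangential because this
    -- function has degree zero.
    have hX := pde (WithLp.toLp 2 fun j => pderiv j (angular v) x) (by
      rw [PiLp.inner_apply]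
      simpa [mul_comm] using hu)
    simp only at hX
    have h1 : ∑ j, pderiv j (angular v) x * pderiv j v x = ∑ j, pderiv j (angular v) x ^ 2 := by
      have : ∀ j, pderiv j (angular v) x * pderiv j v x
          = pderiv j (angular v) x ^ 2 + v x * (x j * pderiv j (angular v) x) := by
        intro j; rw [hvj j]; ring
      simp only [this, Finset.sum_add_distrib, ← Finset.mul_sum, hu]
      ring
    rw [h1] at hX
    have h2 : ∀ i j, tfHess v i j x * pderiv j (angular v) x
        = pderiv i (pderiv j v) x * pderiv j (angular v) x
          - ((n : ℝ) - 1)⁻¹ * lap v x * (if i = j then pderiv j (angular v) x else 0)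
          + ((n : ℝ) - 1)⁻¹ * lap v x * x i * (x j * pderiv j (angular v) x) := by
      intro i j
      unfold tfHess
      rw [hx]
      by_cases hij : i = j <;> simp [hij] <;> ring
    simp only [h2, Finset.sum_add_distrib, Finset.sum_sub_distrib, ← Finset.mul_sum, hu]
    simp only [Finset.sum_ite_eq, Finset.mem_univ, if_true, mul_zero, add_zero, mul_sub,
      Finset.sum_sub_distrib]
    rw [sum_mul_sum_comm]
    have h3 : ∑ j, (∑ i, pderiv i ρ x * pderiv i (pderiv j v) x) * pderiv j (angular v) x
        = ∑ i, pderiv i (angular v) x * ∑ j, pderiv i (pderiv j v) x * pderiv j ρ x := by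
      refine Finset.sum_congr rfl fun j _ => ?_
      rw [mul_comm]
      congr 1
      refine Finset.sum_congr rfl fun i _ => ?_
      rw [pderiv_comm hv i j hx0, mul_comm]
    rw [h3, hX]
    have h4 : ∑ i, pderiv i ρ x * (((n : ℝ) - 1)⁻¹ * lap v x * pderiv i (angular v) x)
        = ((n : ℝ) - 1)⁻¹ * lap v x * ∑ i, pderiv i (angular v) x * pderiv i ρ x := by
      rw [Finset.mul_sum]
      exact Finset.sum_congr rfl fun j _ => by ring
    have h5 : ∑ i, pderiv i (angular v) x * pderiv i (lap v) x
        = ∑ i, pderiv i (lap v) x * pderiv i (angular v) x :=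
      Finset.sum_congr rfl fun j _ => mul_comm _ _
    rw [h4, h5]
    ring
  rw [hdiv, hgrad, show ρ x ^ (n - 2) = ρ x ^ (n - 3) * ρ x by
    rw [← pow_succ]; congr 1; omega]
  field_simp
  ring

end

/-! ### The kernel of the trace-free Hessian and rigidity of the linearized equation -/

section
variable {n : ℕ}

lemma norm_normalize {y : Space n} (hy : y ≠ 0) : ‖‖y‖⁻¹ • y‖ = 1 := by
  rw [norm_smul, norm_inv, norm_norm, inv_mul_cancel₀ (norm_ne_zero_iff.2 hy)]

lemma norm_smul_normalize {y : Space n} (hy : y ≠ 0) : ‖y‖ • (‖y‖⁻¹ • y) = y := by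
  rw [smul_smul, mul_inv_cancel₀ (norm_ne_zero_iff.2 hy), one_smul]

lemma IsHomogeneous.eq_zero {k : ℤ} {g : Space n → ℝ} (hg : IsHomogeneous k g)
    (h : ∀ x, ‖x‖ = 1 → g x = 0) {y : Space n} (hy : y ≠ 0) : g y = 0 := by
  rw [← norm_smul_normalize hy, hg _ (norm_pos_iff.2 hy) _ (ne_zero_of_norm_one (norm_normalize hy)),
    h _ (norm_normalize hy), mul_zero]

/-- The dimension bound makes the punctured space connected. -/
lemma exists_const_of_pderiv_eq_zero (hn : 2 ≤ n) {g : Space n → ℝ}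
    (hg : ContDiffOn ℝ ∞ g {0}ᶜ) (h : ∀ i, ∀ y ≠ 0, pderiv i g y = 0) :
    ∃ c, ∀ y ≠ 0, g y = c := by
  have hr : 1 < Module.rank ℝ (Space n) := by
    rw [← Module.finrank_eq_rank, finrank_euclideanSpace_fin]
    exact_mod_cast hn
  obtain ⟨c, hc⟩ := isOpen_compl_singleton.exists_is_const_of_fderiv_eq_zero (𝕜 := ℝ)
    (isConnected_compl_singleton_of_one_lt_rank hr (0 : Space n)).isPreconnected
    (fun y hy => (differentiableAt_of_smooth hg hy).differentiableWithinAt) (f := g)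
    (fun y hy => by
      ext X
      rw [fderiv_eq_sum_pderiv]
      simp [h _ y hy])
  exact ⟨c, fun y hy => hc y hy⟩

/-- A function of degree one with pure trace Hessian is a combination of `‖y‖` and the Cartesian
coordinates. -/
theorem exists_affine_of_tfHess_eq_zero (hn : 3 ≤ n) {v : Space n → ℝ}
    (hv : ContDiffOn ℝ ∞ v {0}ᶜ) (hvh : IsHomogeneous 1 v)
    (hA : ∀ i j, ∀ y ≠ 0, tfHess v i j y = 0) :
    ∃ (a₀ : ℝ) (a : Fin n → ℝ), ∀ y ≠ 0, v y = a₀ * ‖y‖ + ∑ i, a i * y i := by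
  have hm : (3 : ℝ) ≤ n := by exact_mod_cast hn
  have hm1 : (n : ℝ) - 1 ≠ 0 := by linarith
  have hm2 : (n : ℝ) - 2 ≠ 0 := by linarith
  have cl := contDiffOn_lap hv
  have hl : IsHomogeneous (-1) (lap v) := IsHomogeneous.sum fun a _ =>
    (hvh.pderiv hv a).pderiv (contDiffOn_pderiv hv a) a
  have cg : ContDiffOn ℝ ∞ (fun y => ‖y‖ * lap v y) {0}ᶜ := contDiffOn_norm'.mul cl
  have hg : IsHomogeneous 0 (fun y => ‖y‖ * lap v y) := isHomogeneous_norm.mul hl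
  -- The divergence of `tfHess` vanishes as well. With Euler's identity for `lap v`, of degree -1,
  -- it equals (n-2)/(n-1) times the gradient of |y| `lap v` at unit vectors, and n ≠ 2 allows
  -- division.
  obtain ⟨c, hc⟩ := exists_const_of_pderiv_eq_zero (by omega) cg (by
    intro j y hy
    refine (hg.pderiv cg j).eq_zero ?_ hy
    intro x hx
    have hx0 := ne_zero_of_norm_one hx
    have h0 : ∑ i, pderiv i (tfHess v i j) x = 0 := by
      refine Finset.sum_eq_zero fun i _ => ?_
      rw [pderiv_congr i (eventuallyEq_of_forall_ne (hA i j) hx0)]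
      simp [pderiv]
    have he := hl.euler cl hx0
    rw [sum_pderiv_tfHess hv hx, he] at h0
    rw [pderiv_mul j (differentiableAt_of_smooth contDiffOn_norm' hx0)
      (differentiableAt_of_smooth cl hx0), pderiv_norm j hx0, hx]
    field_simp at h0
    push_cast at h0
    have : ((n : ℝ) - 2) * (x j * lap v x + pderiv j (lap v) x) = 0 := by linear_combination h0
    have := (mul_eq_zero.1 this).resolve_left hm2
    linarith)
  -- The Hessian of |y| is |y|⁻¹ times the projection away from y. So this multiple of |y| has the
  -- same Hessian as v, the difference has constant gradient, and Euler's identity then makes the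
  -- difference linear.
  set a₀ : ℝ := ((n : ℝ) - 1)⁻¹ * c with ha₀
  have cN := contDiffOn_norm' (n := n)
  have cNi := contDiffOn_norm_inv (n := n)
  have cf : ContDiffOn ℝ ∞ (fun y => v y - a₀ * ‖y‖) {0}ᶜ := hv.sub (contDiffOn_const.mul cN)
  have hf : IsHomogeneous 1 (fun y => v y - a₀ * ‖y‖) := by
    have := (IsHomogeneous.const (n := n) a₀).mul isHomogeneous_norm
    exact hvh.sub this
  have hpf : ∀ j, ∀ y ≠ 0, pderiv j (fun y => v y - a₀ * ‖y‖) y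
      = pderiv j v y - a₀ * (y j * ‖y‖⁻¹) := by
    intro j y hy
    rw [pderiv_sub j (differentiableAt_of_smooth hv hy)
      (differentiableAt_of_smooth (contDiffOn_const.mul cN) hy),
      pderiv_const_mul j _ (differentiableAt_of_smooth cN hy), pderiv_norm j hy]
    ring
  have hconst : ∀ j, ∃ b, ∀ y ≠ 0, pderiv j (fun y => v y - a₀ * ‖y‖) y = b := by
    intro j
    refine exists_const_of_pderiv_eq_zero (by omega) (contDiffOn_pderiv cf j) ?_
    intro i y hy
    have cy : ContDiffOn ℝ ∞ (fun y : Space n => y j * ‖y‖⁻¹) {0}ᶜ := (contDiffOn_coord j _).mul cNi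
    rw [pderiv_congr i (eventuallyEq_of_forall_ne (hpf j) hy),
      pderiv_sub i (differentiableAt_of_smooth (contDiffOn_pderiv hv j) hy)
        (differentiableAt_of_smooth (contDiffOn_const.mul cy) hy),
      pderiv_const_mul i _ (differentiableAt_of_smooth cy hy),
      pderiv_mul i (differentiableAt_of_smooth (contDiffOn_coord j _) hy)
        (differentiableAt_of_smooth cNi hy), pderiv_norm_inv i hy, pderiv_coord]
    have h1 := hA i j y hy
    have hny : ‖y‖ ≠ 0 := norm_ne_zero_iff.2 hy
    have h2 : lap v y = c * ‖y‖⁻¹ := by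
      rw [← hc y hy]; field_simp
    unfold tfHess at h1
    rw [h2] at h1
    rw [ha₀]
    linear_combination h1
  choose a ha using hconst
  refine ⟨a₀, a, fun y hy => ?_⟩
  have he := hf.euler cf hy
  simp only [ha _ y hy] at he
  push_cast at he
  have : ∑ i, a i * y i = ∑ i, y i * a i := Finset.sum_congr rfl fun i _ => mul_comm _ _
  rw [this, he]
  ring

/-- Rigidity for the linearized equation on the unit sphere, written for the degree one extension
`v` of the unknown. -/
theorem exists_lowModes_of_linearized_equation (hn : 3 ≤ n) {ρ v k : Space n → ℝ}
    (hρ : ContDiffOn ℝ ∞ ρ {0}ᶜ) (hρh : IsHomogeneous 0 ρ) (hρpos : ∀ y ≠ 0, 0 < ρ y)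
    (hv : ContDiffOn ℝ ∞ v {0}ᶜ) (hvh : IsHomogeneous 1 v) (hk : ∀ x, ‖x‖ = 1 → 0 ≤ k x)
    (pde : ∀ x X : Space n, ‖x‖ = 1 → inner ℝ x X = 0 →
      ∑ i, X i * ∑ j, pderiv i (pderiv j v) x * pderiv j ρ x
        = ((n : ℝ) - 1)⁻¹ * (lap v x * ∑ i, X i * pderiv i ρ x
          - ρ x * ∑ i, X i * pderiv i (lap v) x) + k x * ∑ i, X i * pderiv i v x) :
    ∃ (a₀ : ℝ) (a : Fin n → ℝ), (∀ x, ‖x‖ = 1 → v x = a₀ + ∑ i, a i * x i) ∧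
      ∀ x, ‖x‖ = 1 → k x * ∑ j, (a j - (∑ i, a i * x i) * x j) ^ 2 = 0 := by
  have hm : (3 : ℝ) ≤ n := by exact_mod_cast hn
  have cu := contDiffOn_angular hv
  have hdivf : ∀ x : Space n, ‖x‖ = 1 → ∑ i, pderiv i (rigidityField ρ v i) x
      = ((n : ℝ) - 2) * ρ x ^ (n - 3) * (k x * ∑ i, pderiv i (angular v) x ^ 2)
        + ρ x ^ (n - 2) * ∑ i, ∑ j, tfHess v i j x ^ 2 := fun x hx =>
    divergence_rigidityField hn hρ hv hvh hx fun X hX => pde x X hx hX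
  have hn1 : ∀ x : Space n, ‖x‖ = 1 →
      0 ≤ ((n : ℝ) - 2) * ρ x ^ (n - 3) * (k x * ∑ i, pderiv i (angular v) x ^ 2) := by
    intro x hx
    have := hρpos x (ne_zero_of_norm_one hx)
    have := hk x hx
    have : (0 : ℝ) ≤ (n : ℝ) - 2 := by linarith
    positivity
  have hn2 : ∀ x : Space n, ‖x‖ = 1 →
      0 ≤ ρ x ^ (n - 2) * ∑ i, ∑ j, tfHess v i j x ^ 2 := by
    intro x hx
    have := hρpos x (ne_zero_of_norm_one hx)
    positivity
  have hdiv0 : ∀ x : Space n, ‖x‖ = 1 → ∑ i, pderiv i (rigidityField ρ v i) x = 0 := by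
    -- Degree 0 from the power of ρ, -1 from `tfHess` and -1 from the gradient of `angular v`.
    refine divergence_eq_zero_of_nonneg (k := -2) ?_ ?_ ?_ ?_
    · intro i
      exact (hρ.pow _).mul (ContDiffOn.sum fun j _ =>
        (contDiffOn_tfHess hv i j).mul (contDiffOn_pderiv cu j))
    · intro i
      exact (hρh.pow_zero (n - 2)).mul (IsHomogeneous.sum fun j _ =>
        (isHomogeneous_tfHess hv hvh i j).mul ((isHomogeneous_angular hvh).pderiv cu j))
    · intro y hy
      have : ∀ i, y i * rigidityField ρ v i y
          = ρ y ^ (n - 2) * (y i * ∑ j, tfHess v i j y * pderiv j (angular v) y) := by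
        intro i; unfold rigidityField; ring
      simp only [this, ← Finset.mul_sum]
      rw [sum_mul_sum_comm]
      simp [sum_coord_mul_tfHess hv hvh _ hy]
    · intro x hx
      rw [hdivf x hx]
      exact add_nonneg (hn1 x hx) (hn2 x hx)
  have hA : ∀ i j, ∀ y ≠ 0, tfHess v i j y = 0 := by
    intro i j y hy
    refine (isHomogeneous_tfHess hv hvh i j).eq_zero (fun x hx => ?_) hy
    have h0 := hdiv0 x hx
    rw [hdivf x hx] at h0
    have h1 : ρ x ^ (n - 2) * ∑ i, ∑ j, tfHess v i j x ^ 2 = 0 := by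
      linarith [hn1 x hx, hn2 x hx]
    have h2 := (mul_eq_zero.1 h1).resolve_left (pow_pos (hρpos x (ne_zero_of_norm_one hx)) _).ne'
    rw [Finset.sum_eq_zero_iff_of_nonneg fun i _ => Finset.sum_nonneg fun j _ => sq_nonneg _] at h2
    have h3 := h2 i (Finset.mem_univ _)
    rw [Finset.sum_eq_zero_iff_of_nonneg fun j _ => sq_nonneg _] at h3
    exact pow_eq_zero_iff (two_ne_zero) |>.1 (h3 j (Finset.mem_univ _))
  obtain ⟨a₀, a, ha⟩ := exists_affine_of_tfHess_eq_zero hn hv hvh hA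
  have hau : ∀ x : Space n, ‖x‖ = 1 → v x = a₀ + ∑ i, a i * x i := by
    intro x hx
    rw [ha x (ne_zero_of_norm_one hx), hx, mul_one]
  refine ⟨a₀, a, hau, fun x hx => ?_⟩
  have hx0 := ne_zero_of_norm_one hx
  have hvj : ∀ j, pderiv j v x = a₀ * x j + a j := by
    intro j
    have c1 : ContDiffOn ℝ ∞ (fun y : Space n => a₀ * ‖y‖) {0}ᶜ := contDiffOn_const.mul contDiffOn_norm'
    have c2 : ∀ i, ContDiffOn ℝ ∞ (fun y : Space n => a i * y i) {0}ᶜ := fun i =>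
      contDiffOn_const.mul (contDiffOn_coord i _)
    rw [pderiv_congr j (eventuallyEq_of_forall_ne ha hx0),
      pderiv_add j (differentiableAt_of_smooth c1 hx0)
        (differentiableAt_of_smooth (ContDiffOn.sum fun i _ => c2 i) hx0),
      pderiv_sum _ j fun i _ => differentiableAt_of_smooth (c2 i) hx0,
      pderiv_const_mul j _ (differentiableAt_of_smooth contDiffOn_norm' hx0), pderiv_norm j hx0, hx]
    simp only [pderiv_const_mul j _ (differentiableAt_of_smooth (contDiffOn_coord _ _) hx0),
      pderiv_coord]
    simp
  have huj : ∀ j, pderiv j (angular v) x = a j - (∑ i, a i * x i) * x j := by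
    intro j
    rw [pderiv_angular hv j hx0, hvj j, hau x hx, hx]
    ring
  have h0 := hdiv0 x hx
  rw [hdivf x hx] at h0
  have h1 : ((n : ℝ) - 2) * ρ x ^ (n - 3) * (k x * ∑ i, pderiv i (angular v) x ^ 2) = 0 := by
    linarith [hn1 x hx, hn2 x hx]
  have h2 : ((n : ℝ) - 2) * ρ x ^ (n - 3) ≠ 0 :=
    mul_ne_zero (by linarith) (pow_pos (hρpos x hx0) _).ne'
  simpa only [huj] using (mul_eq_zero.1 h1).resolve_left h2

end

section
variable {n : ℕ}

/-! ### The connection in the coordinates `w = t - r*`, `r`, `θ = y / ‖y‖` -/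

lemma hasFDerivAt_fun_div {E : Type*} [NormedAddCommGroup E] [NormedSpace ℝ E] {g h : E → ℝ}
    {g' h' : E →L[ℝ] ℝ} {x : E} (hg : HasFDerivAt g g' x) (hh : HasFDerivAt h h' x)
    (h0 : h x ≠ 0) :
    HasFDerivAt (fun y => g y / h y) ((h x)⁻¹ • g' - (g x / h x ^ 2) • h') x := by
  have h1 : HasFDerivAt (fun y => (h y)⁻¹) _ x := (hasDerivAt_inv h0).comp_hasFDerivAt x hh
  have h2 : HasFDerivAt (fun y => g y * (h y)⁻¹) _ x := hg.mul h1
  simp only [div_eq_mul_inv]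
  refine h2.congr_fderiv ?_
  ext X
  simp
  ring

/-- The derivative is exposed only through its values, so that later computations with the metric
see `dr` instead of composed linear maps. -/
lemma hasFDerivAt_norm_snd {p : Event n} (hp : p.2 ≠ 0) :
    ∃ N : Event n →L[ℝ] ℝ, HasFDerivAt (fun q : Event n => ‖q.2‖) N p ∧ ∀ A, N A = dr p A := by
  have h := (differentiableAt_of_smooth contDiffOn_norm' hp).hasFDerivAt
  have h2 : HasFDerivAt (fun q : Event n => ‖q.2‖) _ p := h.comp p hasFDerivAt_snd
  refine ⟨_, h2, fun A => ?_⟩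
  simp [fderiv_norm_apply hp, dr]

lemma hasFDerivAt_dr {p : Event n} (hp : p.2 ≠ 0) (B : Event n) :
    ∃ N : Event n →L[ℝ] ℝ, HasFDerivAt (fun q : Event n => dr q B) N p ∧
      ∀ A, N A = (inner ℝ A.2 B.2 - dr p A * dr p B) / ‖p.2‖ := by
  have hn : ‖p.2‖ ≠ 0 := norm_ne_zero_iff.2 hp
  obtain ⟨N, hN, hNA⟩ := hasFDerivAt_norm_snd hp
  have h1 : HasFDerivAt (fun q : Event n => inner ℝ q.2 B.2) _ p :=
    (hasFDerivAt_snd (𝕜 := ℝ)).inner ℝ (hasFDerivAt_const B.2 p)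
  have h2 : HasFDerivAt (fun q : Event n => inner ℝ q.2 B.2 / ‖q.2‖) _ p := hasFDerivAt_fun_div h1 hN hn
  refine ⟨_, h2, fun A => ?_⟩
  simp [hNA, dr, fderivInnerCLM_apply]
  field_simp

lemma fderiv_metric {f : ℝ → ℝ} {p : Event n} (hp : p.2 ≠ 0) {f' : ℝ}
    (hf : HasDerivAt f f' ‖p.2‖) (hf0 : f ‖p.2‖ ≠ 0) (A B Z : Event n) :
    fderiv ℝ (fun q => metric f q B Z) p A
      = -2 * f ‖p.2‖ * f' * dr p A * B.1 * Z.1 - 2 * f' / f ‖p.2‖ ^ 3 * dr p A * dr p B * dr p Z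
        + (1 / f ‖p.2‖ ^ 2 - 1) * ((inner ℝ A.2 B.2 - dr p A * dr p B) * dr p Z
          + (inner ℝ A.2 Z.2 - dr p A * dr p Z) * dr p B) / ‖p.2‖ := by
  have hn : ‖p.2‖ ≠ 0 := norm_ne_zero_iff.2 hp
  obtain ⟨N, hN, hNA⟩ := hasFDerivAt_norm_snd hp
  obtain ⟨DB, hB, hDB⟩ := hasFDerivAt_dr hp B
  obtain ⟨DZ, hZ, hDZ⟩ := hasFDerivAt_dr hp Z
  have hfN : HasFDerivAt (fun q : Event n => f ‖q.2‖) _ p := hf.comp_hasFDerivAt p hN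
  have hBZ := hB.mul hZ
  have h : HasFDerivAt (fun q => metric f q B Z) _ p :=
    ((hfN.pow 2).neg.mul_const (B.1 * Z.1)).add
      (hasFDerivAt_fun_div hBZ (hfN.pow 2) (pow_ne_zero 2 hf0)) |>.add (hBZ.const_sub (inner ℝ B.2 Z.2))
  rw [h.fderiv]
  simp [hNA, hDB, hDZ]
  field_simp
  ring

/-- In the coordinates (t, y) only f and dr vary with the point. The terms with f' come from f; the
last one comes from the Euclidean Hessian of |y|, weighted by 1/f² - 1, the amount by which the
coefficient of dr² exceeds the Euclidean one. -/
lemma christoffel_eq {f : ℝ → ℝ} {p : Event n} (hp : p.2 ≠ 0) {f' : ℝ}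
    (hf : HasDerivAt f f' ‖p.2‖) (hf0 : f ‖p.2‖ ≠ 0) (A B Z : Event n) :
    christoffel f p A B Z
      = -(f ‖p.2‖ * f') * (dr p A * B.1 * Z.1 + dr p B * A.1 * Z.1 - dr p Z * A.1 * B.1)
        - f' / f ‖p.2‖ ^ 3 * dr p A * dr p B * dr p Z
        + (1 / f ‖p.2‖ ^ 2 - 1) * (inner ℝ A.2 B.2 - dr p A * dr p B) * dr p Z / ‖p.2‖ := by
  unfold christoffel
  rw [fderiv_metric hp hf hf0, fderiv_metric hp hf hf0, fderiv_metric hp hf hf0,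
    real_inner_comm A.2 B.2, real_inner_comm Z.2 B.2, real_inner_comm Z.2 A.2]
  ring

/-- The vector with components `(a, b, c)` along `∂_w`, `∂_r` and the sphere, at the point with
`r = R` and `θ = o`. Here `Q = f(R)²`. -/
def ofPolar (Q R : ℝ) (o : Space n) (a b : ℝ) (c : Space n) : Event n :=
  (a + b / Q, b • o + R • c)

/-- The metric `-f² dw² - 2 dw dr + r² |dθ|²`. -/
def polarInner (Q R : ℝ) (a b : ℝ) (c : Space n) (a₂ b₂ : ℝ) (c₂ : Space n) : ℝ :=
  -Q * a * a₂ - a * b₂ - b * a₂ + R ^ 2 * inner ℝ c c₂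

/-- The Christoffel symbols of the first kind of `-f² dw² - 2 dw dr + r² |dθ|²`, where `P` is
the product of `f` and its derivative. -/
def polarGamma (P R : ℝ) (a b : ℝ) (c : Space n) (a' b' : ℝ) (c' : Space n) (a'' b'' : ℝ)
    (c'' : Space n) : ℝ :=
  -P * (b * a' * a'' + a * b' * a'' - a * a' * b'')
    + R * (b * inner ℝ c' c'' + b' * inner ℝ c c'' - b'' * inner ℝ c c')

lemma dr_smul {t R : ℝ} (hR : 0 < R) {o : Space n} (ho : ‖o‖ = 1) (X : Event n) :
    dr (t, R • o) X = inner ℝ o X.2 := by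
  have : ‖R • o‖ = R := by rw [norm_smul, ho, mul_one, Real.norm_of_nonneg hR.le]
  unfold dr
  simp only [this, inner_smul_left]
  simp
  field_simp

lemma metric_ofPolar {f : ℝ → ℝ} {t R : ℝ} (hR : 0 < R) {o : Space n} (ho : ‖o‖ = 1)
    (hf0 : f R ≠ 0) {a b a' b' : ℝ} {c c' : Space n} (hc : inner ℝ o c = 0)
    (hc' : inner ℝ o c' = 0) :
    metric f (t, R • o) (ofPolar (f R ^ 2) R o a b c) (ofPolar (f R ^ 2) R o a' b' c')
      = polarInner (f R ^ 2) R a b c a' b' c' := by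
  have hN : ‖R • o‖ = R := by rw [norm_smul, ho, mul_one, Real.norm_of_nonneg hR.le]
  have hoo : inner ℝ o o = 1 := by rw [real_inner_self_eq_norm_sq, ho]; norm_num
  have hco : inner ℝ c o = 0 := by rw [real_inner_comm, hc]
  unfold metric polarInner
  simp only [dr_smul hR ho, hN]
  simp only [ofPolar, inner_add_left, inner_add_right, real_inner_smul_left,
    real_inner_smul_right, hoo, hc, hc', hco]
  field_simp
  ring

/-- `⟨D_X W, Z⟩` in polar components. -/
theorem covInner_eq_polar {f rs : ℝ → ℝ} {F W : Space n → Event n} {x X : Space n} {Z : Event n}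
    {w r a b : Space n → ℝ} {o c : Space n → Space n} {f' az bz : ℝ} {cz : Space n} (hx : ‖x‖ = 1)
    (hF : radialExt F =ᶠ[𝓝 x] fun y => (w y + rs (r y), r y • o y))
    (hW : radialExt W =ᶠ[𝓝 x] fun y => ofPolar (f (r y) ^ 2) (r y) (o y) (a y) (b y) (c y))
    (hw : DifferentiableAt ℝ w x) (hr : DifferentiableAt ℝ r x) (ho : DifferentiableAt ℝ o x)
    (ha : DifferentiableAt ℝ a x) (hb : DifferentiableAt ℝ b x) (hc : DifferentiableAt ℝ c x)
    (hrs : HasDerivAt rs (1 / f (r x) ^ 2) (r x)) (hf : HasDerivAt f f' (r x))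
    (hf0 : f (r x) ≠ 0) (hr0 : 0 < r x) (ho1 : ∀ᶠ y in 𝓝 x, ‖o y‖ = 1)
    (hoc : ∀ᶠ y in 𝓝 x, inner ℝ (o y) (c y) = 0) (hcz : inner ℝ (o x) cz = 0)
    (hZ : Z = ofPolar (f (r x) ^ 2) (r x) (o x) az bz cz) :
    covInner f F W x X Z
      = polarInner (f (r x) ^ 2) (r x) (fderiv ℝ a x X) (fderiv ℝ b x X) (fderiv ℝ c x X) az bz cz
        + polarGamma (f (r x) * f') (r x) (fderiv ℝ w x X) (fderiv ℝ r x X) (fderiv ℝ o x X)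
            (a x) (b x) (c x) az bz cz := by
  have hFx : F x = (w x + rs (r x), r x • o x) := by
    have := hF.eq_of_nhds; simpa [radialExt, hx] using this
  have hWx : W x = ofPolar (f (r x) ^ 2) (r x) (o x) (a x) (b x) (c x) := by
    have := hW.eq_of_nhds; simpa [radialExt, hx] using this
  have ho1x := ho1.self_of_nhds
  have hocx := hoc.self_of_nhds
  have hoo : inner ℝ (o x) (o x) = 1 := by rw [real_inner_self_eq_norm_sq, ho1x]; norm_num
  have hN : ‖r x • o x‖ = r x := by rw [norm_smul, ho1x, mul_one, Real.norm_of_nonneg hr0.le]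
  have hp : r x • o x ≠ 0 := by rw [← norm_ne_zero_iff, hN]; exact hr0.ne'
  have hoo' : inner ℝ (o x) (fderiv ℝ o x X) = 0 := by
    have h1 := (ho.hasFDerivAt.inner ℝ ho.hasFDerivAt)
    have h2 : HasFDerivAt (fun y => inner ℝ (o y) (o y)) (0 : Space n →L[ℝ] ℝ) x := by
      refine (hasFDerivAt_const (1 : ℝ) x).congr_of_eventuallyEq ?_
      filter_upwards [ho1] with y hy
      rw [real_inner_self_eq_norm_sq, hy]; norm_num
    have h3 := congrArg (fun A => A X) (h1.unique h2)
    simp [fderivInnerCLM_apply, real_inner_comm (o x)] at h3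
    linarith
  -- The derivative of the spherical component is not tangential. Its normal part -⟨do, c⟩ combines
  -- with the weight 1/f² - 1 of the Christoffel symbol into the term with `-b''` in the second
  -- summand of `polarGamma`.
  have hoc' : inner ℝ (o x) (fderiv ℝ c x X) = -inner ℝ (fderiv ℝ o x X) (c x) := by
    have h1 := (ho.hasFDerivAt.inner ℝ hc.hasFDerivAt)
    have h2 : HasFDerivAt (fun y => inner ℝ (o y) (c y)) (0 : Space n →L[ℝ] ℝ) x :=
      (hasFDerivAt_const (0 : ℝ) x).congr_of_eventuallyEq hoc
    have h3 := congrArg (fun A => A X) (h1.unique h2)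
    simp [fderivInnerCLM_apply] at h3
    linarith
  have hdF : sphereDeriv F x X = (fderiv ℝ w x X + 1 / f (r x) ^ 2 * fderiv ℝ r x X,
      r x • fderiv ℝ o x X + fderiv ℝ r x X • o x) := by
    have h : HasFDerivAt (fun y => (w y + rs (r y), r y • o y)) _ x :=
      (hw.hasFDerivAt.add (hrs.comp_hasFDerivAt x hr.hasFDerivAt)).prodMk
        (hr.hasFDerivAt.smul ho.hasFDerivAt)
    unfold sphereDeriv
    rw [hF.fderiv_eq, h.fderiv]
    simp
  have hdW : sphereDeriv W x X = (fderiv ℝ a x X + (fderiv ℝ b x X / f (r x) ^ 2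
        - 2 * b x * f' * fderiv ℝ r x X / f (r x) ^ 3),
      (b x • fderiv ℝ o x X + fderiv ℝ b x X • o x)
        + (r x • fderiv ℝ c x X + fderiv ℝ r x X • c x)) := by
    have hfr : HasFDerivAt (fun y => f (r y)) _ x := hf.comp_hasFDerivAt x hr.hasFDerivAt
    have h : HasFDerivAt (fun y => ofPolar (f (r y) ^ 2) (r y) (o y) (a y) (b y) (c y)) _ x :=
      (ha.hasFDerivAt.add (hasFDerivAt_fun_div hb.hasFDerivAt (hfr.pow 2) (pow_ne_zero 2 hf0))).prodMk
        ((hb.hasFDerivAt.smul ho.hasFDerivAt).add (hr.hasFDerivAt.smul hc.hasFDerivAt))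
    unfold sphereDeriv
    rw [hW.fderiv_eq, h.fderiv]
    simp
    field_simp
  have hco : inner ℝ (c x) (o x) = 0 := by rw [real_inner_comm, hocx]
  have hdoo : inner ℝ (fderiv ℝ o x X) (o x) = 0 := by rw [real_inner_comm, hoo']
  have hdco : inner ℝ (fderiv ℝ c x X) (o x) = -inner ℝ (fderiv ℝ o x X) (c x) := by
    rw [real_inner_comm, hoc']
  unfold covInner
  rw [christoffel_eq (f' := f') (by rw [hFx]; exact hp) (by rw [hFx]; simpa only [hN] using hf)
    (by rw [hFx]; simpa only [hN] using hf0), hFx, hWx, hdF, hdW, hZ]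
  unfold metric polarInner polarGamma
  simp only [dr_smul hr0 ho1x, hN]
  simp only [ofPolar, inner_add_left, inner_add_right, real_inner_smul_left,
    real_inner_smul_right, hoo, hocx, hcz, hoo', hoc', hdoo, hdco, hco]
  field_simp
  ring

end

section
variable {n : ℕ} {W : Type*} [NormedAddCommGroup W] [NormedSpace ℝ W]

/-! ### One-parameter families of maps on punctured Euclidean space -/

/-- `(s, y) ↦ g s y` is smooth for `|s| < ε` and `y ≠ 0`. -/
def SmoothFam (ε : ℝ) (g : ℝ → Space n → W) : Prop :=
  ContDiffOn ℝ ∞ (fun q : ℝ × Space n => g q.1 q.2) (Ioo (-ε) ε ×ˢ {0}ᶜ)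

/-- The derivative of the family at the parameter `0`. -/
def dS (g : ℝ → Space n → W) (y : Space n) : W := deriv (fun s => g s y) 0

lemma isOpen_famDomain (ε : ℝ) : IsOpen (Ioo (-ε) ε ×ˢ ({0}ᶜ : Set (Space n))) :=
  isOpen_Ioo.prod isOpen_compl_singleton

lemma two_le_smooth : (2 : WithTop ℕ∞) ≤ ∞ := WithTop.coe_le_coe.2 le_top

lemma SmoothFam.contDiffAt {ε : ℝ} {g : ℝ → Space n → W} (hg : SmoothFam ε g) {s : ℝ}
    (hs : s ∈ Ioo (-ε) ε) {y : Space n} (hy : y ≠ 0) :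
    ContDiffAt ℝ ∞ (fun q : ℝ × Space n => g q.1 q.2) (s, y) :=
  ContDiffOn.contDiffAt hg ((isOpen_famDomain ε).mem_nhds ⟨hs, hy⟩)

lemma fderiv_slice {g : ℝ → Space n → W} {s : ℝ} {y : Space n}
    (hg : DifferentiableAt ℝ (fun q : ℝ × Space n => g q.1 q.2) (s, y)) (X : Space n) :
    fderiv ℝ (g s) y X = fderiv ℝ (fun q : ℝ × Space n => g q.1 q.2) (s, y) (0, X) := by
  have h : HasFDerivAt (fun z : Space n => (s, z)) (ContinuousLinearMap.inr ℝ ℝ (Space n)) y :=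
    hasFDerivAt_prodMk_right s y
  have h2 := hg.hasFDerivAt.comp y h
  rw [show g s = (fun q : ℝ × Space n => g q.1 q.2) ∘ fun z => (s, z) from rfl, h2.fderiv]
  simp

lemma hasDerivAt_slice {g : ℝ → Space n → W} {s : ℝ} {y : Space n}
    (hg : DifferentiableAt ℝ (fun q : ℝ × Space n => g q.1 q.2) (s, y)) :
    HasDerivAt (fun τ => g τ y) (fderiv ℝ (fun q : ℝ × Space n => g q.1 q.2) (s, y) (1, 0)) s := by
  have h : HasDerivAt (fun τ : ℝ => (τ, y)) ((1 : ℝ), (0 : Space n)) s :=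
    (hasDerivAt_id s).prodMk (hasDerivAt_const s y)
  exact hg.hasFDerivAt.comp_hasDerivAt s h

/-- Derivatives in the parameter and in the space variable commute. -/
theorem hasDerivAt_fderiv_slice {g : ℝ → Space n → W} {x : Space n}
    (hg : ContDiffAt ℝ 2 (fun q : ℝ × Space n => g q.1 q.2) (0, x)) (X : Space n) :
    HasDerivAt (fun s => fderiv ℝ (g s) x X) (fderiv ℝ (dS g) x X) 0 := by
  set G : ℝ × Space n → W := fun q => g q.1 q.2 with hG
  have hev : ∀ᶠ q in 𝓝 ((0 : ℝ), x), DifferentiableAt ℝ G q := by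
    filter_upwards [hg.eventually (by simp)] with q hq
    exact hq.differentiableAt (by simp)
  have hd : HasFDerivAt (fderiv ℝ G) (fderiv ℝ (fderiv ℝ G) (0, x)) (0, x) :=
    ((hg.fderiv_right (m := 1) (by norm_num)).differentiableAt (by simp)).hasFDerivAt
  have hsym : IsSymmSndFDerivAt ℝ G (0, x) := hg.isSymmSndFDerivAt (by simp)
  have e1 : (fun s => fderiv ℝ (g s) x X) =ᶠ[𝓝 0] fun s => fderiv ℝ G (s, x) (0, X) := by
    have hc : Tendsto (fun s : ℝ => (s, x)) (𝓝 0) (𝓝 ((0 : ℝ), x)) :=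
      (Continuous.prodMk_left x).tendsto 0
    filter_upwards [hc.eventually hev] with s hs
    exact fderiv_slice hs X
  have e2 : dS g =ᶠ[𝓝 x] fun y => fderiv ℝ G (0, y) (1, 0) := by
    have hc : Tendsto (fun y : Space n => ((0 : ℝ), y)) (𝓝 x) (𝓝 ((0 : ℝ), x)) :=
      (Continuous.prodMk_right (0 : ℝ)).tendsto x
    filter_upwards [hc.eventually hev] with y hy
    exact (hasDerivAt_slice hy).deriv
  have h1 : HasDerivAt (fun s => fderiv ℝ G (s, x) (0, X))
      (fderiv ℝ (fderiv ℝ G) (0, x) (1, 0) (0, X)) 0 := by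
    have h : HasDerivAt (fun τ : ℝ => (τ, x)) ((1 : ℝ), (0 : Space n)) 0 :=
      (hasDerivAt_id 0).prodMk (hasDerivAt_const 0 x)
    exact ((ContinuousLinearMap.apply ℝ W ((0 : ℝ), X)).hasFDerivAt
      (x := fderiv ℝ G (0, x))).comp_hasDerivAt 0 (hd.comp_hasDerivAt (0 : ℝ) h)
  have h2 : fderiv ℝ (dS g) x X = fderiv ℝ (fderiv ℝ G) (0, x) (0, X) (1, 0) := by
    have h : HasFDerivAt (fun z : Space n => ((0 : ℝ), z)) (ContinuousLinearMap.inr ℝ ℝ (Space n)) x :=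
      hasFDerivAt_prodMk_right 0 x
    have h' := ((ContinuousLinearMap.apply ℝ W ((1 : ℝ), (0 : Space n))).hasFDerivAt
        (x := fderiv ℝ G (0, x))).comp x (hd.comp x h)
    change HasFDerivAt (fun y => fderiv ℝ G (0, y) (1, 0)) _ x at h'
    rw [e2.fderiv_eq, h'.fderiv]
    rfl
  rw [h2, ← hsym.eq]
  exact h1.congr_of_eventuallyEq e1

lemma SmoothFam.differentiableAt {ε : ℝ} {g : ℝ → Space n → W} (hg : SmoothFam ε g) {s : ℝ}
    (hs : s ∈ Ioo (-ε) ε) {y : Space n} (hy : y ≠ 0) :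
    DifferentiableAt ℝ (fun q : ℝ × Space n => g q.1 q.2) (s, y) :=
  (hg.contDiffAt hs hy).differentiableAt (by simp)

lemma SmoothFam.slice {ε : ℝ} {g : ℝ → Space n → W} (hg : SmoothFam ε g) {s : ℝ}
    (hs : s ∈ Ioo (-ε) ε) : ContDiffOn ℝ ∞ (g s) {0}ᶜ := by
  have h : ContDiffOn ℝ ∞ (fun y : Space n => (s, y)) {0}ᶜ :=
    (contDiff_prodMk_right s).contDiffOn
  exact ContDiffOn.comp (g := fun q : ℝ × Space n => g q.1 q.2) hg h fun y hy => ⟨hs, hy⟩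

lemma SmoothFam.hasDerivAt {ε : ℝ} {g : ℝ → Space n → W} (hg : SmoothFam ε g)
    (hε : 0 < ε) {y : Space n} (hy : y ≠ 0) : HasDerivAt (fun s => g s y) (dS g y) 0 :=
  (hasDerivAt_slice (hg.differentiableAt (by simp [hε]) hy)).differentiableAt.hasDerivAt

lemma SmoothFam.hasDerivAt_fderiv {ε : ℝ} {g : ℝ → Space n → W} (hg : SmoothFam ε g)
    (hε : 0 < ε) {y : Space n} (hy : y ≠ 0) (X : Space n) :
    HasDerivAt (fun s => fderiv ℝ (g s) y X) (fderiv ℝ (dS g) y X) 0 :=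
  hasDerivAt_fderiv_slice ((hg.contDiffAt (by simp [hε]) hy).of_le two_le_smooth) X

lemma SmoothFam.fderiv {ε : ℝ} {g : ℝ → Space n → W} (hg : SmoothFam ε g) (X : Space n) :
    SmoothFam ε (fun s y => fderiv ℝ (g s) y X) := by
  have h : ContDiffOn ℝ ∞ (fun q => _root_.fderiv ℝ (fun q : ℝ × Space n => g q.1 q.2) q (0, X))
      (Ioo (-ε) ε ×ˢ {0}ᶜ) :=
    (ContDiffOn.fderiv_of_isOpen hg (isOpen_famDomain ε) (by simp)).clm_apply contDiffOn_const
  refine ContDiffOn.congr h ?_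
  rintro ⟨s, y⟩ ⟨hs, hy⟩
  exact fderiv_slice (hg.differentiableAt hs hy) X

lemma SmoothFam.deriv {ε : ℝ} {g : ℝ → Space n → W} (hg : SmoothFam ε g) :
    SmoothFam ε (fun s y => deriv (fun τ => g τ y) s) := by
  have h : ContDiffOn ℝ ∞ (fun q => _root_.fderiv ℝ (fun q : ℝ × Space n => g q.1 q.2) q (1, 0))
      (Ioo (-ε) ε ×ˢ {0}ᶜ) :=
    (ContDiffOn.fderiv_of_isOpen hg (isOpen_famDomain ε) (by simp)).clm_apply contDiffOn_const
  refine ContDiffOn.congr h ?_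
  rintro ⟨s, y⟩ ⟨hs, hy⟩
  exact (hasDerivAt_slice (hg.differentiableAt hs hy)).deriv

lemma SmoothFam.contDiffOn_dS {ε : ℝ} {g : ℝ → Space n → W} (hg : SmoothFam ε g) (hε : 0 < ε) :
    ContDiffOn ℝ ∞ (dS g) {0}ᶜ :=
  hg.deriv.slice (s := 0) (by simp [hε])

lemma contDiffOn_normalize : ContDiffOn ℝ ∞ (fun y : Space n => ‖y‖⁻¹ • y) {0}ᶜ :=
  contDiffOn_norm_inv.smul contDiffOn_id

lemma normalize_ne_zero {y : Space n} (hy : y ≠ 0) : ‖y‖⁻¹ • y ≠ 0 :=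
  ne_zero_of_norm_one (norm_normalize hy)

lemma SmoothFam.normalize {ε : ℝ} {g : ℝ → Space n → W} (hg : SmoothFam ε g) :
    SmoothFam ε (fun s y => g s (‖y‖⁻¹ • y)) := by
  have h : ContDiffOn ℝ ∞ (fun q : ℝ × Space n => (q.1, ‖q.2‖⁻¹ • q.2)) (Ioo (-ε) ε ×ˢ {0}ᶜ) :=
    contDiffOn_fst.prodMk (contDiffOn_normalize.comp contDiffOn_snd fun q hq => hq.2)
  exact ContDiffOn.comp hg h fun q hq => ⟨hq.1, normalize_ne_zero hq.2⟩

/-- `g` is constant along rays. -/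
def RayConst {V : Type*} (g : Space n → V) : Prop := ∀ c : ℝ, 0 < c → ∀ y, g (c • y) = g y

lemma RayConst.normalize {V : Type*} {g : Space n → V} (hg : RayConst g) {y : Space n} (hy : y ≠ 0) :
    g (‖y‖⁻¹ • y) = g y :=
  hg _ (inv_pos.2 (norm_pos_iff.2 hy)) y

lemma rayConst_radialExt {V : Type*} (u : Space n → V) {c : ℝ} (hc : 0 < c) (y : Space n) :
    radialExt u (c • y) = radialExt u y := by
  unfold radialExt
  rw [norm_smul, Real.norm_of_nonneg hc.le, smul_smul, mul_inv, mul_comm c⁻¹, mul_assoc,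
    inv_mul_cancel₀ hc.ne', mul_one]

lemma RayConst.fderiv_smul {g : Space n → W} (hg : RayConst g) {c : ℝ} (hc : 0 < c) {y : Space n}
    (hd : DifferentiableAt ℝ g (c • y)) (X : Space n) :
    c • fderiv ℝ g (c • y) X = fderiv ℝ g y X := by
  have h1 : HasFDerivAt (fun z => g (c • z))
      ((fderiv ℝ g (c • y)).comp (c • ContinuousLinearMap.id ℝ (Space n))) y :=
    hd.hasFDerivAt.comp y ((hasFDerivAt_id y).const_smul c)
  have e : (fun z => g (c • z)) = g := funext fun z => hg c hc z
  rw [e] at h1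
  rw [h1.fderiv]
  simp

lemma RayConst.fderiv_self {g : Space n → W} (hg : RayConst g) {y : Space n}
    (hd : DifferentiableAt ℝ g y) : fderiv ℝ g y y = 0 := by
  have h0 : HasDerivAt (fun c : ℝ => c • y) y 1 := by
    simpa using (hasDerivAt_id (1 : ℝ)).smul_const y
  have h1 : HasDerivAt (fun c : ℝ => g (c • y)) (fderiv ℝ g y y) 1 := by
    have hd : HasFDerivAt g (fderiv ℝ g y) ((1 : ℝ) • y) := by simpa using hd.hasFDerivAt
    exact hd.comp_hasDerivAt 1 h0
  have e : (fun c : ℝ => g (c • y)) =ᶠ[𝓝 1] fun _ => g y := by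
    filter_upwards [isOpen_Ioi.mem_nhds (show (1 : ℝ) ∈ Ioi 0 by simp)] with c hc
    exact hg c hc y
  exact h1.unique ((hasDerivAt_const 1 (g y)).congr_of_eventuallyEq e)

lemma RayConst.dS {g : ℝ → Space n → W} (hg : ∀ s, RayConst (g s)) : RayConst (dS g) := by
  intro c hc y
  unfold StaticNullCone.dS
  congr 1
  funext s
  exact hg s c hc y

end

/-! ### Polar components of families of maps and of vector fields along them -/

section
variable {n : ℕ}

/-- `w`, `r`, `o` are the coordinates `t - r*`, `r`, `θ` of the family of maps `F`. -/
structure IsPolarMap (I : Set ℝ) (rs : ℝ → ℝ) (ε : ℝ) (F : ℝ → Space n → Event n)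
    (w r : ℝ → Space n → ℝ) (o : ℝ → Space n → Space n) : Prop where
  smooth_w : SmoothFam ε w
  smooth_r : SmoothFam ε r
  smooth_o : SmoothFam ε o
  ray_w : ∀ s, RayConst (w s)
  ray_r : ∀ s, RayConst (r s)
  ray_o : ∀ s, RayConst (o s)
  eq : ∀ s ∈ Ioo (-ε) ε, ∀ y ≠ 0, radialExt (F s) y = (w s y + rs (r s y), r s y • o s y)
  mem : ∀ s ∈ Ioo (-ε) ε, ∀ y ≠ 0, r s y ∈ I
  norm_o : ∀ s ∈ Ioo (-ε) ε, ∀ y ≠ 0, ‖o s y‖ = 1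

/-- `a`, `b`, `c` are the components along `∂_w`, `∂_r` and the sphere of the family `V` of vector
fields along the maps with coordinates `r`, `o`. -/
structure IsPolarField (f : ℝ → ℝ) (ε : ℝ) (r : ℝ → Space n → ℝ) (o : ℝ → Space n → Space n)
    (V : ℝ → Space n → Event n) (a b : ℝ → Space n → ℝ) (c : ℝ → Space n → Space n) : Prop where
  smooth_a : SmoothFam ε a
  smooth_b : SmoothFam ε b
  smooth_c : SmoothFam ε c
  ray_a : ∀ s, RayConst (a s)
  ray_b : ∀ s, RayConst (b s)
  ray_c : ∀ s, RayConst (c s)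
  eq : ∀ s ∈ Ioo (-ε) ε, ∀ y ≠ 0,
    radialExt (V s) y = ofPolar (f (r s y) ^ 2) (r s y) (o s y) (a s y) (b s y) (c s y)
  orth : ∀ s ∈ Ioo (-ε) ε, ∀ y ≠ 0, inner ℝ (o s y) (c s y) = 0

lemma contDiffOn_tortoise {I : Set ℝ} {f rs : ℝ → ℝ} (hf : IsWarpingFactor I f)
    (hrs : ∀ r ∈ I, HasDerivAt rs (1 / f r ^ 2) r) : ContDiffOn ℝ ∞ rs I := by
  rw [contDiffOn_infty_iff_deriv_of_isOpen hf.isOpen]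
  refine ⟨fun r hr => (hrs r hr).differentiableAt.differentiableWithinAt, ?_⟩
  have h : ContDiffOn ℝ ∞ (fun r => 1 / f r ^ 2) I :=
    contDiffOn_const.div (hf.smooth.pow 2) fun r hr => pow_ne_zero 2 (hf.pos r hr).ne'
  exact h.congr fun r hr => (hrs r hr).deriv

lemma IsWarpingFactor.hasDerivAt {I : Set ℝ} {f : ℝ → ℝ} (hf : IsWarpingFactor I f) {r : ℝ}
    (hr : r ∈ I) : HasDerivAt f (deriv f r) r :=
  ((hf.smooth.contDiffAt (hf.isOpen.mem_nhds hr)).differentiableAt (by simp)).hasDerivAt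

/-- Coordinates are read off the event itself: r = |y|, θ = y/|y|, w = t - r*(r). They are smooth
because radii in `I` are positive. -/
lemma exists_isPolarMap {I : Set ℝ} {f rs : ℝ → ℝ} (hf : IsWarpingFactor I f)
    (hrs : ∀ r ∈ I, HasDerivAt rs (1 / f r ^ 2) r) {ε : ℝ} {F : ℝ → Space n → Event n}
    (hF : SphereSmoothFamily (Ioo (-ε) ε) F)
    (hreg : ∀ s ∈ Ioo (-ε) ε, ∀ x, ‖x‖ = 1 → F s x ∈ region n I) :
    IsPolarMap I rs ε F (fun s y => (radialExt (F s) y).1 - rs ‖(radialExt (F s) y).2‖)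
      (fun s y => ‖(radialExt (F s) y).2‖)
      (fun s y => ‖(radialExt (F s) y).2‖⁻¹ • (radialExt (F s) y).2) := by
  have hmem : ∀ s ∈ Ioo (-ε) ε, ∀ y ≠ 0, ‖(radialExt (F s) y).2‖ ∈ I := fun s hs y hy =>
    hreg s hs _ (norm_normalize hy)
  have hne : ∀ q ∈ Ioo (-ε) ε ×ˢ ({0}ᶜ : Set (Space n)), ‖(radialExt (F q.1) q.2).2‖ ≠ 0 :=
    fun q hq => (hf.radius_pos (hmem q.1 hq.1 q.2 hq.2)).ne'
  have h1 : ContDiffOn ℝ ∞ (fun q : ℝ × Space n => (radialExt (F q.1) q.2).1)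
      (Ioo (-ε) ε ×ˢ {0}ᶜ) := hF.fst
  have h2 : ContDiffOn ℝ ∞ (fun q : ℝ × Space n => (radialExt (F q.1) q.2).2)
      (Ioo (-ε) ε ×ˢ {0}ᶜ) := hF.snd
  have h3 : ContDiffOn ℝ ∞ (fun q : ℝ × Space n => ‖(radialExt (F q.1) q.2).2‖)
      (Ioo (-ε) ε ×ˢ {0}ᶜ) := h2.norm ℝ fun q hq => norm_ne_zero_iff.1 (hne q hq)
  refine ⟨?_, h3, ?_, ?_, ?_, ?_, ?_, hmem, ?_⟩
  · exact h1.sub ((contDiffOn_tortoise hf hrs).comp h3 fun q hq => hmem q.1 hq.1 q.2 hq.2)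
  · exact (h3.inv hne).smul h2
  · intro s c hc y
    simp only [rayConst_radialExt _ hc]
  · intro s c hc y
    simp only [rayConst_radialExt _ hc]
  · intro s c hc y
    simp only [rayConst_radialExt _ hc]
  · intro s hs y hy
    have := hne (s, y) ⟨hs, hy⟩
    ext1
    · simp
    · simp only [smul_smul]
      rw [mul_inv_cancel₀ this, one_smul]
  · intro s hs y hy
    exact norm_normalize (norm_ne_zero_iff.1 (hne (s, y) ⟨hs, hy⟩))

/-- The component of the event vector `A` at `p` along `∂_w`. -/
def compW (f : ℝ → ℝ) (p A : Event n) : ℝ := A.1 - dr p A / f ‖p.2‖ ^ 2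

/-- The component of the event vector `A` at `p` along the sphere. -/
def compTheta (p A : Event n) : Space n := ‖p.2‖⁻¹ • (A.2 - dr p A • (‖p.2‖⁻¹ • p.2))

/-- At fixed w the field ∂_r has t-component 1/f², which explains the subtraction in `compW`; the
spherical component is the part of the vector orthogonal to y, divided by r. -/
lemma exists_isPolarField {I : Set ℝ} {f : ℝ → ℝ} (hf : IsWarpingFactor I f)
    {ε : ℝ} {F V : ℝ → Space n → Event n}
    (hF : SphereSmoothFamily (Ioo (-ε) ε) F) (hV : SphereSmoothFamily (Ioo (-ε) ε) V)
    (hreg : ∀ s ∈ Ioo (-ε) ε, ∀ x, ‖x‖ = 1 → F s x ∈ region n I) :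
    IsPolarField f ε (fun s y => ‖(radialExt (F s) y).2‖)
      (fun s y => ‖(radialExt (F s) y).2‖⁻¹ • (radialExt (F s) y).2) V
      (fun s y => compW f (radialExt (F s) y) (radialExt (V s) y))
      (fun s y => dr (radialExt (F s) y) (radialExt (V s) y))
      (fun s y => compTheta (radialExt (F s) y) (radialExt (V s) y)) := by
  have hmem : ∀ s ∈ Ioo (-ε) ε, ∀ y ≠ 0, ‖(radialExt (F s) y).2‖ ∈ I := fun s hs y hy =>
    hreg s hs _ (norm_normalize hy)
  have hne : ∀ q ∈ Ioo (-ε) ε ×ˢ ({0}ᶜ : Set (Space n)), ‖(radialExt (F q.1) q.2).2‖ ≠ 0 :=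
    fun q hq => (hf.radius_pos (hmem q.1 hq.1 q.2 hq.2)).ne'
  have h2 : ContDiffOn ℝ ∞ (fun q : ℝ × Space n => (radialExt (F q.1) q.2).2)
      (Ioo (-ε) ε ×ˢ {0}ᶜ) := hF.snd
  have h3 : ContDiffOn ℝ ∞ (fun q : ℝ × Space n => ‖(radialExt (F q.1) q.2).2‖)
      (Ioo (-ε) ε ×ˢ {0}ᶜ) := h2.norm ℝ fun q hq => norm_ne_zero_iff.1 (hne q hq)
  have hdr : ContDiffOn ℝ ∞ (fun q : ℝ × Space n =>
      dr (radialExt (F q.1) q.2) (radialExt (V q.1) q.2)) (Ioo (-ε) ε ×ˢ {0}ᶜ) :=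
    (h2.inner ℝ hV.snd).div h3 hne
  have hfr : ContDiffOn ℝ ∞ (fun q : ℝ × Space n => f ‖(radialExt (F q.1) q.2).2‖)
      (Ioo (-ε) ε ×ˢ {0}ᶜ) := hf.smooth.comp h3 fun q hq => hmem q.1 hq.1 q.2 hq.2
  refine ⟨?_, hdr, ?_, ?_, ?_, ?_, ?_, ?_⟩
  · exact (ContDiffOn.fst hV).sub (hdr.div (hfr.pow 2) fun q hq =>
      pow_ne_zero 2 (hf.pos _ (hmem q.1 hq.1 q.2 hq.2)).ne')
  · exact (h3.inv hne).smul ((ContDiffOn.snd hV).sub (hdr.smul ((h3.inv hne).smul h2)))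
  · intro s c hc y
    simp only [rayConst_radialExt _ hc]
  · intro s c hc y
    simp only [rayConst_radialExt _ hc]
  · intro s c hc y
    simp only [rayConst_radialExt _ hc]
  · intro s hs y hy
    have := hne (s, y) ⟨hs, hy⟩
    simp only at this
    unfold ofPolar compW compTheta
    ext1
    · simp
    · simp only
      rw [smul_smul ‖(radialExt (F s) y).2‖, mul_inv_cancel₀ this, one_smul]
      abel
  · intro s hs y hy
    have := hne (s, y) ⟨hs, hy⟩
    simp only at this
    simp only [compTheta, inner_smul_left, inner_smul_right, inner_sub_right, dr,
      real_inner_self_eq_norm_sq]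
    simp
    field_simp
    simp

section
variable {I : Set ℝ} {f rs : ℝ → ℝ} {ε : ℝ} {F V : ℝ → Space n → Event n}
  {w r : ℝ → Space n → ℝ} {o : ℝ → Space n → Space n} {a b : ℝ → Space n → ℝ}
  {c : ℝ → Space n → Space n}

lemma IsPolarMap.eventuallyEq (hF : IsPolarMap I rs ε F w r o) {s : ℝ} (hs : s ∈ Ioo (-ε) ε)
    {x : Space n} (hx : x ≠ 0) :
    radialExt (F s) =ᶠ[𝓝 x] fun y => (w s y + rs (r s y), r s y • o s y) :=
  eventuallyEq_of_forall_ne (hF.eq s hs) hx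

lemma IsPolarMap.inner_fderiv_o (hF : IsPolarMap I rs ε F w r o) {s : ℝ} (hs : s ∈ Ioo (-ε) ε)
    {x : Space n} (hx : x ≠ 0) (X : Space n) : inner ℝ (o s x) (fderiv ℝ (o s) x X) = 0 := by
  have ho := differentiableAt_of_smooth (hF.smooth_o.slice hs) hx
  have h1 := (ho.hasFDerivAt.inner ℝ ho.hasFDerivAt)
  have h2 : HasFDerivAt (fun y => inner ℝ (o s y) (o s y)) (0 : Space n →L[ℝ] ℝ) x := by
    refine (hasFDerivAt_const (1 : ℝ) x).congr_of_eventuallyEq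
      (eventuallyEq_of_forall_ne (fun y hy => ?_) hx)
    rw [real_inner_self_eq_norm_sq, hF.norm_o s hs y hy]; norm_num
  have h3 := congrArg (fun A => A X) (h1.unique h2)
  simp [fderivInnerCLM_apply, real_inner_comm (o s x)] at h3
  linarith

lemma IsPolarMap.sphereDeriv_eq
    (hrs : ∀ r ∈ I, HasDerivAt rs (1 / f r ^ 2) r) (hF : IsPolarMap I rs ε F w r o) {s : ℝ}
    (hs : s ∈ Ioo (-ε) ε) {x : Space n} (hx : x ≠ 0) (X : Space n) :
    sphereDeriv (F s) x X = ofPolar (f (r s x) ^ 2) (r s x) (o s x) (fderiv ℝ (w s) x X)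
      (fderiv ℝ (r s) x X) (fderiv ℝ (o s) x X) := by
  have hw := differentiableAt_of_smooth (hF.smooth_w.slice hs) hx
  have hr := differentiableAt_of_smooth (hF.smooth_r.slice hs) hx
  have ho := differentiableAt_of_smooth (hF.smooth_o.slice hs) hx
  have h : HasFDerivAt (fun y => (w s y + rs (r s y), r s y • o s y)) _ x :=
    (hw.hasFDerivAt.add ((hrs _ (hF.mem s hs x hx)).comp_hasFDerivAt x hr.hasFDerivAt)).prodMk
      (hr.hasFDerivAt.smul ho.hasFDerivAt)
  unfold sphereDeriv ofPolar
  rw [(hF.eventuallyEq hs hx).fderiv_eq, h.fderiv]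
  ext1
  · simp
    ring
  · simp [add_comm]

lemma IsPolarField.covInner_eq (hf : IsWarpingFactor I f)
    (hrs : ∀ r ∈ I, HasDerivAt rs (1 / f r ^ 2) r) (hF : IsPolarMap I rs ε F w r o)
    (hV : IsPolarField f ε r o V a b c) {s : ℝ}
    (hs : s ∈ Ioo (-ε) ε) {x : Space n} (hx : ‖x‖ = 1) (X : Space n) {az bz : ℝ} {cz : Space n}
    (hcz : inner ℝ (o s x) cz = 0) :
    covInner f (F s) (V s) x X (ofPolar (f (r s x) ^ 2) (r s x) (o s x) az bz cz)
      = polarInner (f (r s x) ^ 2) (r s x) (fderiv ℝ (a s) x X) (fderiv ℝ (b s) x X)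
          (fderiv ℝ (c s) x X) az bz cz
        + polarGamma (f (r s x) * deriv f (r s x)) (r s x) (fderiv ℝ (w s) x X)
            (fderiv ℝ (r s) x X) (fderiv ℝ (o s) x X) (a s x) (b s x) (c s x) az bz cz := by
  have hx0 := ne_zero_of_norm_one hx
  have hmem := hF.mem s hs x hx0
  have hne : ∀ᶠ y : Space n in 𝓝 x, y ≠ 0 := isOpen_compl_singleton.mem_nhds hx0
  exact covInner_eq_polar hx (hF.eventuallyEq hs hx0) (eventuallyEq_of_forall_ne (hV.eq s hs) hx0)
    (differentiableAt_of_smooth (hF.smooth_w.slice hs) hx0)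
    (differentiableAt_of_smooth (hF.smooth_r.slice hs) hx0)
    (differentiableAt_of_smooth (hF.smooth_o.slice hs) hx0)
    (differentiableAt_of_smooth (hV.smooth_a.slice hs) hx0)
    (differentiableAt_of_smooth (hV.smooth_b.slice hs) hx0)
    (differentiableAt_of_smooth (hV.smooth_c.slice hs) hx0)
    (hrs _ hmem) (hf.hasDerivAt hmem) (hf.pos _ hmem).ne' (hf.radius_pos hmem)
    (hne.mono fun y hy => hF.norm_o s hs y hy) (hne.mono fun y hy => hV.orth s hs y hy) hcz rfl

lemma radialExt_of_norm_one {V : Type*} (u : Space n → V) {x : Space n} (hx : ‖x‖ = 1) :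
    radialExt u x = u x := by
  simp [radialExt, hx]

lemma IsPolarMap.metric_eq (hf : IsWarpingFactor I f) (hF : IsPolarMap I rs ε F w r o) {s : ℝ}
    (hs : s ∈ Ioo (-ε) ε) {x : Space n} (hx : ‖x‖ = 1) {a b a' b' : ℝ} {c c' : Space n}
    (hc : inner ℝ (o s x) c = 0) (hc' : inner ℝ (o s x) c' = 0) :
    metric f (F s x) (ofPolar (f (r s x) ^ 2) (r s x) (o s x) a b c)
        (ofPolar (f (r s x) ^ 2) (r s x) (o s x) a' b' c')
      = polarInner (f (r s x) ^ 2) (r s x) a b c a' b' c' := by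
  have hx0 := ne_zero_of_norm_one hx
  have hmem := hF.mem s hs x hx0
  rw [← radialExt_of_norm_one (F s) hx, hF.eq s hs x hx0]
  exact metric_ofPolar (hf.radius_pos hmem) (hF.norm_o s hs x hx0) (hf.pos _ hmem).ne' hc hc'

end

lemma hasDerivAt_polarInner {Q R a b a₂ b₂ : ℝ → ℝ} {c c₂ : ℝ → Space n}
    {Q' R' a' b' a₂' b₂' : ℝ} {c' c₂' : Space n} {s : ℝ}
    (hQ : HasDerivAt Q Q' s) (hR : HasDerivAt R R' s) (ha : HasDerivAt a a' s)
    (hb : HasDerivAt b b' s) (hc : HasDerivAt c c' s) (ha₂ : HasDerivAt a₂ a₂' s)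
    (hb₂ : HasDerivAt b₂ b₂' s) (hc₂ : HasDerivAt c₂ c₂' s) :
    HasDerivAt (fun s => polarInner (Q s) (R s) (a s) (b s) (c s) (a₂ s) (b₂ s) (c₂ s))
      (-Q' * a s * a₂ s - Q s * a' * a₂ s - Q s * a s * a₂' - (a' * b₂ s + a s * b₂')
        - (b' * a₂ s + b s * a₂') + 2 * R s * R' * inner ℝ (c s) (c₂ s)
        + R s ^ 2 * (inner ℝ c' (c₂ s) + inner ℝ (c s) c₂')) s := by
  have h := ((((hQ.neg.mul ha).mul ha₂).sub (ha.mul hb₂)).sub (hb.mul ha₂)).add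
    ((hR.pow 2).mul (hc.inner ℝ hc₂))
  refine h.congr_deriv ?_
  simp
  ring

lemma hasDerivAt_polarGamma {P R a b a₂ b₂ a₃ b₃ : ℝ → ℝ} {c c₂ c₃ : ℝ → Space n}
    {P' R' a' b' a₂' b₂' a₃' b₃' : ℝ} {c' c₂' c₃' : Space n} {s : ℝ}
    (hP : HasDerivAt P P' s) (hR : HasDerivAt R R' s) (ha : HasDerivAt a a' s)
    (hb : HasDerivAt b b' s) (hc : HasDerivAt c c' s) (ha₂ : HasDerivAt a₂ a₂' s)
    (hb₂ : HasDerivAt b₂ b₂' s) (hc₂ : HasDerivAt c₂ c₂' s) (ha₃ : HasDerivAt a₃ a₃' s)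
    (hb₃ : HasDerivAt b₃ b₃' s) (hc₃ : HasDerivAt c₃ c₃' s) :
    HasDerivAt (fun s => polarGamma (P s) (R s) (a s) (b s) (c s) (a₂ s) (b₂ s) (c₂ s)
        (a₃ s) (b₃ s) (c₃ s))
      (-P' * (b s * a₂ s * a₃ s + a s * b₂ s * a₃ s - a s * a₂ s * b₃ s)
        - P s * (b' * a₂ s * a₃ s + b s * a₂' * a₃ s + b s * a₂ s * a₃'
          + (a' * b₂ s * a₃ s + a s * b₂' * a₃ s + a s * b₂ s * a₃')
          - (a' * a₂ s * b₃ s + a s * a₂' * b₃ s + a s * a₂ s * b₃'))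
        + R' * (b s * inner ℝ (c₂ s) (c₃ s) + b₂ s * inner ℝ (c s) (c₃ s)
          - b₃ s * inner ℝ (c s) (c₂ s))
        + R s * (b' * inner ℝ (c₂ s) (c₃ s) + b s * (inner ℝ c₂' (c₃ s) + inner ℝ (c₂ s) c₃')
          + b₂' * inner ℝ (c s) (c₃ s) + b₂ s * (inner ℝ c' (c₃ s) + inner ℝ (c s) c₃')
          - b₃' * inner ℝ (c s) (c₂ s) - b₃ s * (inner ℝ c' (c₂ s) + inner ℝ (c s) c₂'))) s := by
  have h := (hP.neg.mul ((((hb.mul ha₂).mul ha₃).add ((ha.mul hb₂).mul ha₃)).sub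
    ((ha.mul ha₂).mul hb₃))).add (hR.mul (((hb.mul (hc₂.inner ℝ hc₃)).add
      (hb₂.mul (hc.inner ℝ hc₃))).sub (hb₃.mul (hc.inner ℝ hc₂))))
  refine h.congr_deriv ?_
  simp
  ring

end

/-! ### Variations in polar components: values on Σ and linearized frame conditions -/

section
variable {n : ℕ}

/-- A variation `F` of the cone graph of `ρ` with null normals `L`, `Lb`, together with the polar
components of `F`, `L` and `Lb`. -/
structure IsPolarVariation (I : Set ℝ) (f rs : ℝ → ℝ) (w₀ : ℝ) (ρ : Space n → ℝ) (ε : ℝ)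
    (F L Lb : ℝ → Space n → Event n) (w r : ℝ → Space n → ℝ) (o : ℝ → Space n → Space n)
    (a b : ℝ → Space n → ℝ) (c : ℝ → Space n → Space n)
    (a₂ b₂ : ℝ → Space n → ℝ) (c₂ : ℝ → Space n → Space n) : Prop where
  warp : IsWarpingFactor I f
  tortoise : ∀ r ∈ I, HasDerivAt rs (1 / f r ^ 2) r
  ε_pos : 0 < ε
  map : IsPolarMap I rs ε F w r o
  fieldL : IsPolarField f ε r o L a b c
  fieldB : IsPolarField f ε r o Lb a₂ b₂ c₂
  frame : ∀ s ∈ Ioo (-ε) ε, IsNullFrame f (F s) (L s) (Lb s)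
  base_mem : ∀ x, ‖x‖ = 1 → ρ x ∈ I
  base_F : ∀ x, ‖x‖ = 1 → F 0 x = coneGraph rs w₀ ρ x
  base_L : ∀ x, ‖x‖ = 1 → L 0 x = coneNormal f ρ x

lemma fderiv_normalize {x : Space n} (hx : ‖x‖ = 1) (X : Space n) :
    fderiv ℝ (fun y : Space n => ‖y‖⁻¹ • y) x X = X - inner ℝ x X • x := by
  have hx0 := ne_zero_of_norm_one hx
  have h1 := (differentiableAt_of_smooth contDiffOn_norm' hx0).hasFDerivAt
  have h2 : HasFDerivAt (fun y : Space n => ‖y‖⁻¹) _ x :=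
    (hasDerivAt_inv (norm_ne_zero_iff.2 hx0)).comp_hasFDerivAt x h1
  have h3 : HasFDerivAt (fun y : Space n => ‖y‖⁻¹ • y) _ x := h2.smul (hasFDerivAt_id x)
  rw [h3.fderiv]
  simp [hx, fderiv_norm_apply hx0]
  abel

/-- Each frame condition says that a polar inner product is constant in s; this turns it into a
linear relation between first variations. -/
lemma deriv_eq_zero_of_eq_const {ε : ℝ} (hε : 0 < ε) {g : ℝ → ℝ} {g' k : ℝ}
    (hg : HasDerivAt g g' 0) (h : ∀ s ∈ Ioo (-ε) ε, g s = k) : g' = 0 := by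
  have e : g =ᶠ[𝓝 0] fun _ => k := by
    filter_upwards [isOpen_Ioo.mem_nhds (show (0 : ℝ) ∈ Ioo (-ε) ε by simp [hε])] with s hs
    exact h s hs
  exact hg.unique ((hasDerivAt_const 0 k).congr_of_eventuallyEq e)

namespace IsPolarVariation

variable {I : Set ℝ} {f rs : ℝ → ℝ} {w₀ : ℝ} {ρ : Space n → ℝ} {ε : ℝ}
  {F L Lb : ℝ → Space n → Event n} {w r : ℝ → Space n → ℝ} {o : ℝ → Space n → Space n}
  {a b : ℝ → Space n → ℝ} {c : ℝ → Space n → Space n}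
  {a₂ b₂ : ℝ → Space n → ℝ} {c₂ : ℝ → Space n → Space n}

lemma zero_mem (H : IsPolarVariation I f rs w₀ ρ ε F L Lb w r o a b c a₂ b₂ c₂) :
    (0 : ℝ) ∈ Ioo (-ε) ε := by simp [H.ε_pos]

lemma radius_mem (H : IsPolarVariation I f rs w₀ ρ ε F L Lb w r o a b c a₂ b₂ c₂)
    {y : Space n} (hy : y ≠ 0) : radialExt ρ y ∈ I := H.base_mem _ (norm_normalize hy)

lemma radius_pos (H : IsPolarVariation I f rs w₀ ρ ε F L Lb w r o a b c a₂ b₂ c₂)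
    {y : Space n} (hy : y ≠ 0) : 0 < radialExt ρ y := H.warp.radius_pos (H.radius_mem hy)

/-- Polar coordinates are unique for positive radius: the norm of the space part determines r, then
the direction is determined, then w from the time part. -/
lemma base_map (H : IsPolarVariation I f rs w₀ ρ ε F L Lb w r o a b c a₂ b₂ c₂)
    {y : Space n} (hy : y ≠ 0) :
    r 0 y = radialExt ρ y ∧ o 0 y = ‖y‖⁻¹ • y ∧ w 0 y = w₀ := by
  have h := H.map.eq 0 H.zero_mem y hy
  have h2 : radialExt (F 0) y = (w₀ + rs (radialExt ρ y), radialExt ρ y • (‖y‖⁻¹ • y)) :=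
    H.base_F _ (norm_normalize hy)
  rw [h2] at h
  have hpos := H.radius_pos hy
  have hrpos : 0 < r 0 y := H.warp.radius_pos (H.map.mem 0 H.zero_mem y hy)
  have e1 := congrArg Prod.fst h
  have e2 := congrArg Prod.snd h
  simp only at e1 e2
  have er : r 0 y = radialExt ρ y := by
    have := congrArg norm e2
    rw [norm_smul (r 0 y), norm_smul (radialExt ρ y), norm_normalize hy,
      H.map.norm_o 0 H.zero_mem y hy,
      Real.norm_of_nonneg hpos.le, Real.norm_of_nonneg hrpos.le] at this
    linarith
  refine ⟨er, ?_, ?_⟩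
  · rw [er] at e2
    exact (smul_right_injective _ hpos.ne' e2).symm
  · rw [er] at e1
    linarith

/-- In the coordinates (w, r, θ) the normal tangent to the cone is ρ ∂_r. -/
lemma base_fieldL (H : IsPolarVariation I f rs w₀ ρ ε F L Lb w r o a b c a₂ b₂ c₂)
    {y : Space n} (hy : y ≠ 0) : a 0 y = 0 ∧ b 0 y = radialExt ρ y ∧ c 0 y = 0 := by
  obtain ⟨er, eo, -⟩ := H.base_map hy
  have h := H.fieldL.eq 0 H.zero_mem y hy
  have horth := H.fieldL.orth 0 H.zero_mem y hy
  have h2 : radialExt (L 0) y = (radialExt ρ y / f (radialExt ρ y) ^ 2,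
      radialExt ρ y • (‖y‖⁻¹ • y)) := H.base_L _ (norm_normalize hy)
  rw [h2, er, eo] at h
  rw [eo] at horth
  have hpos := H.radius_pos hy
  have e1 := congrArg Prod.fst h
  have e2 := congrArg Prod.snd h
  simp only [ofPolar] at e1 e2
  have eb : b 0 y = radialExt ρ y := by
    have := congrArg (fun z => inner ℝ (‖y‖⁻¹ • y) z) e2
    simp only [inner_add_right] at this
    rw [real_inner_smul_right _ _ (radialExt ρ y), real_inner_smul_right _ _ (b 0 y),
      real_inner_smul_right _ _ (radialExt ρ y), horth, real_inner_self_eq_norm_sq,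
      norm_normalize hy] at this
    linarith
  rw [eb] at e1 e2
  refine ⟨by linarith, eb, ?_⟩
  have : radialExt ρ y • c 0 y = 0 := by
    have := e2
    simpa using this
  exact (smul_eq_zero.1 this).resolve_left hpos.ne'

lemma eventually_base (H : IsPolarVariation I f rs w₀ ρ ε F L Lb w r o a b c a₂ b₂ c₂)
    {x : Space n} (hx : ‖x‖ = 1) (X : Space n) :
    fderiv ℝ (w 0) x X = 0 ∧ fderiv ℝ (r 0) x X = fderiv ℝ (radialExt ρ) x X ∧
    fderiv ℝ (o 0) x X = X - inner ℝ x X • x ∧ fderiv ℝ (a 0) x X = 0 ∧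
    fderiv ℝ (b 0) x X = fderiv ℝ (radialExt ρ) x X ∧ fderiv ℝ (c 0) x X = 0 := by
  have hx0 := ne_zero_of_norm_one hx
  refine ⟨?_, ?_, ?_, ?_, ?_, ?_⟩
  · rw [(eventuallyEq_of_forall_ne (fun y hy => (H.base_map hy).2.2) hx0).fderiv_eq]; simp
  · rw [(eventuallyEq_of_forall_ne (fun y hy => (H.base_map hy).1) hx0).fderiv_eq]
  · rw [(eventuallyEq_of_forall_ne (fun y hy => (H.base_map hy).2.1) hx0).fderiv_eq,
      fderiv_normalize hx]
  · rw [(eventuallyEq_of_forall_ne (fun y hy => (H.base_fieldL hy).1) hx0).fderiv_eq]; simp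
  · rw [(eventuallyEq_of_forall_ne (fun y hy => (H.base_fieldL hy).2.1) hx0).fderiv_eq]
  · rw [(eventuallyEq_of_forall_ne (fun y hy => (H.base_fieldL hy).2.2) hx0).fderiv_eq]; simp

lemma value_L (H : IsPolarVariation I f rs w₀ ρ ε F L Lb w r o a b c a₂ b₂ c₂) {s : ℝ}
    (hs : s ∈ Ioo (-ε) ε) {x : Space n} (hx : ‖x‖ = 1) :
    L s x = ofPolar (f (r s x) ^ 2) (r s x) (o s x) (a s x) (b s x) (c s x) := by
  rw [← radialExt_of_norm_one (L s) hx, H.fieldL.eq s hs x (ne_zero_of_norm_one hx)]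

lemma value_Lb (H : IsPolarVariation I f rs w₀ ρ ε F L Lb w r o a b c a₂ b₂ c₂) {s : ℝ}
    (hs : s ∈ Ioo (-ε) ε) {x : Space n} (hx : ‖x‖ = 1) :
    Lb s x = ofPolar (f (r s x) ^ 2) (r s x) (o s x) (a₂ s x) (b₂ s x) (c₂ s x) := by
  rw [← radialExt_of_norm_one (Lb s) hx, H.fieldB.eq s hs x (ne_zero_of_norm_one hx)]

lemma null_eq (H : IsPolarVariation I f rs w₀ ρ ε F L Lb w r o a b c a₂ b₂ c₂) {s : ℝ}
    (hs : s ∈ Ioo (-ε) ε) {x : Space n} (hx : ‖x‖ = 1) :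
    polarInner (f (r s x) ^ 2) (r s x) (a s x) (b s x) (c s x) (a s x) (b s x) (c s x) = 0 := by
  have hc := H.fieldL.orth s hs x (ne_zero_of_norm_one hx)
  rw [← (H.frame s hs).null x hx, H.value_L hs hx, H.map.metric_eq H.warp hs hx hc hc]

lemma normalized_eq (H : IsPolarVariation I f rs w₀ ρ ε F L Lb w r o a b c a₂ b₂ c₂) {s : ℝ}
    (hs : s ∈ Ioo (-ε) ε) {x : Space n} (hx : ‖x‖ = 1) :
    polarInner (f (r s x) ^ 2) (r s x) (a s x) (b s x) (c s x) (a₂ s x) (b₂ s x) (c₂ s x) = -2 := by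
  have hc := H.fieldL.orth s hs x (ne_zero_of_norm_one hx)
  have hc₂ := H.fieldB.orth s hs x (ne_zero_of_norm_one hx)
  rw [← (H.frame s hs).normalized x hx, H.value_L hs hx, H.value_Lb hs hx,
    H.map.metric_eq H.warp hs hx hc hc₂]

lemma normal_eq (H : IsPolarVariation I f rs w₀ ρ ε F L Lb w r o a b c a₂ b₂ c₂) {s : ℝ}
    (hs : s ∈ Ioo (-ε) ε) {x X : Space n} (hx : ‖x‖ = 1) (hX : inner ℝ x X = 0) :
    polarInner (f (r s x) ^ 2) (r s x) (a s x) (b s x) (c s x) (fderiv ℝ (w s) x X)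
      (fderiv ℝ (r s) x X) (fderiv ℝ (o s) x X) = 0 := by
  have hx0 := ne_zero_of_norm_one hx
  rw [← (H.frame s hs).normal x X hx hX, H.value_L hs hx, H.map.sphereDeriv_eq H.tortoise hs hx0,
    H.map.metric_eq H.warp hs hx (H.fieldL.orth s hs x hx0) (H.map.inner_fderiv_o hs hx0 X)]

lemma normal_bar_eq (H : IsPolarVariation I f rs w₀ ρ ε F L Lb w r o a b c a₂ b₂ c₂) {s : ℝ}
    (hs : s ∈ Ioo (-ε) ε) {x X : Space n} (hx : ‖x‖ = 1) (hX : inner ℝ x X = 0) :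
    polarInner (f (r s x) ^ 2) (r s x) (a₂ s x) (b₂ s x) (c₂ s x) (fderiv ℝ (w s) x X)
      (fderiv ℝ (r s) x X) (fderiv ℝ (o s) x X) = 0 := by
  have hx0 := ne_zero_of_norm_one hx
  rw [← (H.frame s hs).normal_bar x X hx hX, H.value_Lb hs hx,
    H.map.sphereDeriv_eq H.tortoise hs hx0,
    H.map.metric_eq H.warp hs hx (H.fieldB.orth s hs x hx0) (H.map.inner_fderiv_o hs hx0 X)]

lemma exists_hasDerivAt_warp (H : IsPolarVariation I f rs w₀ ρ ε F L Lb w r o a b c a₂ b₂ c₂)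
    {x : Space n} (hx : ‖x‖ = 1) :
    (∃ Q', HasDerivAt (fun s => f (r s x) ^ 2) Q' 0) ∧
      ∃ P', HasDerivAt (fun s => f (r s x) * deriv f (r s x)) P' 0 := by
  have hx0 := ne_zero_of_norm_one hx
  have hmem := H.map.mem 0 H.zero_mem x hx0
  have hr := H.map.smooth_r.hasDerivAt H.ε_pos hx0
  have h1 : HasDerivAt (fun s => f (r s x)) _ 0 := (H.warp.hasDerivAt hmem).comp (0 : ℝ) hr
  have hd : ContDiffOn ℝ ∞ (deriv f) I :=
    ((contDiffOn_infty_iff_deriv_of_isOpen H.warp.isOpen).1 H.warp.smooth).2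
  have hdd : HasDerivAt (deriv f) _ (r 0 x) :=
    ((hd.contDiffAt (H.warp.isOpen.mem_nhds hmem)).differentiableAt (by simp)).hasDerivAt
  have h2 := HasDerivAt.comp (h₂ := deriv f) (0 : ℝ) hdd hr
  exact ⟨⟨_, h1.pow 2⟩, ⟨_, h1.mul h2⟩⟩

/-- On Σ only the ∂_r component of L is nonzero, and ∂_r is null. The linearization of ⟨L, L⟩ = 0
reduces to -2 ρ `dS a` = 0. -/
lemma dS_a (H : IsPolarVariation I f rs w₀ ρ ε F L Lb w r o a b c a₂ b₂ c₂)
    {x : Space n} (hx : ‖x‖ = 1) : dS a x = 0 := by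
  have hx0 := ne_zero_of_norm_one hx
  obtain ⟨Q', hQ⟩ := (H.exists_hasDerivAt_warp hx).1
  obtain ⟨ea, eb, ec⟩ := H.base_fieldL hx0
  have ha := H.fieldL.smooth_a.hasDerivAt H.ε_pos hx0
  have hb := H.fieldL.smooth_b.hasDerivAt H.ε_pos hx0
  have hc := H.fieldL.smooth_c.hasDerivAt H.ε_pos hx0
  have h := deriv_eq_zero_of_eq_const H.ε_pos (hasDerivAt_polarInner hQ
    (H.map.smooth_r.hasDerivAt H.ε_pos hx0) ha hb hc ha hb hc) fun s hs => H.null_eq hs hx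
  simp [ea, eb, ec] at h
  have := (H.radius_pos hx0).ne'
  have h2 : 2 * radialExt ρ x * dS a x = 0 := by linarith
  simpa [this] using h2

/-- Linearization of ⟨L, dF X⟩ = 0 for tangent X. The varying metric coefficients do not enter,
because on Σ they multiply components of L or derivatives of w that are zero. Both sides vanish in
the radial direction, so X may be arbitrary. -/
lemma inner_dS_c (H : IsPolarVariation I f rs w₀ ρ ε F L Lb w r o a b c a₂ b₂ c₂)
    {x : Space n} (hx : ‖x‖ = 1) (X : Space n) :
    radialExt ρ x * inner ℝ (dS c x) X = fderiv ℝ (dS w) x X := by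
  have hx0 := ne_zero_of_norm_one hx
  obtain ⟨Q', hQ⟩ := (H.exists_hasDerivAt_warp hx).1
  obtain ⟨ea, eb, ec⟩ := H.base_fieldL hx0
  obtain ⟨er, eo, ew⟩ := H.base_map hx0
  have hpos := H.radius_pos hx0
  have ha := H.fieldL.smooth_a.hasDerivAt H.ε_pos hx0
  have hb := H.fieldL.smooth_b.hasDerivAt H.ε_pos hx0
  have hc := H.fieldL.smooth_c.hasDerivAt H.ε_pos hx0
  have hrad : inner ℝ (dS c x) x = 0 := by
    have h := deriv_eq_zero_of_eq_const H.ε_pos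
      ((H.map.smooth_o.hasDerivAt H.ε_pos hx0).inner ℝ hc) fun s hs =>
        H.fieldL.orth s hs x hx0
    rw [eo, ec, hx] at h
    simpa [real_inner_comm] using h
  have hwx : fderiv ℝ (dS w) x x = 0 := (RayConst.dS H.map.ray_w).fderiv_self
    (differentiableAt_of_smooth (H.map.smooth_w.contDiffOn_dS H.ε_pos) hx0)
  have htan : ∀ Y : Space n, inner ℝ x Y = 0 →
      radialExt ρ x * inner ℝ (dS c x) Y = fderiv ℝ (dS w) x Y := by
    intro Y hY
    obtain ⟨dw, dr', do', -, -, -⟩ := H.eventually_base hx Y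
    have h := deriv_eq_zero_of_eq_const H.ε_pos (hasDerivAt_polarInner hQ
      (H.map.smooth_r.hasDerivAt H.ε_pos hx0) ha hb hc
      (H.map.smooth_w.hasDerivAt_fderiv H.ε_pos hx0 Y)
      (H.map.smooth_r.hasDerivAt_fderiv H.ε_pos hx0 Y)
      (H.map.smooth_o.hasDerivAt_fderiv H.ε_pos hx0 Y)) fun s hs => H.normal_eq hs hx hY
    rw [ea, eb, ec, er, dw, dr', do', hY, H.dS_a hx] at h
    simp at h
    have h2 : radialExt ρ x * (radialExt ρ x * inner ℝ (dS c x) Y - fderiv ℝ (dS w) x Y) = 0 := by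
      linarith
    have := (mul_eq_zero.1 h2).resolve_left hpos.ne'
    linarith
  have hdec := htan (X - inner ℝ x X • x) (by
    rw [inner_sub_right, real_inner_smul_right, real_inner_self_eq_norm_sq, hx]; ring)
  rw [inner_sub_right, real_inner_smul_right, hrad, map_sub, map_smul, hwx] at hdec
  simpa using hdec

lemma base_a₂ (H : IsPolarVariation I f rs w₀ ρ ε F L Lb w r o a b c a₂ b₂ c₂)
    {x : Space n} (hx : ‖x‖ = 1) : a₂ 0 x = 2 / radialExt ρ x := by
  have hx0 := ne_zero_of_norm_one hx
  obtain ⟨ea, eb, ec⟩ := H.base_fieldL hx0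
  have h := H.normalized_eq H.zero_mem hx
  have := (H.radius_pos hx0).ne'
  rw [ea, eb, ec] at h
  simp [polarInner] at h
  field_simp
  linarith

/-- The condition ⟨Lbar, dF X⟩ = 0 on Σ: the ∂_r part of dF X pairs with the ∂_w component 2/ρ of
Lbar and must be balanced by the spherical part, which is therefore 2ρ⁻³ ∇ρ. -/
lemma inner_base_c₂ (H : IsPolarVariation I f rs w₀ ρ ε F L Lb w r o a b c a₂ b₂ c₂)
    (hρ : SphereSmooth ρ) {x : Space n} (hx : ‖x‖ = 1) (X : Space n) :
    radialExt ρ x ^ 3 * inner ℝ (c₂ 0 x) X = 2 * fderiv ℝ (radialExt ρ) x X := by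
  have hx0 := ne_zero_of_norm_one hx
  obtain ⟨er, eo, ew⟩ := H.base_map hx0
  have hpos := H.radius_pos hx0
  have hrad : inner ℝ (c₂ 0 x) x = 0 := by
    have := H.fieldB.orth 0 H.zero_mem x hx0
    rw [eo, hx] at this
    simpa [real_inner_comm] using this
  have hwx : fderiv ℝ (radialExt ρ) x x = 0 :=
    RayConst.fderiv_self (fun c hc y => rayConst_radialExt ρ hc y) (differentiableAt_of_smooth hρ hx0)
  have htan : ∀ Y : Space n, inner ℝ x Y = 0 →
      radialExt ρ x ^ 3 * inner ℝ (c₂ 0 x) Y = 2 * fderiv ℝ (radialExt ρ) x Y := by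
    intro Y hY
    obtain ⟨dw, dr', do', -, -, -⟩ := H.eventually_base hx Y
    have h := H.normal_bar_eq H.zero_mem hx hY
    rw [dw, dr', do', hY, er, H.base_a₂ hx] at h
    simp [polarInner] at h
    field_simp at h
    linarith
  have hdec := htan (X - inner ℝ x X • x) (by
    rw [inner_sub_right, real_inner_smul_right, real_inner_self_eq_norm_sq, hx]; ring)
  rw [inner_sub_right, real_inner_smul_right, hrad, map_sub, map_smul, hwx] at hdec
  simpa using hdec

/-- Linearization of ⟨L, Lbar⟩ = -2. The ∂_r component of Lbar and its variation drop out, because L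
has no ∂_w component to first order. -/
lemma dS_a₂ (H : IsPolarVariation I f rs w₀ ρ ε F L Lb w r o a b c a₂ b₂ c₂)
    {x : Space n} (hx : ‖x‖ = 1) :
    dS a₂ x = -2 / radialExt ρ x ^ 2 * dS b x + radialExt ρ x * inner ℝ (dS c x) (c₂ 0 x) := by
  have hx0 := ne_zero_of_norm_one hx
  obtain ⟨Q', hQ⟩ := (H.exists_hasDerivAt_warp hx).1
  obtain ⟨ea, eb, ec⟩ := H.base_fieldL hx0
  obtain ⟨er, eo, ew⟩ := H.base_map hx0
  have hpos := H.radius_pos hx0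
  have h := deriv_eq_zero_of_eq_const H.ε_pos (hasDerivAt_polarInner hQ
    (H.map.smooth_r.hasDerivAt H.ε_pos hx0) (H.fieldL.smooth_a.hasDerivAt H.ε_pos hx0)
    (H.fieldL.smooth_b.hasDerivAt H.ε_pos hx0) (H.fieldL.smooth_c.hasDerivAt H.ε_pos hx0)
    (H.fieldB.smooth_a.hasDerivAt H.ε_pos hx0) (H.fieldB.smooth_b.hasDerivAt H.ε_pos hx0)
    (H.fieldB.smooth_c.hasDerivAt H.ε_pos hx0)) fun s hs => H.normalized_eq hs hx
  rw [ea, eb, ec, er, H.dS_a hx, H.base_a₂ hx] at h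
  simp at h
  field_simp at h ⊢
  linarith

end IsPolarVariation

end

/-! ### Linearization of the torsion ⟨D_X Lbar, L⟩ -/

section
variable {n : ℕ}

lemma fderiv_fderiv_eq_sum {g : Space n → ℝ} (hg : ContDiffOn ℝ ∞ g {0}ᶜ) {x : Space n}
    (hx : x ≠ 0) (X Y : Space n) :
    fderiv ℝ (fun y => fderiv ℝ g y Y) x X = ∑ i, X i * ∑ j, pderiv i (pderiv j g) x * Y j := by
  rw [fderiv_eq_sum_pderiv]
  refine Finset.sum_congr rfl fun i _ => ?_
  congr 1
  have e : (fun y => fderiv ℝ g y Y) = fun y => ∑ j, Y j * pderiv j g y :=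
    funext fun y => fderiv_eq_sum_pderiv g y Y
  have hd : ∀ j, DifferentiableAt ℝ (pderiv j g) x := fun j =>
    differentiableAt_of_smooth (contDiffOn_pderiv hg j) hx
  rw [e, pderiv_sum _ i fun j _ => (hd j).const_mul _]
  refine Finset.sum_congr rfl fun j _ => ?_
  rw [pderiv_const_mul i _ (hd j), mul_comm]

lemma RayConst.fderiv_normalize {W : Type*} [NormedAddCommGroup W] [NormedSpace ℝ W]
    {g : Space n → W} (hg : RayConst g) (hs : ContDiffOn ℝ ∞ g {0}ᶜ) {y : Space n} (hy : y ≠ 0)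
    (X : Space n) : fderiv ℝ g (‖y‖⁻¹ • y) X = ‖y‖ • fderiv ℝ g y X := by
  have hn := norm_pos_iff.2 hy
  rw [← hg.fderiv_smul (inv_pos.2 hn)
    (differentiableAt_of_smooth hs (normalize_ne_zero hy)) X, smul_smul, mul_inv_cancel₀ hn.ne',
    one_smul]

namespace IsPolarVariation

variable {I : Set ℝ} {f rs : ℝ → ℝ} {w₀ : ℝ} {ρ : Space n → ℝ} {ε : ℝ}
  {F L Lb : ℝ → Space n → Event n} {w r : ℝ → Space n → ℝ} {o : ℝ → Space n → Space n}
  {a b : ℝ → Space n → ℝ} {c : ℝ → Space n → Space n}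
  {a₂ b₂ : ℝ → Space n → ℝ} {c₂ : ℝ → Space n → Space n}

/-- Every term of `dS_a₂` is constant along rays, so that formula holds in a neighbourhood of x and
can be differentiated. -/
lemma fderiv_dS_a₂ (H : IsPolarVariation I f rs w₀ ρ ε F L Lb w r o a b c a₂ b₂ c₂)
    (hρ : SphereSmooth ρ) {x : Space n} (hx : ‖x‖ = 1) (X : Space n) :
    fderiv ℝ (dS a₂) x X = -2 / radialExt ρ x ^ 2 * fderiv ℝ (dS b) x X
      + 4 / radialExt ρ x ^ 3 * fderiv ℝ (radialExt ρ) x X * dS b x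
      + fderiv ℝ (radialExt ρ) x X * inner ℝ (dS c x) (c₂ 0 x)
      + radialExt ρ x * (inner ℝ (fderiv ℝ (dS c) x X) (c₂ 0 x)
        + inner ℝ (dS c x) (fderiv ℝ (c₂ 0) x X)) := by
  have hx0 := ne_zero_of_norm_one hx
  have hpos := H.radius_pos hx0
  have e : dS a₂ =ᶠ[𝓝 x] fun y => -2 / radialExt ρ y ^ 2 * dS b y
      + radialExt ρ y * inner ℝ (dS c y) (c₂ 0 y) := by
    refine eventuallyEq_of_forall_ne (fun y hy => ?_) hx0
    have h := H.dS_a₂ (norm_normalize hy)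
    rwa [(RayConst.dS H.fieldB.ray_a).normalize hy, (RayConst.dS H.fieldL.ray_b).normalize hy,
      (RayConst.dS H.fieldL.ray_c).normalize hy, (H.fieldB.ray_c 0).normalize hy,
      rayConst_radialExt ρ (inv_pos.2 (norm_pos_iff.2 hy))] at h
  have hR := (differentiableAt_of_smooth hρ hx0).hasFDerivAt
  have hb := (differentiableAt_of_smooth (H.fieldL.smooth_b.contDiffOn_dS H.ε_pos) hx0).hasFDerivAt
  have hc := (differentiableAt_of_smooth (H.fieldL.smooth_c.contDiffOn_dS H.ε_pos) hx0).hasFDerivAt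
  have hc₂ := (differentiableAt_of_smooth (H.fieldB.smooth_c.slice H.zero_mem) hx0).hasFDerivAt
  have h : HasFDerivAt (fun y => -2 / radialExt ρ y ^ 2 * dS b y
      + radialExt ρ y * inner ℝ (dS c y) (c₂ 0 y)) _ x :=
    ((hasFDerivAt_fun_div (hasFDerivAt_const (-2 : ℝ) x) (hR.pow 2) (by positivity)).mul hb).add
      (hR.mul (hc.inner ℝ hc₂))
  rw [e.fderiv_eq, h.fderiv]
  simp [fderivInnerCLM_apply]
  field_simp
  ring

/-- Away from the unit sphere `inner_dS_c` acquires a factor |y|, since the derivative of the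
ray-constant `dS w` has degree -1. Differentiating this factor produces the term with ⟨x, X⟩. -/
lemma inner_fderiv_dS_c (H : IsPolarVariation I f rs w₀ ρ ε F L Lb w r o a b c a₂ b₂ c₂)
    (hρ : SphereSmooth ρ) {x : Space n} (hx : ‖x‖ = 1) (X Y : Space n) :
    radialExt ρ x * inner ℝ (fderiv ℝ (dS c) x X) Y
      = inner ℝ x X * fderiv ℝ (dS w) x Y + fderiv ℝ (fun y => fderiv ℝ (dS w) y Y) x X
        - fderiv ℝ (radialExt ρ) x X * inner ℝ (dS c x) Y := by
  have hx0 := ne_zero_of_norm_one hx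
  have cw := H.map.smooth_w.contDiffOn_dS H.ε_pos
  have e : (fun y => radialExt ρ y * inner ℝ (dS c y) Y)
      =ᶠ[𝓝 x] fun y => ‖y‖ * fderiv ℝ (dS w) y Y := by
    refine eventuallyEq_of_forall_ne (fun y hy => ?_) hx0
    have h := H.inner_dS_c (norm_normalize hy) Y
    rwa [(RayConst.dS H.fieldL.ray_c).normalize hy,
      (RayConst.dS H.map.ray_w).fderiv_normalize cw hy,
      rayConst_radialExt ρ (inv_pos.2 (norm_pos_iff.2 hy))] at h
  have hR := (differentiableAt_of_smooth hρ hx0).hasFDerivAt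
  have hc := (differentiableAt_of_smooth (H.fieldL.smooth_c.contDiffOn_dS H.ε_pos) hx0).hasFDerivAt
  have hN := (differentiableAt_of_smooth contDiffOn_norm' hx0).hasFDerivAt
  have cwY : ContDiffOn ℝ ∞ (fun y => fderiv ℝ (dS w) y Y) {0}ᶜ :=
    (cw.fderiv_of_isOpen isOpen_compl_singleton (by simp)).clm_apply contDiffOn_const
  have hw := (differentiableAt_of_smooth cwY hx0).hasFDerivAt
  have h1 := hR.mul (hc.inner ℝ (hasFDerivAt_const Y x))
  have h2 := (hN.mul hw).congr_of_eventuallyEq e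
  have h3 := congrArg (fun A => A X) (h1.unique h2)
  simp [fderivInnerCLM_apply, fderiv_norm_apply hx0, hx] at h3
  linarith

/-- Linearization of ⟨Lbar, dF X⟩ = 0, solved for the combination of `dS c₂` and `dS o` in which
these enter the linearized torsion. -/
lemma normal_bar_linearized (H : IsPolarVariation I f rs w₀ ρ ε F L Lb w r o a b c a₂ b₂ c₂)
    {x X : Space n} (hx : ‖x‖ = 1) (hX : inner ℝ x X = 0) :
    radialExt ρ x ^ 2 * (inner ℝ (dS c₂ x) X + inner ℝ (c₂ 0 x) (fderiv ℝ (dS o) x X))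
      = f (radialExt ρ x) ^ 2 * (2 / radialExt ρ x) * fderiv ℝ (dS w) x X
        + dS a₂ x * fderiv ℝ (radialExt ρ) x X + 2 / radialExt ρ x * fderiv ℝ (dS r) x X
        + b₂ 0 x * fderiv ℝ (dS w) x X
        - 2 * radialExt ρ x * dS r x * inner ℝ (c₂ 0 x) X := by
  have hx0 := ne_zero_of_norm_one hx
  obtain ⟨Q', hQ⟩ := (H.exists_hasDerivAt_warp hx).1
  obtain ⟨er, eo, ew⟩ := H.base_map hx0
  obtain ⟨dw, dr', do', -, -, -⟩ := H.eventually_base hx X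
  have h := deriv_eq_zero_of_eq_const H.ε_pos (hasDerivAt_polarInner hQ
    (H.map.smooth_r.hasDerivAt H.ε_pos hx0)
    (H.fieldB.smooth_a.hasDerivAt H.ε_pos hx0) (H.fieldB.smooth_b.hasDerivAt H.ε_pos hx0)
    (H.fieldB.smooth_c.hasDerivAt H.ε_pos hx0)
    (H.map.smooth_w.hasDerivAt_fderiv H.ε_pos hx0 X)
    (H.map.smooth_r.hasDerivAt_fderiv H.ε_pos hx0 X)
    (H.map.smooth_o.hasDerivAt_fderiv H.ε_pos hx0 X)) fun s hs => H.normal_bar_eq hs hx hX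
  rw [er, dw, dr', do', hX, H.base_a₂ hx] at h
  simp only [zero_smul, sub_zero] at h
  linear_combination h

/-- The linearization of `⟨D_X Lb, L⟩ = 0`. -/
theorem torsion_linearized (H : IsPolarVariation I f rs w₀ ρ ε F L Lb w r o a b c a₂ b₂ c₂)
    (hρ : SphereSmooth ρ) {x X : Space n} (hx : ‖x‖ = 1) (hX : inner ℝ x X = 0)
    (htor : deriv (fun s => covInner f (F s) (Lb s) x X (L s x)) 0 = 0) :
    radialExt ρ x * (fderiv ℝ (dS b) x X - fderiv ℝ (dS r) x X)
      - fderiv ℝ (radialExt ρ) x X * (dS b x - dS r x)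
      - ∑ i, X i * ∑ j, pderiv i (pderiv j (dS w)) x * pderiv j (radialExt ρ) x
      + radialExt ρ x ^ 2 * (f (radialExt ρ x) * deriv f (radialExt ρ x)
        - f (radialExt ρ x) ^ 2 / radialExt ρ x) * fderiv ℝ (dS w) x X = 0 := by
  have hx0 := ne_zero_of_norm_one hx
  have hpos := H.radius_pos hx0
  have cw := H.map.smooth_w.contDiffOn_dS H.ε_pos
  obtain ⟨⟨Q', hQ⟩, P', hP⟩ := H.exists_hasDerivAt_warp hx
  obtain ⟨ea, eb, ec⟩ := H.base_fieldL hx0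
  obtain ⟨er, eo, ew⟩ := H.base_map hx0
  obtain ⟨dw, dr', do', -, -, -⟩ := H.eventually_base hx X
  have hr' := H.map.smooth_r.hasDerivAt H.ε_pos hx0
  have ha := H.fieldL.smooth_a.hasDerivAt H.ε_pos hx0
  have hb := H.fieldL.smooth_b.hasDerivAt H.ε_pos hx0
  have hc := H.fieldL.smooth_c.hasDerivAt H.ε_pos hx0
  have hD := (hasDerivAt_polarInner hQ hr'
    (H.fieldB.smooth_a.hasDerivAt_fderiv H.ε_pos hx0 X)
    (H.fieldB.smooth_b.hasDerivAt_fderiv H.ε_pos hx0 X)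
    (H.fieldB.smooth_c.hasDerivAt_fderiv H.ε_pos hx0 X) ha hb hc).add
    (hasDerivAt_polarGamma hP hr'
      (H.map.smooth_w.hasDerivAt_fderiv H.ε_pos hx0 X)
      (H.map.smooth_r.hasDerivAt_fderiv H.ε_pos hx0 X)
      (H.map.smooth_o.hasDerivAt_fderiv H.ε_pos hx0 X)
      (H.fieldB.smooth_a.hasDerivAt H.ε_pos hx0) (H.fieldB.smooth_b.hasDerivAt H.ε_pos hx0)
      (H.fieldB.smooth_c.hasDerivAt H.ε_pos hx0) ha hb hc)
  have h5 := (hD.congr_of_eventuallyEq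
    (f₁ := fun s => covInner f (F s) (Lb s) x X (L s x)) (by
      filter_upwards [isOpen_Ioo.mem_nhds H.zero_mem] with s hs
      rw [H.value_L hs hx, H.fieldB.covInner_eq H.warp H.tortoise H.map hs hx X
        (H.fieldL.orth s hs x hx0), Pi.add_apply])).deriv
  rw [htor] at h5
  clear hD
  have da₂ : fderiv ℝ (a₂ 0) x X
      = -2 / radialExt ρ x ^ 2 * fderiv ℝ (radialExt ρ) x X := by
    have ee : a₂ 0 =ᶠ[𝓝 x] fun y => 2 / radialExt ρ y := by
      refine eventuallyEq_of_forall_ne (fun y hy => ?_) hx0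
      have h := H.base_a₂ (norm_normalize hy)
      rwa [(H.fieldB.ray_a 0).normalize hy,
        rayConst_radialExt ρ (inv_pos.2 (norm_pos_iff.2 hy))] at h
    rw [ee.fderiv_eq, (hasFDerivAt_fun_div (hasFDerivAt_const (2 : ℝ) x)
      (differentiableAt_of_smooth hρ hx0).hasFDerivAt hpos.ne').fderiv]
    simp
    ring
  rw [ea, eb, ec, er, dw, dr', do', hX, da₂, H.base_a₂ hx, H.dS_a hx, H.fderiv_dS_a₂ hρ hx] at h5
  simp only [zero_smul, sub_zero, inner_zero_right, mul_zero, zero_mul, add_zero, zero_add] at h5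
  have h4 := H.normal_bar_linearized hx hX
  rw [H.dS_a₂ hx] at h4
  have hcX := H.inner_dS_c hx X
  have hc₂X := H.inner_base_c₂ hρ hx X
  have hcc := H.inner_fderiv_dS_c hρ hx X (c₂ 0 x)
  rw [fderiv_fderiv_eq_sum cw hx0, hX] at hcc
  -- The torsion produces the Hessian of `dS w` contracted with the spherical part of Lbar, which on
  -- Σ is 2ρ⁻³ ∇ρ.
  have hsum : ∑ i, X i * ∑ j, pderiv i (pderiv j (dS w)) x * pderiv j (radialExt ρ) x
      = radialExt ρ x ^ 3 / 2 * ∑ i, X i * ∑ j, pderiv i (pderiv j (dS w)) x * (c₂ 0 x) j := by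
    rw [Finset.mul_sum]
    refine Finset.sum_congr rfl fun i _ => ?_
    rw [mul_left_comm]
    congr 1
    rw [Finset.mul_sum]
    refine Finset.sum_congr rfl fun j _ => ?_
    have hj := H.inner_base_c₂ hρ hx (EuclideanSpace.single j 1)
    rw [EuclideanSpace.inner_single_right] at hj
    simp at hj
    have : pderiv j (radialExt ρ) x = radialExt ρ x ^ 3 * (c₂ 0 x) j / 2 := by
      unfold pderiv; linarith
    rw [this]; ring
  have i1 : inner ℝ X (c₂ 0 x) = inner ℝ (c₂ 0 x) X := real_inner_comm _ _
  have i2 : inner ℝ (fderiv ℝ (c₂ 0) x X) (dS c x) = inner ℝ (dS c x) (fderiv ℝ (c₂ 0) x X) :=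
    real_inner_comm _ _
  have i3 : inner ℝ (c₂ 0 x) (dS c x) = inner ℝ (dS c x) (c₂ 0 x) := real_inner_comm _ _
  have i4 : inner ℝ X (dS c x) = inner ℝ (dS c x) X := real_inner_comm _ _
  have i5 : inner ℝ X (dS c₂ x) = inner ℝ (dS c₂ x) X := real_inner_comm _ _
  have i6 : inner ℝ (fderiv ℝ (dS o) x X) (c₂ 0 x) = inner ℝ (c₂ 0 x) (fderiv ℝ (dS o) x X) :=
    real_inner_comm _ _
  rw [hsum]
  rw [i1, i2, i3, i4, i5, i6] at h5
  -- What remains is linear algebra: solve for A2, A3, A4 and A6 and substitute into `h5`. The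
  -- quantities A1, A5, A7 and the ∂_r component b' of Lbar then cancel.
  generalize (∑ i, X i * ∑ j, pderiv i (pderiv j (dS w)) x * (c₂ 0 x) j) = S at hcc ⊢
  generalize radialExt ρ x = R at *
  generalize fderiv ℝ (radialExt ρ) x X = RX at *
  generalize fderiv ℝ (dS b) x X = qX at *
  generalize fderiv ℝ (dS r) x X = rX at *
  generalize fderiv ℝ (dS w) x X = wX at *
  generalize inner ℝ (dS c x) (c₂ 0 x) = A1 at *
  generalize inner ℝ (dS c x) X = A2 at *
  generalize inner ℝ (c₂ 0 x) X = A3 at *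
  generalize inner ℝ (fderiv ℝ (dS c) x X) (c₂ 0 x) = A4 at *
  generalize inner ℝ (dS c x) (fderiv ℝ (c₂ 0) x X) = A5 at *
  generalize inner ℝ (dS c₂ x) X = A6 at *
  generalize inner ℝ (c₂ 0 x) (fderiv ℝ (dS o) x X) = A7 at *
  generalize dS b x = q at *
  generalize dS r x = r' at *
  generalize b₂ 0 x = b' at *
  have hA3 : A3 = 2 * RX / R ^ 3 := by field_simp; linarith
  have hA2 : A2 = wX / R := by field_simp; linarith
  have hA4 : A4 = (S - RX * A1) / R := by field_simp; linarith
  have hA6 : A6 = (f R ^ 2 * (2 / R) * wX + (-2 / R ^ 2 * q + R * A1) * RX + 2 / R * rX + b' * wX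
        - 2 * R * r' * A3) / R ^ 2 - A7 := by
    rw [eq_sub_iff_add_eq, eq_div_iff (by positivity)]
    linarith
  rw [hA6, hA4, hA3, hA2] at h5
  field_simp at h5 ⊢
  linear_combination -h5

end IsPolarVariation

end

section
variable {n : ℕ}

/-! ### The trace of the null second fundamental form -/

lemma contDiffAt_det {E : Type*} [NormedAddCommGroup E] [NormedSpace ℝ E] {k : WithTop ℕ∞}
    {M : E → Matrix (Fin n) (Fin n) ℝ} {q : E} (hM : ∀ i j, ContDiffAt ℝ k (fun z => M z i j) q) :
    ContDiffAt ℝ k (fun z => (M z).det) q := by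
  simp only [Matrix.det_apply]
  refine ContDiffAt.sum fun σ _ => ?_
  exact (contDiffAt_prod fun i _ => hM _ _).const_smul _

/-- Cramer's rule writes each entry of the inverse as a quotient of determinants, so smoothness can
be checked entry by entry. -/
lemma contDiffAt_matrix_inv {E : Type*} [NormedAddCommGroup E] [NormedSpace ℝ E]
    {k : WithTop ℕ∞} {M : E → Matrix (Fin n) (Fin n) ℝ} {q : E}
    (hM : ∀ i j, ContDiffAt ℝ k (fun z => M z i j) q) (h0 : (M q).det ≠ 0) (i j : Fin n) :
    ContDiffAt ℝ k (fun z => (M z)⁻¹ i j) q := by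
  have e : (fun z => (M z)⁻¹ i j) = fun z => ((M z).det)⁻¹ * ((M z).updateRow j (Pi.single i 1)).det := by
    funext z
    rw [Matrix.inv_def, Ring.inverse_eq_inv', Matrix.smul_apply, Matrix.adjugate_apply, smul_eq_mul]
  rw [e]
  refine ((contDiffAt_det hM).inv h0).mul (contDiffAt_det fun a b => ?_)
  by_cases ha : a = j
  · subst ha
    simp only [Matrix.updateRow_self]
    exact contDiffAt_const
  · simp only [Matrix.updateRow_ne ha]
    exact hM a b

lemma contDiffAt_trace_inv_mul {E : Type*} [NormedAddCommGroup E] [NormedSpace ℝ E]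
    {k : WithTop ℕ∞} {M N : E → Matrix (Fin n) (Fin n) ℝ} {q : E}
    (hM : ∀ i j, ContDiffAt ℝ k (fun z => M z i j) q)
    (hN : ∀ i j, ContDiffAt ℝ k (fun z => N z i j) q) (h0 : (M q).det ≠ 0) :
    ContDiffAt ℝ k (fun z => ((M z)⁻¹ * N z).trace) q := by
  simp only [Matrix.trace, Matrix.diag, Matrix.mul_apply]
  exact ContDiffAt.sum fun i _ => ContDiffAt.sum fun j _ =>
    (contDiffAt_matrix_inv hM h0 i j).mul (hN j i)

/-- The matrix, in the standard basis, of `⟨x, ·⟩² + R² |P ·|²`, where `P` is the projection to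
the orthogonal complement of the unit vector `x`. -/
lemma inv_sphereMatrix {x : Space n} (hx : ‖x‖ = 1) {R : ℝ} (hR : R ≠ 0)
    {M : Matrix (Fin n) (Fin n) ℝ}
    (hM : ∀ i j, M i j = x i * x j + R ^ 2 * ((if i = j then 1 else 0) - x i * x j)) :
    M.det ≠ 0 ∧ ∀ i j, M⁻¹ i j = x i * x j + R⁻¹ ^ 2 * ((if i = j then 1 else 0) - x i * x j) := by
  have hone : M * (Matrix.of fun i j => x i * x j
      + R⁻¹ ^ 2 * ((if i = j then 1 else 0) - x i * x j)) = 1 := by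
    ext i j
    rw [Matrix.mul_apply]
    have hk : ∀ k, M i k * (Matrix.of (fun i j => x i * x j
        + R⁻¹ ^ 2 * ((if i = j then (1 : ℝ) else 0) - x i * x j))) k j
        = (x i * x j * (1 - R ^ 2) * (1 - R⁻¹ ^ 2)) * (x k * x k)
          + x i * (1 - R ^ 2) * R⁻¹ ^ 2 * (if k = j then x k else 0)
          + R ^ 2 * (1 - R⁻¹ ^ 2) * x j * (if i = k then x k else 0)
          + (if i = k then (if k = j then 1 else 0) else 0) := by
      intro k
      rw [hM i k, Matrix.of_apply]
      rcases eq_or_ne i k with rfl | h1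
      · by_cases h2 : i = j <;> simp [h2] <;> field_simp <;> ring
      · rcases eq_or_ne k j with rfl | h2
        · simp [h1]; field_simp; ring
        · simp [h1, h2]; field_simp; ring
    simp only [hk, Finset.sum_add_distrib, ← Finset.mul_sum, sum_sq_of_norm_one hx]
    simp only [Finset.sum_ite_eq', Finset.sum_ite_eq, Finset.mem_univ, if_true, Matrix.one_apply]
    field_simp
    ring
  refine ⟨?_, fun i j => ?_⟩
  · have := congrArg Matrix.det hone
    rw [Matrix.det_mul, Matrix.det_one] at this
    intro h0
    rw [h0, zero_mul] at this
    exact zero_ne_one this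
  · rw [Matrix.inv_eq_right_inv hone, Matrix.of_apply]

/-- Since M x = x for all s near 0 (and M is symmetric in the application), the rank one matrix xxᵀ
satisfies tr(M⁻¹ xxᵀ) = 1, and so tr(M⁻¹ N) = tr(M⁻¹ (N - M + xxᵀ)) + n - 1. The bracket vanishes at
s = 0, so the derivative of M⁻¹ is never needed. By `hE'` the radial part of `E'` does not
contribute, which leaves R⁻² times its trace. -/
lemma hasDerivAt_trace_inv_mul {x : Space n} (hx : ‖x‖ = 1) {R : ℝ} (hR : R ≠ 0)
    {M N : ℝ → Matrix (Fin n) (Fin n) ℝ} {E' : Fin n → Fin n → ℝ}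
    (hM : ∀ i j, ContDiffAt ℝ 1 (fun s => M s i j) 0)
    (hM0 : ∀ i j, M 0 i j = x i * x j + R ^ 2 * ((if i = j then 1 else 0) - x i * x j))
    (hMx : ∀ᶠ s in 𝓝 (0 : ℝ), ∀ i, ∑ j, M s i j * x j = x i)
    (hE : ∀ i j, HasDerivAt (fun s => N s i j - M s i j) (E' i j) 0)
    (hE0 : ∀ i j, N 0 i j - M 0 i j = -(x i * x j))
    (hE' : ∑ i, ∑ j, x i * x j * E' j i = 0) :
    HasDerivAt (fun s => ((M s)⁻¹ * N s).trace) (R⁻¹ ^ 2 * ∑ i, E' i i) 0 := by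
  obtain ⟨hdet, hinv⟩ := inv_sphereMatrix hx hR hM0
  have hdet' : ∀ᶠ s in 𝓝 (0 : ℝ), (M s).det ≠ 0 :=
    (contDiffAt_det hM).continuousAt.eventually_ne hdet
  have e : (fun s => ((M s)⁻¹ * N s).trace) =ᶠ[𝓝 0]
      fun s => (∑ i, ∑ j, (M s)⁻¹ i j * ((N s j i - M s j i) + x j * x i)) + ((n : ℝ) - 1) := by
    filter_upwards [hMx, hdet'] with s hs hds
    have hu : IsUnit (M s).det := hds.isUnit
    have hxs : ∀ i, ∑ j, (M s)⁻¹ i j * x j = x i := by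
      intro i
      have h1 : (M s).mulVec (fun j => x j) = fun j => x j := by
        funext i; exact hs i
      have h2 : (M s)⁻¹.mulVec ((M s).mulVec (fun j => x j)) = fun j => x j := by
        rw [Matrix.mulVec_mulVec, Matrix.nonsing_inv_mul _ hu, Matrix.one_mulVec]
      rw [h1] at h2
      exact congrFun h2 i
    have hid : ∑ i, ∑ j, (M s)⁻¹ i j * M s j i = n := by
      have h1 : ((M s)⁻¹ * M s).trace = n := by
        rw [Matrix.nonsing_inv_mul _ hu, Matrix.trace_one, Fintype.card_fin]
      simpa only [Matrix.trace, Matrix.diag, Matrix.mul_apply] using h1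
    have hproj : ∑ i, ∑ j, (M s)⁻¹ i j * (x j * x i) = 1 := by
      have : ∀ i, ∑ j, (M s)⁻¹ i j * (x j * x i) = x i * x i := by
        intro i
        conv_rhs => rw [← hxs i, Finset.sum_mul]
        rw [hxs i]
        exact Finset.sum_congr rfl fun j _ => by ring
      simp only [this]
      exact sum_sq_of_norm_one hx
    simp only [Matrix.trace, Matrix.diag, Matrix.mul_apply, mul_add, mul_sub,
      Finset.sum_add_distrib, Finset.sum_sub_distrib, hid, hproj]
    ring
  have hD : HasDerivAt (fun s => (∑ i, ∑ j, (M s)⁻¹ i j * ((N s j i - M s j i) + x j * x i))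
      + ((n : ℝ) - 1)) (∑ i, ∑ j, (M 0)⁻¹ i j * E' j i) 0 := by
    refine HasDerivAt.add_const _ ?_
    refine HasDerivAt.fun_sum fun i _ => HasDerivAt.fun_sum fun j _ => ?_
    have h1 := ((contDiffAt_matrix_inv hM hdet i j).differentiableAt (by simp)).hasDerivAt
    have h2 := h1.mul ((hE j i).add_const (x j * x i))
    refine h2.congr_deriv ?_
    rw [hE0 j i]
    ring
  refine (hD.congr_of_eventuallyEq e).congr_deriv ?_
  have hterm : ∀ i j, (M 0)⁻¹ i j * E' j i = (1 - R⁻¹ ^ 2) * (x i * x j * E' j i)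
      + R⁻¹ ^ 2 * (if i = j then E' j i else 0) := by
    intro i j
    rw [hinv]
    by_cases hij : i = j <;> simp [hij] <;> ring
  simp only [hterm, Finset.sum_add_distrib, ← Finset.mul_sum, hE']
  simp

lemma contDiffOn_polarInner {E : Type*} [NormedAddCommGroup E] [NormedSpace ℝ E] {S : Set E}
    {Q R a b a₂ b₂ : E → ℝ} {c c₂ : E → Space n}
    (hQ : ContDiffOn ℝ ∞ Q S) (hR : ContDiffOn ℝ ∞ R S) (ha : ContDiffOn ℝ ∞ a S)
    (hb : ContDiffOn ℝ ∞ b S) (hc : ContDiffOn ℝ ∞ c S) (ha₂ : ContDiffOn ℝ ∞ a₂ S)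
    (hb₂ : ContDiffOn ℝ ∞ b₂ S) (hc₂ : ContDiffOn ℝ ∞ c₂ S) :
    ContDiffOn ℝ ∞ (fun s => polarInner (Q s) (R s) (a s) (b s) (c s) (a₂ s) (b₂ s) (c₂ s)) S :=
  ((((hQ.neg.mul ha).mul ha₂).sub (ha.mul hb₂)).sub (hb.mul ha₂)).add
    ((hR.pow 2).mul (hc.inner ℝ hc₂))

lemma contDiffOn_polarGamma {E : Type*} [NormedAddCommGroup E] [NormedSpace ℝ E] {S : Set E}
    {P R a b a₂ b₂ a₃ b₃ : E → ℝ} {c c₂ c₃ : E → Space n}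
    (hP : ContDiffOn ℝ ∞ P S) (hR : ContDiffOn ℝ ∞ R S) (ha : ContDiffOn ℝ ∞ a S)
    (hb : ContDiffOn ℝ ∞ b S) (hc : ContDiffOn ℝ ∞ c S) (ha₂ : ContDiffOn ℝ ∞ a₂ S)
    (hb₂ : ContDiffOn ℝ ∞ b₂ S) (hc₂ : ContDiffOn ℝ ∞ c₂ S) (ha₃ : ContDiffOn ℝ ∞ a₃ S)
    (hb₃ : ContDiffOn ℝ ∞ b₃ S) (hc₃ : ContDiffOn ℝ ∞ c₃ S) :
    ContDiffOn ℝ ∞ (fun s => polarGamma (P s) (R s) (a s) (b s) (c s) (a₂ s) (b₂ s) (c₂ s)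
        (a₃ s) (b₃ s) (c₃ s)) S :=
  (hP.neg.mul ((((hb.mul ha₂).mul ha₃).add ((ha.mul hb₂).mul ha₃)).sub
    ((ha.mul ha₂).mul hb₃))).add (hR.mul (((hb.mul (hc₂.inner ℝ hc₃)).add
      (hb₂.mul (hc.inner ℝ hc₃))).sub (hb₃.mul (hc.inner ℝ hc₂))))

lemma sum_polarInner {Q R a b : ℝ} {c : Space n} (t u v : Fin n → ℝ) (z : Fin n → Space n) :
    ∑ j, polarInner Q R a b c (u j) (v j) (z j) * t j
      = polarInner Q R a b c (∑ j, t j * u j) (∑ j, t j * v j) (∑ j, t j • z j) := by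
  simp only [polarInner, inner_sum, Finset.mul_sum, real_inner_smul_right,
    ← Finset.sum_sub_distrib, ← Finset.sum_add_distrib]
  exact Finset.sum_congr rfl fun j _ => by ring

end

/-! ### The first variation of tr χ -/

section
variable {n : ℕ}

/-- The induced metric in polar components, see `gramMatrix`. -/
def polarGram (f : ℝ → ℝ) (w r : ℝ → Space n → ℝ) (o : ℝ → Space n → Space n) (s : ℝ)
    (y : Space n) : Matrix (Fin n) (Fin n) ℝ :=
  Matrix.of fun i j => y i * y j + polarInner (f (r s y) ^ 2) (r s y)
    (fderiv ℝ (w s) y (EuclideanSpace.single i 1)) (fderiv ℝ (r s) y (EuclideanSpace.single i 1))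
    (fderiv ℝ (o s) y (EuclideanSpace.single i 1)) (fderiv ℝ (w s) y (EuclideanSpace.single j 1))
    (fderiv ℝ (r s) y (EuclideanSpace.single j 1)) (fderiv ℝ (o s) y (EuclideanSpace.single j 1))

/-- The null second fundamental form in polar components, see `chiMatrix`. -/
def polarChi (f : ℝ → ℝ) (w r : ℝ → Space n → ℝ) (o : ℝ → Space n → Space n)
    (a b : ℝ → Space n → ℝ) (c : ℝ → Space n → Space n) (s : ℝ) (y : Space n) :
    Matrix (Fin n) (Fin n) ℝ :=
  Matrix.of fun i j => polarInner (f (r s y) ^ 2) (r s y)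
      (fderiv ℝ (a s) y (EuclideanSpace.single i 1)) (fderiv ℝ (b s) y (EuclideanSpace.single i 1))
      (fderiv ℝ (c s) y (EuclideanSpace.single i 1))
      (fderiv ℝ (w s) y (EuclideanSpace.single j 1)) (fderiv ℝ (r s) y (EuclideanSpace.single j 1))
      (fderiv ℝ (o s) y (EuclideanSpace.single j 1))
    + polarGamma (f (r s y) * deriv f (r s y)) (r s y)
      (fderiv ℝ (w s) y (EuclideanSpace.single i 1)) (fderiv ℝ (r s) y (EuclideanSpace.single i 1))
      (fderiv ℝ (o s) y (EuclideanSpace.single i 1)) (a s y) (b s y) (c s y)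
      (fderiv ℝ (w s) y (EuclideanSpace.single j 1)) (fderiv ℝ (r s) y (EuclideanSpace.single j 1))
      (fderiv ℝ (o s) y (EuclideanSpace.single j 1))

lemma RayConst.isHomogeneous {g : Space n → ℝ} (hg : RayConst g) : IsHomogeneous 0 g := by
  intro c hc y _
  simp [hg c hc y]

lemma RayConst.sum_coord_mul_hess {g : Space n → ℝ} (hg : RayConst g)
    (hs : ContDiffOn ℝ ∞ g {0}ᶜ) (i : Fin n) {x : Space n} (hx : x ≠ 0) :
    ∑ l, pderiv i (pderiv l g) x * x l = -pderiv i g x := by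
  have h := (hg.isHomogeneous.pderiv hs i).euler (contDiffOn_pderiv hs i) hx
  push_cast at h
  rw [show -pderiv i g x = -1 * pderiv i g x by ring, ← h]
  refine Finset.sum_congr rfl fun l _ => ?_
  rw [pderiv_comm hs i l hx, mul_comm]

/-- The derivative of θ on Σ is the tangential projection, so coordinate vectors enter projected.
The correction arises because the Hessian of a degree zero function sends x to minus the gradient at
x. -/
lemma RayConst.hess_projection {g : Space n → ℝ} (hg : RayConst g)
    (hs : ContDiffOn ℝ ∞ g {0}ᶜ) {x : Space n} (hx : x ≠ 0) (i j : Fin n) :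
    fderiv ℝ (fun y => fderiv ℝ g y (EuclideanSpace.single j 1 - x j • x)) x
      (EuclideanSpace.single i 1) = pderiv i (pderiv j g) x + x j * pderiv i g x := by
  rw [fderiv_fderiv_eq_sum hs hx]
  have h1 : ∀ k, (EuclideanSpace.single i (1 : ℝ) : Space n) k = if k = i then 1 else 0 := by
    intro k; simp
  have h2 : ∀ k, (EuclideanSpace.single j (1 : ℝ) - x j • x : Space n) k
      = (if k = j then 1 else 0) - x j * x k := by
    intro k; simp
  simp only [h1, h2, ite_mul, one_mul, zero_mul, Finset.sum_ite_eq', Finset.mem_univ, if_true]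
  have h3 : ∀ l, pderiv i (pderiv l g) x * ((if l = j then 1 else 0) - x j * x l)
      = (if l = j then pderiv i (pderiv l g) x else 0) - x j * (pderiv i (pderiv l g) x * x l) := by
    intro l
    by_cases hl : l = j <;> simp [hl] <;> ring
  simp only [h3, Finset.sum_sub_distrib, ← Finset.mul_sum, hg.sum_coord_mul_hess hs i hx]
  simp

lemma sum_mul_fderiv_single {W : Type*} [NormedAddCommGroup W] [NormedSpace ℝ W]
    {g : Space n → W} (hg : RayConst g) {x : Space n} (hd : DifferentiableAt ℝ g x) :
    ∑ j, x j • fderiv ℝ g x (EuclideanSpace.single j 1) = 0 := by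
  rw [← hg.fderiv_self hd]
  have h : fderiv ℝ g x x = fderiv ℝ g x (∑ j, x j • EuclideanSpace.single j (1 : ℝ)) := by
    rw [← eq_sum_single x]
  rw [h, map_sum]
  simp

namespace IsPolarVariation

variable {I : Set ℝ} {f rs : ℝ → ℝ} {w₀ : ℝ} {ρ : Space n → ℝ} {ε : ℝ}
  {F L Lb : ℝ → Space n → Event n} {w r : ℝ → Space n → ℝ} {o : ℝ → Space n → Space n}
  {a b : ℝ → Space n → ℝ} {c : ℝ → Space n → Space n}
  {a₂ b₂ : ℝ → Space n → ℝ} {c₂ : ℝ → Space n → Space n}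

lemma trChi_eq (H : IsPolarVariation I f rs w₀ ρ ε F L Lb w r o a b c a₂ b₂ c₂) {s : ℝ}
    (hs : s ∈ Ioo (-ε) ε) {x : Space n} (hx : ‖x‖ = 1) :
    trChi f (F s) (L s) x = ((polarGram f w r o s x)⁻¹ * polarChi f w r o a b c s x).trace := by
  have hx0 := ne_zero_of_norm_one hx
  have h1 : gramMatrix f (F s) x = polarGram f w r o s x := by
    ext i j
    simp only [gramMatrix, polarGram, Matrix.of_apply]
    rw [H.map.sphereDeriv_eq H.tortoise hs hx0, H.map.sphereDeriv_eq H.tortoise hs hx0,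
      H.map.metric_eq H.warp hs hx (H.map.inner_fderiv_o hs hx0 _) (H.map.inner_fderiv_o hs hx0 _)]
  have h2 : chiMatrix f (F s) (L s) x = polarChi f w r o a b c s x := by
    ext i j
    simp only [chiMatrix, polarChi, Matrix.of_apply]
    rw [H.map.sphereDeriv_eq H.tortoise hs hx0,
      H.fieldL.covInner_eq H.warp H.tortoise H.map hs hx _ (H.map.inner_fderiv_o hs hx0 _)]
  rw [trChi, h1, h2]

lemma smoothFam_warp (H : IsPolarVariation I f rs w₀ ρ ε F L Lb w r o a b c a₂ b₂ c₂) :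
    SmoothFam ε (fun s y => f (r s y) ^ 2) ∧
      SmoothFam ε (fun s y => f (r s y) * deriv f (r s y)) := by
  have hd : ContDiffOn ℝ ∞ (deriv f) I :=
    ((contDiffOn_infty_iff_deriv_of_isOpen H.warp.isOpen).1 H.warp.smooth).2
  have hm : MapsTo (fun q : ℝ × Space n => r q.1 q.2) (Ioo (-ε) ε ×ˢ {0}ᶜ) I :=
    fun q hq => H.map.mem q.1 hq.1 q.2 hq.2
  have h1 := H.warp.smooth.comp H.map.smooth_r hm
  exact ⟨h1.pow 2, h1.mul (hd.comp H.map.smooth_r hm)⟩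

lemma smoothFam_polarGram (H : IsPolarVariation I f rs w₀ ρ ε F L Lb w r o a b c a₂ b₂ c₂)
    (i j : Fin n) : SmoothFam ε (fun s y => polarGram f w r o s y i j) := by
  have hy : ∀ k : Fin n, ContDiffOn ℝ ∞ (fun q : ℝ × Space n => q.2 k) (Ioo (-ε) ε ×ˢ {0}ᶜ) :=
    fun k => (contDiffOn_coord k univ).comp contDiffOn_snd fun _ _ => mem_univ _
  exact ((hy i).mul (hy j)).add (contDiffOn_polarInner H.smoothFam_warp.1 H.map.smooth_r
    (H.map.smooth_w.fderiv _) (H.map.smooth_r.fderiv _) (H.map.smooth_o.fderiv _)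
    (H.map.smooth_w.fderiv _) (H.map.smooth_r.fderiv _) (H.map.smooth_o.fderiv _))

lemma smoothFam_polarChi (H : IsPolarVariation I f rs w₀ ρ ε F L Lb w r o a b c a₂ b₂ c₂)
    (i j : Fin n) : SmoothFam ε (fun s y => polarChi f w r o a b c s y i j) :=
  ContDiffOn.add (contDiffOn_polarInner H.smoothFam_warp.1 H.map.smooth_r
    (H.fieldL.smooth_a.fderiv _) (H.fieldL.smooth_b.fderiv _) (H.fieldL.smooth_c.fderiv _)
    (H.map.smooth_w.fderiv _) (H.map.smooth_r.fderiv _) (H.map.smooth_o.fderiv _))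
    (contDiffOn_polarGamma H.smoothFam_warp.2 H.map.smooth_r
    (H.map.smooth_w.fderiv _) (H.map.smooth_r.fderiv _) (H.map.smooth_o.fderiv _)
    H.fieldL.smooth_a H.fieldL.smooth_b H.fieldL.smooth_c
    (H.map.smooth_w.fderiv _) (H.map.smooth_r.fderiv _) (H.map.smooth_o.fderiv _))

lemma inner_projection {x : Space n} (hx : ‖x‖ = 1) (i j : Fin n) :
    inner ℝ (EuclideanSpace.single i 1 - x i • x) (EuclideanSpace.single j 1 - x j • x)
      = (if i = j then 1 else 0) - x i * x j := by
  rw [inner_sub_left, inner_sub_right, inner_sub_right, real_inner_smul_left, real_inner_smul_left,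
    real_inner_smul_right, real_inner_smul_right, real_inner_self_eq_norm_sq, hx,
    EuclideanSpace.inner_single_left, EuclideanSpace.inner_single_left,
    EuclideanSpace.inner_single_right]
  simp
  ring

/-- On the cone dw = 0, and dr occurs in the metric only multiplied by dw, so the slope of ρ leaves
no trace in the induced metric. -/
lemma polarGram_base (H : IsPolarVariation I f rs w₀ ρ ε F L Lb w r o a b c a₂ b₂ c₂)
    {x : Space n} (hx : ‖x‖ = 1) (i j : Fin n) :
    polarGram f w r o 0 x i j
      = x i * x j + radialExt ρ x ^ 2 * ((if i = j then 1 else 0) - x i * x j) := by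
  obtain ⟨er, eo, ew⟩ := H.base_map (ne_zero_of_norm_one hx)
  obtain ⟨dwi, dri, doi, -, -, -⟩ := H.eventually_base hx (EuclideanSpace.single i 1)
  obtain ⟨dwj, drj, doj, -, -, -⟩ := H.eventually_base hx (EuclideanSpace.single j 1)
  simp only [polarGram, Matrix.of_apply, polarInner, dwi, dwj, doi, doj, er,
    EuclideanSpace.inner_single_right]
  simp only [one_mul, conj_trivial, inner_projection hx]
  ring

lemma sum_polarGram_mul (H : IsPolarVariation I f rs w₀ ρ ε F L Lb w r o a b c a₂ b₂ c₂)
    {s : ℝ} (hs : s ∈ Ioo (-ε) ε) {x : Space n} (hx : ‖x‖ = 1) (i : Fin n) :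
    ∑ j, polarGram f w r o s x i j * x j = x i := by
  have hx0 := ne_zero_of_norm_one hx
  have h1 := sum_mul_fderiv_single (H.map.ray_w s)
    (differentiableAt_of_smooth (H.map.smooth_w.slice hs) hx0)
  have h2 := sum_mul_fderiv_single (H.map.ray_r s)
    (differentiableAt_of_smooth (H.map.smooth_r.slice hs) hx0)
  have h3 := sum_mul_fderiv_single (H.map.ray_o s)
    (differentiableAt_of_smooth (H.map.smooth_o.slice hs) hx0)
  simp only [smul_eq_mul] at h1 h2
  simp only [polarGram, Matrix.of_apply, add_mul, Finset.sum_add_distrib]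
  rw [sum_polarInner, h1, h2, h3]
  have h4 : ∑ j, x i * x j * x j = x i := by
    simp only [mul_assoc, ← Finset.mul_sum, sum_sq_of_norm_one hx, mul_one]
  rw [h4]
  simp [polarInner]

/-- For L = ρ ∂_r on the cone the second fundamental form χ equals the induced metric; the
difference is the rank one term that `polarGram` contains and `polarChi` does not. -/
lemma polarChi_sub_polarGram_base
    (H : IsPolarVariation I f rs w₀ ρ ε F L Lb w r o a b c a₂ b₂ c₂)
    {x : Space n} (hx : ‖x‖ = 1) (i j : Fin n) :
    polarChi f w r o a b c 0 x i j - polarGram f w r o 0 x i j = -(x i * x j) := by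
  have hx0 := ne_zero_of_norm_one hx
  obtain ⟨er, eo, ew⟩ := H.base_map hx0
  obtain ⟨ea, eb, ec⟩ := H.base_fieldL hx0
  obtain ⟨dwi, dri, doi, dai, dbi, dci⟩ := H.eventually_base hx (EuclideanSpace.single i 1)
  obtain ⟨dwj, drj, doj, -, -, -⟩ := H.eventually_base hx (EuclideanSpace.single j 1)
  simp only [polarChi, polarGram, Matrix.of_apply, polarInner, polarGamma, dwi, dwj, doi, doj,
    dri, drj, dai, dbi, dci, er, ea, eb, ec, inner_zero_left, inner_zero_right]
  ring

/-- The first three terms in the bracket form the Hessian of `dS w` on the sphere, extended by zero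
to the radial direction; the last is `dS b - dS r` times the round metric. The variation of the
difference suffices for tr χ, because χ is the induced metric on Σ. -/
lemma hasDerivAt_polarChi_sub_polarGram
    (H : IsPolarVariation I f rs w₀ ρ ε F L Lb w r o a b c a₂ b₂ c₂)
    (hρ : SphereSmooth ρ) {x : Space n} (hx : ‖x‖ = 1) (i j : Fin n) :
    HasDerivAt (fun s => polarChi f w r o a b c s x i j - polarGram f w r o s x i j)
      (radialExt ρ x * (pderiv i (pderiv j (dS w)) x + x i * pderiv j (dS w) x
        + x j * pderiv i (dS w) x
        + (dS b x - dS r x) * ((if i = j then 1 else 0) - x i * x j))) 0 := by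
  have hx0 := ne_zero_of_norm_one hx
  have hpos := H.radius_pos hx0
  have cw := H.map.smooth_w.contDiffOn_dS H.ε_pos
  have rw' : RayConst (dS w) := RayConst.dS H.map.ray_w
  obtain ⟨⟨Q', hQ⟩, P', hP⟩ := H.exists_hasDerivAt_warp hx
  obtain ⟨er, eo, ew⟩ := H.base_map hx0
  obtain ⟨ea, eb, ec⟩ := H.base_fieldL hx0
  set ei : Space n := EuclideanSpace.single i 1 with hei
  set ej : Space n := EuclideanSpace.single j 1 with hej
  have xi : inner ℝ x ei = x i := by rw [hei, EuclideanSpace.inner_single_right]; simp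
  have xj : inner ℝ x ej = x j := by rw [hej, EuclideanSpace.inner_single_right]; simp
  obtain ⟨dwi, dri, doi, dai, dbi, dci⟩ := H.eventually_base hx ei
  obtain ⟨dwj, drj, doj, -, -, -⟩ := H.eventually_base hx ej
  rw [xi] at doi
  rw [xj] at doj
  have hr' := H.map.smooth_r.hasDerivAt H.ε_pos hx0
  have hwf := fun X => H.map.smooth_w.hasDerivAt_fderiv H.ε_pos hx0 X
  have hrf := fun X => H.map.smooth_r.hasDerivAt_fderiv H.ε_pos hx0 X
  have hof := fun X => H.map.smooth_o.hasDerivAt_fderiv H.ε_pos hx0 X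
  have hD := ((hasDerivAt_polarInner hQ hr'
      (H.fieldL.smooth_a.hasDerivAt_fderiv H.ε_pos hx0 ei)
      (H.fieldL.smooth_b.hasDerivAt_fderiv H.ε_pos hx0 ei)
      (H.fieldL.smooth_c.hasDerivAt_fderiv H.ε_pos hx0 ei) (hwf ej) (hrf ej) (hof ej)).add
    (hasDerivAt_polarGamma hP hr' (hwf ei) (hrf ei) (hof ei)
      (H.fieldL.smooth_a.hasDerivAt H.ε_pos hx0) (H.fieldL.smooth_b.hasDerivAt H.ε_pos hx0)
      (H.fieldL.smooth_c.hasDerivAt H.ε_pos hx0) (hwf ej) (hrf ej) (hof ej))).sub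
    ((hasDerivAt_polarInner hQ hr' (hwf ei) (hrf ei) (hof ei) (hwf ej) (hrf ej) (hof ej)).const_add
      (x i * x j))
  refine HasDerivAt.congr_deriv (f := fun s => polarChi f w r o a b c s x i j
    - polarGram f w r o s x i j) hD ?_
  have da : fderiv ℝ (dS a) x ei = 0 := by
    have e : dS a =ᶠ[𝓝 x] fun _ => 0 := by
      refine eventuallyEq_of_forall_ne (fun y hy => ?_) hx0
      rw [← (RayConst.dS H.fieldL.ray_a).normalize hy]
      exact H.dS_a (norm_normalize hy)
    rw [e.fderiv_eq]; simp
  have hwx : fderiv ℝ (dS w) x x = 0 := rw'.fderiv_self (differentiableAt_of_smooth cw hx0)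
  have wproj : ∀ k : Fin n, fderiv ℝ (dS w) x (EuclideanSpace.single k 1 - x k • x)
      = pderiv k (dS w) x := by
    intro k
    rw [map_sub, map_smul, hwx, smul_zero, sub_zero]; rfl
  have hcj := H.inner_dS_c hx (ej - x j • x)
  have hci := H.inner_dS_c hx (ei - x i • x)
  rw [hej, wproj j] at hcj
  rw [hei, wproj i] at hci
  have hcc := H.inner_fderiv_dS_c hρ hx ei (ej - x j • x)
  rw [xi, hei, hej, rw'.hess_projection cw hx0, wproj j] at hcc
  have hPP := inner_projection hx i j
  have hcomm : inner ℝ (ei - x i • x) (dS c x) = inner ℝ (dS c x) (ei - x i • x) :=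
    real_inner_comm _ _
  simp only [er, ea, eb, ec, dwi, dwj, dri, drj, doi, doj, dai, dbi, dci, da, H.dS_a hx,
    inner_zero_left, inner_zero_right, hcomm]
  simp only [hei, hej] at hcc hPP hci hcj ⊢
  have e1 : ∀ k, fderiv ℝ (dS w) x (EuclideanSpace.single k 1) = pderiv k (dS w) x := fun k => rfl
  rw [hPP]
  simp only [e1]
  linear_combination radialExt ρ x * hcc
    - fderiv ℝ (radialExt ρ) x (EuclideanSpace.single j 1) * hci

/-- The first variation of `tr χ` on the unit sphere. -/
lemma hasDerivAt_trChi (H : IsPolarVariation I f rs w₀ ρ ε F L Lb w r o a b c a₂ b₂ c₂)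
    (hρ : SphereSmooth ρ) {x : Space n} (hx : ‖x‖ = 1) :
    HasDerivAt (fun s => trChi f (F s) (L s) x)
      ((radialExt ρ x)⁻¹ * (lap (dS w) x + ((n : ℝ) - 1) * (dS b x - dS r x))) 0 := by
  have hx0 := ne_zero_of_norm_one hx
  have hpos := H.radius_pos hx0
  have cw := H.map.smooth_w.contDiffOn_dS H.ε_pos
  have rw' : RayConst (dS w) := RayConst.dS H.map.ray_w
  have heu : ∑ i, x i * pderiv i (dS w) x = 0 := by
    simpa using rw'.isHomogeneous.euler cw hx0
  have e : (fun s => trChi f (F s) (L s) x) =ᶠ[𝓝 0]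
      fun s => ((polarGram f w r o s x)⁻¹ * polarChi f w r o a b c s x).trace := by
    filter_upwards [isOpen_Ioo.mem_nhds H.zero_mem] with s hs using H.trChi_eq hs hx
  have hsm : ∀ i j, ContDiffAt ℝ 1 (fun s => polarGram f w r o s x i j) 0 := by
    intro i j
    have h : ContDiffAt ℝ 1 (fun q : ℝ × Space n => polarGram f w r o q.1 q.2 i j) (0, x) :=
      ((H.smoothFam_polarGram i j).contDiffAt H.zero_mem hx0).of_le
      (le_trans (by norm_num) two_le_smooth)
    exact h.comp (f := fun s : ℝ => (s, x)) (0 : ℝ) (contDiff_prodMk_left x).contDiffAt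
  have h := hasDerivAt_trace_inv_mul hx hpos.ne' hsm (H.polarGram_base hx)
    (by filter_upwards [isOpen_Ioo.mem_nhds H.zero_mem] with s hs using
      fun i => H.sum_polarGram_mul hs hx i)
    (H.hasDerivAt_polarChi_sub_polarGram hρ hx) (H.polarChi_sub_polarGram_base hx) (by
      have hi : ∀ i, ∑ j, x i * x j * (radialExt ρ x * (pderiv j (pderiv i (dS w)) x
          + x j * pderiv i (dS w) x + x i * pderiv j (dS w) x
          + (dS b x - dS r x) * ((if j = i then 1 else 0) - x j * x i))) = 0 := by
        intro i
        have hE : ∑ j, x j * pderiv j (pderiv i (dS w)) x = -pderiv i (dS w) x := by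
          rw [← rw'.sum_coord_mul_hess cw i hx0]
          refine Finset.sum_congr rfl fun l _ => ?_
          rw [pderiv_comm cw i l hx0, mul_comm]
        have hj : ∀ j, x i * x j * (radialExt ρ x * (pderiv j (pderiv i (dS w)) x
            + x j * pderiv i (dS w) x + x i * pderiv j (dS w) x
            + (dS b x - dS r x) * ((if j = i then 1 else 0) - x j * x i)))
            = x i * radialExt ρ x * (x j * pderiv j (pderiv i (dS w)) x)
              + x i * radialExt ρ x * pderiv i (dS w) x * (x j * x j)
              + x i * radialExt ρ x * x i * (x j * pderiv j (dS w) x)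
              + x i * radialExt ρ x * (dS b x - dS r x) * (if j = i then x j else 0)
              - x i * radialExt ρ x * (dS b x - dS r x) * x i * (x j * x j) := by
          intro j
          by_cases hji : j = i <;> simp [hji] <;> ring
        simp only [hj, Finset.sum_add_distrib, Finset.sum_sub_distrib, ← Finset.mul_sum, hE, heu,
          sum_sq_of_norm_one hx, Finset.sum_ite_eq', Finset.mem_univ, if_true]
        ring
      exact Finset.sum_eq_zero fun i _ => hi i)
  refine (h.congr_of_eventuallyEq e).congr_deriv ?_
  have hi : ∀ i, radialExt ρ x * (pderiv i (pderiv i (dS w)) x + x i * pderiv i (dS w) x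
        + x i * pderiv i (dS w) x + (dS b x - dS r x) * ((if i = i then 1 else 0) - x i * x i))
      = radialExt ρ x * pderiv i (pderiv i (dS w)) x
        + 2 * radialExt ρ x * (x i * pderiv i (dS w) x)
        + radialExt ρ x * (dS b x - dS r x)
        - radialExt ρ x * (dS b x - dS r x) * (x i * x i) := by
    intro i; simp; ring
  rw [Finset.sum_congr rfl fun i _ => hi i]
  simp only [Finset.sum_add_distrib, Finset.sum_sub_distrib, ← Finset.mul_sum, heu,
    sum_sq_of_norm_one hx]
  simp only [lap, Finset.sum_const, Finset.card_univ, Fintype.card_fin, nsmul_eq_mul]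
  field_simp
  ring

/-- The linearization of `∂_X tr χ = 0`. -/
theorem trChi_linearized (H : IsPolarVariation I f rs w₀ ρ ε F L Lb w r o a b c a₂ b₂ c₂)
    (hρ : SphereSmooth ρ) {x X : Space n} (hx : ‖x‖ = 1) (hX : inner ℝ x X = 0)
    (htr : deriv (fun s => sphereDeriv (trChi f (F s) (L s)) x X) 0 = 0) :
    radialExt ρ x * (fderiv ℝ (lap (dS w)) x X
        + ((n : ℝ) - 1) * (fderiv ℝ (dS b) x X - fderiv ℝ (dS r) x X))
      - fderiv ℝ (radialExt ρ) x X * (lap (dS w) x + ((n : ℝ) - 1) * (dS b x - dS r x)) = 0 := by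
  have hx0 := ne_zero_of_norm_one hx
  have hpos := H.radius_pos hx0
  have cw := H.map.smooth_w.contDiffOn_dS H.ε_pos
  have rw' : RayConst (dS w) := RayConst.dS H.map.ray_w
  have hl : IsHomogeneous (-2) (lap (dS w)) := IsHomogeneous.sum fun i _ =>
    (rw'.isHomogeneous.pderiv cw i).pderiv (contDiffOn_pderiv cw i) i
  set τ : ℝ → Space n → ℝ := fun s => radialExt (trChi f (F s) (L s)) with hτ
  -- Joint C² regularity at (0, x) allows the derivatives in s and along X to be exchanged, so that
  -- the hypothesis becomes a statement about the first variation of tr χ.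
  have hC : ContDiffAt ℝ 2 (fun q : ℝ × Space n => τ q.1 q.2) (0, x) := by
    have e : (fun q : ℝ × Space n => τ q.1 q.2) =ᶠ[𝓝 ((0 : ℝ), x)] fun q =>
        ((polarGram f w r o q.1 (‖q.2‖⁻¹ • q.2))⁻¹
          * polarChi f w r o a b c q.1 (‖q.2‖⁻¹ • q.2)).trace := by
      filter_upwards [(isOpen_famDomain ε).mem_nhds (show ((0 : ℝ), x) ∈ _ from ⟨H.zero_mem, hx0⟩)]
        with q hq
      exact H.trChi_eq hq.1 (norm_normalize hq.2)
    refine ContDiffAt.congr_of_eventuallyEq ?_ e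
    refine contDiffAt_trace_inv_mul
      (fun i j => ((H.smoothFam_polarGram i j).normalize.contDiffAt H.zero_mem hx0).of_le
        two_le_smooth)
      (fun i j => ((H.smoothFam_polarChi i j).normalize.contDiffAt H.zero_mem hx0).of_le
        two_le_smooth) ?_
    simp only [hx, inv_one, one_smul]
    exact (inv_sphereMatrix hx hpos.ne' (H.polarGram_base hx)).1
  have h0 : fderiv ℝ (dS τ) x X = 0 := by
    rw [← (hasDerivAt_fderiv_slice hC X).deriv]
    exact htr
  -- `lap (dS w)` has degree -2, and the factor |y|² makes its restriction to the unit sphere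
  -- constant along rays. Tangential derivatives do not see this factor.
  have e : dS τ =ᶠ[𝓝 x] fun y => (‖y‖ ^ 2 * lap (dS w) y + ((n : ℝ) - 1) * (dS b y - dS r y))
      / radialExt ρ y := by
    refine eventuallyEq_of_forall_ne (fun y hy => ?_) hx0
    have h := (H.hasDerivAt_trChi hρ (norm_normalize hy)).deriv
    have hn := norm_pos_iff.2 hy
    rw [(RayConst.dS H.fieldL.ray_b).normalize hy, (RayConst.dS H.map.ray_r).normalize hy,
      rayConst_radialExt ρ (inv_pos.2 hn), hl _ (inv_pos.2 hn) y hy] at h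
    change deriv (fun s => trChi f (F s) (L s) (‖y‖⁻¹ • y)) 0 = _
    rw [h]
    simp
    ring
  have hR := (differentiableAt_of_smooth hρ hx0).hasFDerivAt
  have hb := (differentiableAt_of_smooth (H.fieldL.smooth_b.contDiffOn_dS H.ε_pos) hx0).hasFDerivAt
  have hr := (differentiableAt_of_smooth (H.map.smooth_r.contDiffOn_dS H.ε_pos) hx0).hasFDerivAt
  have hlp := (differentiableAt_of_smooth (contDiffOn_lap cw) hx0).hasFDerivAt
  have hN := (differentiableAt_of_smooth contDiffOn_norm' hx0).hasFDerivAt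
  have hD : HasFDerivAt (fun y => (‖y‖ ^ 2 * lap (dS w) y
      + ((n : ℝ) - 1) * (dS b y - dS r y)) / radialExt ρ y) _ x :=
    hasFDerivAt_fun_div (((hN.pow 2).mul hlp).add ((hb.sub hr).const_mul ((n : ℝ) - 1))) hR hpos.ne'
  rw [e.fderiv_eq, hD.fderiv] at h0
  simp [hx, fderiv_norm_apply hx0, hX] at h0
  field_simp at h0
  linear_combination h0

end IsPolarVariation

end

section
variable {n : ℕ}

/-! ### The degree one extension -/

lemma pderiv_norm_mul {u : Space n → ℝ} (hu : ContDiffOn ℝ ∞ u {0}ᶜ) (j : Fin n) {y : Space n}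
    (hy : y ≠ 0) :
    pderiv j (fun z => ‖z‖ * u z) y = y j * ‖y‖⁻¹ * u y + ‖y‖ * pderiv j u y := by
  rw [pderiv_mul j (differentiableAt_of_smooth contDiffOn_norm' hy)
    (differentiableAt_of_smooth hu hy), pderiv_norm j hy]
  ring

lemma pderiv_pderiv_norm_mul {u : Space n → ℝ} (hu : ContDiffOn ℝ ∞ u {0}ᶜ) (i j : Fin n)
    {x : Space n} (hx : ‖x‖ = 1) :
    pderiv i (pderiv j (fun z => ‖z‖ * u z)) x = pderiv i (pderiv j u) x
      + (if i = j then u x else 0) - x i * x j * u x + x j * pderiv i u x + x i * pderiv j u x := by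
  have hx0 := ne_zero_of_norm_one hx
  have d : ∀ {g : Space n → ℝ}, ContDiffOn ℝ ∞ g {0}ᶜ → DifferentiableAt ℝ g x :=
    fun hg => differentiableAt_of_smooth hg hx0
  have cN := contDiffOn_norm' (n := n)
  have cNi := contDiffOn_norm_inv (n := n)
  have cj := contDiffOn_coord j ({0}ᶜ : Set (Space n))
  rw [pderiv_congr i (eventuallyEq_of_forall_ne (fun y hy => pderiv_norm_mul hu j hy) hx0),
    pderiv_add i (d ((cj.mul cNi).mul hu)) (d (cN.mul (contDiffOn_pderiv hu j))),
    pderiv_mul i (d (cj.mul cNi)) (d hu), pderiv_mul i (d cj) (d cNi),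
    pderiv_mul i (d cN) (d (contDiffOn_pderiv hu j)), pderiv_coord, pderiv_norm_inv i hx0,
    pderiv_norm i hx0, hx]
  by_cases hij : i = j <;> simp [hij] <;> ring

/-- Both sides have degree -1, so unit vectors suffice. The zeroth order term is u times the
Laplacian of |y|; the cross terms vanish because u has no radial derivative. -/
lemma lap_norm_mul {u : Space n → ℝ} (hu : ContDiffOn ℝ ∞ u {0}ᶜ) (hr : RayConst u)
    {y : Space n} (hy : y ≠ 0) :
    lap (fun z => ‖z‖ * u z) y = ‖y‖ * lap u y + ((n : ℝ) - 1) * (‖y‖⁻¹ * u y) := by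
  have hh := hr.isHomogeneous
  have cv : ContDiffOn ℝ ∞ (fun z => ‖z‖ * u z) {0}ᶜ := contDiffOn_norm'.mul hu
  have hv : IsHomogeneous 1 (fun z => ‖z‖ * u z) := isHomogeneous_norm.mul hh
  have h1 : IsHomogeneous (-1) (lap (fun z => ‖z‖ * u z)) := IsHomogeneous.sum fun i _ =>
    (hv.pderiv cv i).pderiv (contDiffOn_pderiv cv i) i
  have hl : IsHomogeneous (-2) (lap u) := IsHomogeneous.sum fun i _ =>
    (hh.pderiv hu i).pderiv (contDiffOn_pderiv hu i) i
  have h2 : IsHomogeneous (-1) (fun y => ‖y‖ * lap u y) :=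
    isHomogeneous_norm.mul hl
  have h3 : IsHomogeneous (-1) (fun y => ((n : ℝ) - 1) * (‖y‖⁻¹ * u y)) :=
    (IsHomogeneous.const ((n : ℝ) - 1)).mul (isHomogeneous_norm_inv.mul hh)
  have h := ((h1.sub h2).sub h3).eq_zero (fun x hx => by
    have heu : ∑ i, x i * pderiv i u x = 0 := by
      simpa using hh.euler hu (ne_zero_of_norm_one hx)
    have hi : ∀ i, pderiv i (pderiv i (fun z => ‖z‖ * u z)) x = pderiv i (pderiv i u) x + u x
        - u x * (x i * x i) + 2 * (x i * pderiv i u x) := by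
      intro i
      rw [pderiv_pderiv_norm_mul hu i i hx]
      simp; ring
    unfold lap
    simp only [hi, Finset.sum_add_distrib, Finset.sum_sub_distrib, ← Finset.mul_sum, heu,
      sum_sq_of_norm_one hx, hx, Finset.sum_const, Finset.card_univ, Fintype.card_fin,
      nsmul_eq_mul]
    ring) hy
  linarith

lemma sum_mul_pderiv_eq {g : Space n → ℝ} (x X : Space n) :
    ∑ i, X i * pderiv i g x = fderiv ℝ g x X := (fderiv_eq_sum_pderiv g x X).symm

lemma sum_coord_mul_eq_inner (x X : Space n) : ∑ i, X i * x i = inner ℝ x X := by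
  rw [PiLp.inner_apply]
  exact Finset.sum_congr rfl fun i _ => by simp

/-- The equation for `u` of degree zero implies the equation for `‖y‖ u` of degree one. -/
lemma linearized_equation_norm_mul {u R : Space n → ℝ} (hn : 3 ≤ n)
    (hu : ContDiffOn ℝ ∞ u {0}ᶜ) (hur : RayConst u) (hR : ContDiffOn ℝ ∞ R {0}ᶜ)
    (hRr : RayConst R) {x X : Space n} (hx : ‖x‖ = 1) (hX : inner ℝ x X = 0) {K : ℝ}
    (h : ∑ i, X i * ∑ j, pderiv i (pderiv j u) x * pderiv j R x
      = ((n : ℝ) - 1)⁻¹ * (lap u x * fderiv ℝ R x X - R x * fderiv ℝ (lap u) x X)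
        + K * fderiv ℝ u x X) :
    ∑ i, X i * ∑ j, pderiv i (pderiv j fun z => ‖z‖ * u z) x * pderiv j R x
      = ((n : ℝ) - 1)⁻¹ * (lap (fun z => ‖z‖ * u z) x * ∑ i, X i * pderiv i R x
          - R x * ∑ i, X i * pderiv i (lap fun z => ‖z‖ * u z) x)
        + (K + R x) * ∑ i, X i * pderiv i (fun z => ‖z‖ * u z) x := by
  have hx0 := ne_zero_of_norm_one hx
  have hm : (n : ℝ) - 1 ≠ 0 := by
    have : (3 : ℝ) ≤ n := by exact_mod_cast hn
    linarith
  have hRx : ∑ j, x j * pderiv j R x = 0 := by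
    simpa using hRr.isHomogeneous.euler hR hx0
  have hXx : ∑ i, X i * x i = 0 := by rw [sum_coord_mul_eq_inner, hX]
  have hRX := sum_mul_pderiv_eq (g := R) x X
  have huX := sum_mul_pderiv_eq (g := u) x X
  have hv1 : ∑ i, X i * pderiv i (fun z => ‖z‖ * u z) x = fderiv ℝ u x X := by
    have hi : ∀ i, X i * pderiv i (fun z => ‖z‖ * u z) x
        = u x * (X i * x i) + X i * pderiv i u x := by
      intro i; rw [pderiv_norm_mul hu i hx0, hx]; ring
    simp only [hi, Finset.sum_add_distrib, ← Finset.mul_sum, hXx, huX]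
    ring
  have hl1 : ∑ i, X i * pderiv i (lap fun z => ‖z‖ * u z) x
      = fderiv ℝ (lap u) x X + ((n : ℝ) - 1) * fderiv ℝ u x X := by
    rw [sum_mul_pderiv_eq,
      (eventuallyEq_of_forall_ne (fun y hy => lap_norm_mul hu hur hy) hx0).fderiv_eq]
    have dN := (differentiableAt_of_smooth contDiffOn_norm' hx0).hasFDerivAt
    have dNi : HasFDerivAt (fun y : Space n => ‖y‖⁻¹) _ x :=
      (hasDerivAt_inv (norm_ne_zero_iff.2 hx0)).comp_hasFDerivAt x dN
    have du := (differentiableAt_of_smooth hu hx0).hasFDerivAt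
    have dl := (differentiableAt_of_smooth (contDiffOn_lap hu) hx0).hasFDerivAt
    have hD : HasFDerivAt (fun y => ‖y‖ * lap u y + ((n : ℝ) - 1) * (‖y‖⁻¹ * u y)) _ x :=
      (dN.mul dl).add ((dNi.mul du).const_mul ((n : ℝ) - 1))
    rw [hD.fderiv]
    simp [hx, fderiv_norm_apply hx0, hX]
  have hS : ∑ i, X i * ∑ j, pderiv i (pderiv j fun z => ‖z‖ * u z) x * pderiv j R x
      = (∑ i, X i * ∑ j, pderiv i (pderiv j u) x * pderiv j R x) + u x * fderiv ℝ R x X := by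
    have hi : ∀ i, X i * ∑ j, pderiv i (pderiv j fun z => ‖z‖ * u z) x * pderiv j R x
        = X i * ∑ j, pderiv i (pderiv j u) x * pderiv j R x + u x * (X i * pderiv i R x)
          + X i * x i * ∑ j, pderiv j u x * pderiv j R x := by
      intro i
      have hj : ∀ j, pderiv i (pderiv j fun z => ‖z‖ * u z) x * pderiv j R x
          = pderiv i (pderiv j u) x * pderiv j R x + (if i = j then u x * pderiv j R x else 0)
            + (pderiv i u x - x i * u x) * (x j * pderiv j R x)
            + x i * (pderiv j u x * pderiv j R x) := by
        intro j
        rw [pderiv_pderiv_norm_mul hu i j hx]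
        by_cases hij : i = j <;> simp [hij] <;> ring
      simp only [hj, Finset.sum_add_distrib, ← Finset.mul_sum, hRx]
      simp only [Finset.sum_ite_eq, Finset.mem_univ, if_true]
      ring
    simp only [hi, Finset.sum_add_distrib, ← Finset.mul_sum, ← Finset.sum_mul, hXx, hRX]
    ring
  -- Passing to degree one adds u Xρ on the left. On the right the extra (n-1) u in the Laplacian
  -- adds u Xρ - ρ Xu, and the last term is compensated by replacing K with K + ρ.
  rw [hS, h, hRX, hv1, hl1, lap_norm_mul hu hur hx0, hx]
  field_simp
  ring

/-- If `k` does not vanish identically on the sphere and the tangential part of `a` vanishes where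
`k` does not, then `a = 0`. -/
lemma eq_zero_of_tangential (hn : 3 ≤ n) {k : Space n → ℝ} {a : Fin n → ℝ}
    (hk : ∀ x, ‖x‖ = 1 → k x * ∑ j, (a j - (∑ i, a i * x i) * x j) ^ 2 = 0) (hray : RayConst k)
    {x₀ : Space n} (hx₀ : ‖x₀‖ = 1) (hcont : ContinuousAt k x₀) (hne : k x₀ ≠ 0) : a = 0 := by
  have hpar : ∀ y : Space n, y ≠ 0 → k y ≠ 0 → ∃ μ : ℝ, ∀ j, a j = μ * y j := by
    intro y hy hky
    have h := hk _ (norm_normalize hy)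
    rw [hray.normalize hy] at h
    have h2 := (mul_eq_zero.1 h).resolve_left hky
    rw [Finset.sum_eq_zero_iff_of_nonneg fun j _ => sq_nonneg _] at h2
    refine ⟨(∑ i, a i * (‖y‖⁻¹ • y) i) * ‖y‖⁻¹, fun j => ?_⟩
    have h3 := pow_eq_zero_iff (two_ne_zero) |>.1 (h2 j (Finset.mem_univ _))
    have h4 : (‖y‖⁻¹ • y) j = ‖y‖⁻¹ * y j := by simp
    rw [h4] at h3
    linarith
  have hx0 := ne_zero_of_norm_one hx₀
  -- A direction transverse to x₀, available because the dimension exceeds one.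
  obtain ⟨e, he, he0⟩ : ∃ e ∈ (Submodule.span ℝ {x₀})ᗮ, e ≠ 0 := by
    apply Submodule.exists_mem_ne_zero_of_ne_bot
    intro hb
    rw [Submodule.orthogonal_eq_bot_iff] at hb
    have h1 := finrank_span_singleton (K := ℝ) hx0
    rw [hb, finrank_top, finrank_euclideanSpace_fin] at h1
    omega
  have hexe : inner ℝ x₀ e = 0 := Submodule.mem_orthogonal_singleton_iff_inner_right.1 he
  have hc : Tendsto (fun t : ℝ => x₀ + t • e) (𝓝 0) (𝓝 x₀) := by
    have : Continuous fun t : ℝ => x₀ + t • e := by fun_prop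
    simpa using this.tendsto 0
  -- By continuity k is nonzero at some point x₀ + t e off the line of x₀. Then a is a multiple of
  -- two independent vectors, hence zero.
  have hev : ∀ᶠ t : ℝ in 𝓝[≠] 0, k (x₀ + t • e) ≠ 0 ∧ x₀ + t • e ≠ 0 ∧ t ≠ 0 := by
    have h1 := hc.eventually (hcont.eventually_ne hne)
    have h2 := hc.eventually_ne hx0
    filter_upwards [nhdsWithin_le_nhds h1, nhdsWithin_le_nhds h2, self_mem_nhdsWithin]
      with t ht1 ht2 ht3 using ⟨ht1, ht2, ht3⟩
  obtain ⟨t, ht1, ht2, ht3⟩ := hev.exists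
  obtain ⟨μ, hμ⟩ := hpar _ ht2 ht1
  obtain ⟨lam, hlam⟩ := hpar x₀ hx0 hne
  have hvec : lam • x₀ = μ • (x₀ + t • e) := by
    ext j
    have := (hlam j).symm.trans (hμ j)
    simpa [mul_add] using this
  have hin := congrArg (fun z => inner ℝ e z) hvec
  simp only [inner_smul_right, inner_add_right, real_inner_comm x₀ e, hexe] at hin
  have hee : inner ℝ e e ≠ 0 := inner_self_ne_zero.2 he0
  have hμ0 : μ = 0 := by
    have : μ * (t * inner ℝ e e) = 0 := by linarith
    rcases mul_eq_zero.1 this with h | h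
    · exact h
    · exact absurd h (mul_ne_zero ht3 hee)
  funext j
  rw [hμ j, hμ0]
  simp

end

section
variable {n : ℕ}

/-- The defect in the differential inequality for the warping factor, along the cone graph. -/
def warpDefect (f : ℝ → ℝ) (ρ : Space n → ℝ) (y : Space n) : ℝ :=
  radialExt ρ y ^ 2 * (f (radialExt ρ y) * deriv f (radialExt ρ y)
    - f (radialExt ρ y) ^ 2 / radialExt ρ y) + radialExt ρ y

lemma rayConst_warpDefect (f : ℝ → ℝ) (ρ : Space n → ℝ) : RayConst (warpDefect f ρ) :=
  fun c hc y => by simp only [warpDefect, rayConst_radialExt ρ hc]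

/-- This is the link with the differential inequality: the defect is nonnegative along Σ, and it
vanishes exactly where equality holds. -/
lemma warpDefect_eq {f : ℝ → ℝ} {ρ : Space n → ℝ} {x : Space n} (hx : ‖x‖ = 1) (hpos : 0 < ρ x) :
    warpDefect f ρ x
      = -(ρ x ^ 3 * ((f (ρ x) ^ 2 - 1) / ρ x ^ 2 - f (ρ x) * deriv f (ρ x) / ρ x)) := by
  simp only [warpDefect, radialExt_of_norm_one ρ hx]
  field_simp
  ring

lemma continuousAt_warpDefect {I : Set ℝ} {f : ℝ → ℝ} (hf : IsWarpingFactor I f)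
    {ρ : Space n → ℝ} (hρ : SphereSmooth ρ) (hρI : ∀ x, ‖x‖ = 1 → ρ x ∈ I)
    {x : Space n} (hx : x ≠ 0) : ContinuousAt (warpDefect f ρ) x := by
  have hmem : radialExt ρ x ∈ I := hρI _ (norm_normalize hx)
  have hR : ContinuousAt (radialExt ρ) x := (differentiableAt_of_smooth hρ hx).continuousAt
  have hd : ContDiffOn ℝ ∞ (deriv f) I :=
    ((contDiffOn_infty_iff_deriv_of_isOpen hf.isOpen).1 hf.smooth).2
  have h1 : ContinuousAt (fun y => f (radialExt ρ y)) x :=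
    ContinuousAt.comp (hf.hasDerivAt hmem).continuousAt hR
  have h2 : ContinuousAt (fun y => deriv f (radialExt ρ y)) x :=
    ContinuousAt.comp (g := deriv f)
      (hd.contDiffAt (hf.isOpen.mem_nhds hmem)).continuousAt hR
  exact ((hR.pow 2).mul ((h1.mul h2).sub ((h1.pow 2).div₀ hR (hf.radius_pos hmem).ne'))).add hR

section
variable {I : Set ℝ} {f rs : ℝ → ℝ} {w₀ : ℝ} {ρ : Space n → ℝ} {ε : ℝ}
  {F L Lb : ℝ → Space n → Event n} {w r : ℝ → Space n → ℝ} {o : ℝ → Space n → Space n}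
  {a b : ℝ → Space n → ℝ} {c : ℝ → Space n → Space n}
  {a₂ b₂ : ℝ → Space n → ℝ} {c₂ : ℝ → Space n → Space n}

/-- The variation of `t - r*` is supported in the modes `ℓ ≤ 1`, and is constant where the
differential inequality is strict. -/
theorem IsPolarVariation.exists_lowModes
    (H : IsPolarVariation I f rs w₀ ρ ε F L Lb w r o a b c a₂ b₂ c₂) (hn : 3 ≤ n)
    (hρ : SphereSmooth ρ) (hP : PreservesCNNC f F L Lb) :
    ∃ (α₀ : ℝ) (α : Fin n → ℝ), (∀ x, ‖x‖ = 1 → dS w x = α₀ + ∑ i, α i * x i) ∧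
      ∀ x, ‖x‖ = 1 → warpDefect f ρ x * ∑ j, (α j - (∑ i, α i * x i) * x j) ^ 2 = 0 := by
  have cw := H.map.smooth_w.contDiffOn_dS H.ε_pos
  have rayw : RayConst (dS w) := RayConst.dS H.map.ray_w
  have rayρ : RayConst (radialExt ρ) := fun c hc y => rayConst_radialExt ρ hc y
  have hm : (n : ℝ) - 1 ≠ 0 := by
    have : (3 : ℝ) ≤ n := by exact_mod_cast hn
    linarith
  obtain ⟨α₀, α, h1, h2⟩ := exists_lowModes_of_linearized_equation hn
    (v := fun z => ‖z‖ * dS w z) (k := warpDefect f ρ) hρ rayρ.isHomogeneous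
    (fun y hy => H.radius_pos hy) (contDiffOn_norm'.mul cw)
    (isHomogeneous_norm.mul rayw.isHomogeneous)
    (fun x hx => by
      have hmem := H.base_mem x hx
      have hpos : 0 < ρ x := H.warp.radius_pos hmem
      rw [warpDefect_eq hx hpos]
      exact neg_nonneg.2
        (mul_nonpos_of_nonneg_of_nonpos (pow_pos hpos 3).le (H.warp.inequality _ hmem)))
    (fun x X hx hX => by
      refine linearized_equation_norm_mul hn cw rayw hρ rayρ hx hX ?_
      have ht := H.torsion_linearized hρ hx hX (hP x X hx hX).2
      have hc := H.trChi_linearized hρ hx hX (hP x X hx hX).1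
      field_simp
      field_simp at ht
      -- The unknown `dS b - dS r` enters both equations through the same expression, up to the
      -- factor n - 1, so this combination removes it.
      linear_combination -((n : ℝ) - 1) * ht + hc)
  exact ⟨α₀, α, fun x hx => by rw [← h1 x hx, hx, one_mul], h2⟩

end

/-- Values of ξ are unit vectors, where a map and its radial extension agree; so the composite of
the radial extensions is the radial extension of the composite. -/
lemma SphereSmoothFamily.comp_varMap {W : Type*} [NormedAddCommGroup W] [NormedSpace ℝ W]
    {δ ε : ℝ} {g : ℝ → Space n → W} {T : ℝ → Space n → ℝ} {ξ : ℝ → Space n → Space n}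
    (hg : SphereSmoothFamily (Ioo (-δ) δ) g) (hT : SphereSmoothFamily (Ioo (-ε) ε) T)
    (hξ : SphereSmoothFamily (Ioo (-ε) ε) ξ)
    (T_mem : ∀ s ∈ Ioo (-ε) ε, ∀ x, ‖x‖ = 1 → T s x ∈ Ioo (-δ) δ)
    (norm_ξ : ∀ s ∈ Ioo (-ε) ε, ∀ x, ‖x‖ = 1 → ‖ξ s x‖ = 1) :
    SphereSmoothFamily (Ioo (-ε) ε) (fun s x => g (T s x) (ξ s x)) := by
  have hn : ∀ q ∈ Ioo (-ε) ε ×ˢ ({0}ᶜ : Set (Space n)), ‖radialExt (ξ q.1) q.2‖ = 1 :=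
    fun q hq => norm_ξ q.1 hq.1 _ (norm_normalize hq.2)
  refine (ContDiffOn.comp hg (hT.prodMk hξ) fun q hq =>
    ⟨T_mem q.1 hq.1 _ (norm_normalize hq.2), ne_zero_of_norm_one (hn q hq)⟩).congr fun q hq => ?_
  exact (radialExt_of_norm_one (g (radialExt (T q.1) q.2)) (hn q hq)).symm

lemma SphereSmoothFamily.deriv {W : Type*} [NormedAddCommGroup W] [NormedSpace ℝ W]
    {δ : ℝ} {g : ℝ → Space n → W} (hg : SphereSmoothFamily (Ioo (-δ) δ) g) :
    SphereSmoothFamily (Ioo (-δ) δ) (fun τ x => deriv (fun τ' => g τ' x) τ) :=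
  SmoothFam.deriv (g := fun τ => radialExt (g τ)) hg

theorem infinitesimallyRigid (hn : 3 ≤ n) {I : Set ℝ} {f : ℝ → ℝ} (hf : IsWarpingFactor I f)
    {rs : ℝ → ℝ} (hrs : ∀ r ∈ I, HasDerivAt rs (1 / f r ^ 2) r) (w₀ : ℝ) {ρ : Space n → ℝ}
    (hρ : SphereSmooth ρ) (hρI : ∀ x, ‖x‖ = 1 → ρ x ∈ I) :
    InfinitesimallyRigid I f rs w₀ ρ := by
  rintro U ⟨δ, Φ, ε, T, ξ, ψ, L, hΦ, hV, hP⟩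
  have hF : SphereSmoothFamily (Ioo (-ε) ε) (varMap Φ T ξ) :=
    hΦ.smooth.comp_varMap hV.smooth_T hV.smooth_ξ hV.T_mem hV.norm_ξ
  have hLb : SphereSmoothFamily (Ioo (-ε) ε) (varLbar Φ T ξ ψ) :=
    ContDiffOn.smul hV.smooth_ψ
      (hΦ.smooth.deriv.comp_varMap hV.smooth_T hV.smooth_ξ hV.T_mem hV.norm_ξ)
  have hreg : ∀ s ∈ Ioo (-ε) ε, ∀ x, ‖x‖ = 1 → varMap Φ T ξ s x ∈ region n I :=
    fun s hs x hx => hΦ.mem_region _ (hV.T_mem s hs x hx) _ (hV.norm_ξ s hs x hx)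
  have hF0 : ∀ x, ‖x‖ = 1 → varMap Φ T ξ 0 x = coneGraph rs w₀ ρ x := fun x hx => by
    rw [varMap, hV.T_zero x hx, hV.ξ_zero x hx, hΦ.initial x hx]
  have H := IsPolarVariation.mk (w₀ := w₀) hf hrs hV.ε_pos (exists_isPolarMap hf hrs hF hreg)
    (exists_isPolarField hf hF hV.smooth_L hreg) (exists_isPolarField hf hF hLb hreg)
    hV.frame hρI hF0 hV.L_zero
  obtain ⟨α₀, α, hα, hdef⟩ := H.exists_lowModes hn hρ hP
  have hpos : ∀ x, ‖x‖ = 1 → 0 < ρ x := fun x hx => hf.radius_pos (hρI x hx)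
  have hU : ∀ x, ‖x‖ = 1 → U x = ρ x * (α₀ / 2 + ∑ i, α i / 2 * x i) := by
    intro x hx
    have h0 : (0 : ℝ) ∈ Ioo (-ε) ε := H.zero_mem
    have hmem : ‖(varMap Φ T ξ 0 x).2‖ ∈ I := hreg 0 h0 x hx
    obtain ⟨N, hN, hNA⟩ := hasFDerivAt_norm_snd (norm_ne_zero_iff.1 (hf.radius_pos hmem).ne')
    have hv := hV.velocity x hx
    have hv1 : HasDerivAt (fun s => (varMap Φ T ξ s x).1) _ 0 :=
      (hasFDerivAt_fst (𝕜 := ℝ)).comp_hasDerivAt (0 : ℝ) hv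
    have hv2 := hN.comp_hasDerivAt (0 : ℝ) hv
    -- The variation of t - r* is dw applied to U Lbar, that is, U times the ∂_w component 2/ρ of
    -- Lbar from `base_a₂`. This recovers U from `dS w`.
    have hw : HasDerivAt (fun s => (varMap Φ T ξ s x).1 - rs ‖(varMap Φ T ξ s x).2‖) _ 0 :=
      hv1.sub ((hrs _ hmem).comp (0 : ℝ) hv2)
    have hLb0 : varLbar Φ T ξ ψ 0 x = deriv (fun τ => Φ τ x) 0 := by
      rw [varLbar, hV.T_zero x hx, hV.ξ_zero x hx, hV.ψ_zero x hx, one_smul]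
    have ha := H.base_a₂ hx
    simp only [radialExt_of_norm_one _ hx, hLb0, compW] at ha
    have hd := hα x hx
    simp only [dS, radialExt_of_norm_one _ hx] at hd
    rw [hw.deriv, map_smul, map_smul, hNA] at hd
    have h2 : U x * (2 / ρ x) = α₀ + ∑ i, α i * x i := by
      rw [← hd, ← ha]
      simp only [ContinuousLinearMap.coe_fst', smul_eq_mul]
      ring
    have h3 : ∑ i, α i / 2 * x i = (∑ i, α i * x i) / 2 := by
      rw [Finset.sum_div]
      exact Finset.sum_congr rfl fun i _ => by ring
    have := (hpos x hx).ne'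
    rw [h3]
    field_simp at h2
    linarith
  by_cases hS : IsSpaceFormAlong f ρ
  · exact Or.inr ⟨hS, fun x => α₀ / 2 + ∑ i, α i / 2 * x i,
      ⟨α₀ / 2, fun i => α i / 2, fun x _ => rfl⟩, hU⟩
  · left
    simp only [IsSpaceFormAlong, not_forall] at hS
    obtain ⟨x₀, hx₀, hne⟩ := hS
    -- If the inequality is strict at one point of Σ, the defect is nonzero there and the linear
    -- part of `dS w` must vanish.
    have hα0 : α = 0 := eq_zero_of_tangential hn hdef (rayConst_warpDefect f ρ) hx₀
      (continuousAt_warpDefect hf hρ hρI (ne_zero_of_norm_one hx₀)) (by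
        rw [warpDefect_eq hx₀ (hpos x₀ hx₀)]
        exact neg_ne_zero.2 (mul_ne_zero (pow_pos (hpos x₀ hx₀) 3).ne' hne))
    exact ⟨α₀ / 2, fun x hx => by rw [hU x hx, hα0]; simp [mul_comm]⟩

end

end StaticNullCone

end

theorem mainTheorem2 (n : ℕ) (hn : 3 ≤ n) (I : Set ℝ) (f : ℝ → ℝ)
    (hf : StaticNullCone.IsWarpingFactor I f)
    (rs : ℝ → ℝ) (hrs : ∀ r ∈ I, HasDerivAt rs (1 / f r ^ 2) r)
    (w₀ : ℝ) (ρ : StaticNullCone.Space n → ℝ)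
    (hρ : StaticNullCone.SphereSmooth ρ) (hρI : ∀ x, ‖x‖ = 1 → ρ x ∈ I) :
    StaticNullCone.InfinitesimallyRigid I f rs w₀ ρ := by
  exact StaticNullCone.infinitesimallyRigid hn hf hrs w₀ hρ hρI
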